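/- **Setting.** Let $N\ge1$, $T>0$, $\alpha<\beta$, $k\in\mathbb R^N$, $\mathbf A,\mathbf B\in\mathbb R^{N\times N}$, and let $\mathbf M=(m_0,\dots,m_{N-1})$ be a linear functional on $\mathbb R^N$ with $m_0\neq0$. For a continuous $g$ on $[0,\infty)$ and $t\ge 0$ put $X_t=\{t'\in(0,t]: g(t')\in\{\alpha,\beta\}\}$ and define the hysteresis operator by $\mathcal H(g)(t)=1$ if $X_t\ne\emptyset$ and $g(\max X_t)=\alpha$; $\mathcal H(g)(t)=-1$ if $X_t\neq\emptyset$ and $g(\max X_t)=\beta$; and, if $X_t=\emptyset$, $\mathcal H(g)(t)=1$ when $g(0)<\beta$ and $\mathcal H(g)(t)=-1$ when $g(0)\ge\beta$. A switching time of $g$ is a point $t>0$ at which $\mathcal H(g)$ is discontinuous. Let $0<s<1$, $1<p<\min\{\frac1s,\frac1{1-s}\}$, $0<\sigma\le \frac T3$. Let $\mathbb B$ be the space of all $\varphi\in L_p((-2T,0);\mathbb R^N)$ whose restriction to $(-T-\sigma,0)$ belongs to the Sobolev--Slobodeckij space $W^s_p$, with the norm $\|\varphi\|_{\mathbb B}=\|\varphi\|_{L_p(-2T,0)}+\|\varphi\|_{W^s_p(-T-\sigma,0)}$,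 where $\|\varphi\|_{W_p^s(a,b)}=\|\varphi\|_{L_p(a,b)}+\big(\int_a^b\int_a^b\frac{|\varphi(t)-\varphi(\xi)|^p}{|t-\xi|^{1+sp}}\,d\xi\,dt\big)^{1/p}$. Neighbourhoods and distances below are taken in $\mathbb B\times\mathbb R^N$. For $(\varphi,x)\in L_p((-2T,0);\mathbb R^N)\times\mathbb R^N$ let $u(\varphi,x;\cdot)$ be the solution of $$u'(t)=k\,\mathcal H(\mathbf Mu)(t)-\mathbf Bu(t)+\mathbf Au(t-2T)\ (t>0),\qquad u=\varphi\ \text{ on }(-2T,0),\qquad u(0+)=x,$$ i.e. for every $T_1>0$ one has $u\in L_p(-2T,T_1)$ and $u|_{(0,T_1)}\in W^1_p(0,T_1)$, and the equation and the condition on $(-2T,0)$ hold almost everywhere. Let $u_\pm(\varphi,x;\cdot)$ be the solution, in the same sense, of the problem in which $\mathcal H(\mathbf Mu)(t)$ is replaced by the constant $\pm1$. For such a function $u$ write $u^{[t]}=(u(t+\xi)|_{\xi\in(-2T,0)},u(t))$, $t\ge 0$, and $\gamma(u)=\{u^{[t]}:t\ge0\}$. **Periodic solution.** Let $(\varphi_\alpha,x_\alpha)\in\mathbb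 B\times\mathbb R^N$ be such that $u_{per}=u(\varphi_\alpha,x_\alpha;\cdot)$ is $2T$-periodic, i.e. $u_{per}^{[2T]}=(\varphi_\alpha,x_\alpha)$ and $\mathcal H(\mathbf Mu_{per})(2T)=\mathcal H(\mathbf Mu_{per})(0)$, and such that 1. $\mathbf Mx_\alpha=\alpha$; 2. the switching times of $\mathbf Mu_{per}$ in $(0,2T]$ are exactly $T$ and $2T$, with $\mathbf Mu_{per}(T)=\beta$ and $\mathbf Mu_{per}(2T)=\alpha$; 3. $\varphi_\alpha'(\theta)=-\varphi_\alpha'(\theta+T)$ for $\theta\in(-2T,-T)$ (the function $\varphi_\alpha$ is smooth on $[-2T,-T]$ and on $[-T,0]$ as a consequence of 1 and 2); 4. the left derivatives of $\mathbf Mu_{per}$ at $T$ and at $2T$ are non-zero. Let $\Gamma_1=\{u_{per}^{[t]}:t\in[0,T]\}$, $\Gamma_2=\{u_{per}^{[t]}:t\in[T,2T]\}$, $\Gamma=\Gamma_1\cup\Gamma_2$. The solution $u_{per}$ is called *orbitally stable* if for every neighbourhood $\Omega$ of $\Gamma$ there are neighbourhoods $\Omega_i$ of $\Gamma_i$ $(i=1,2)$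 such that $\gamma(u(\varphi,x;\cdot))\subset\Omega$ whenever either $(\varphi,x)\in\Omega_1$ and $\mathbf Mx<\beta$, or $(\varphi,x)\in\Omega_2$ and $\mathbf Mx\ge\beta$. It is *orbitally asymptotically stable* if, in addition, there are neighbourhoods $\Theta_i$ of $\Gamma_i$ such that, whenever either $(\varphi,x)\in\Theta_1$ and $\mathbf Mx<\beta$, or $(\varphi,x)\in\Theta_2$ and $\mathbf Mx\ge\beta$, the distance from $u^{[t]}$, $u=u(\varphi,x;\cdot)$, to $\Gamma$ tends to $0$ as $t\to\infty$. It is *orbitally unstable* if it is not orbitally stable. **Poincaré map.** Let $\mathbb T_c=\{(\varphi,x)\in\mathbb B\times\mathbb R^N:\mathbf Mx=c\}$ for $c\in\{\alpha,\beta\}$. For $\mathbf Mx<\beta$ let $\mathbf t_\beta(\varphi,x)\in(0,\infty]$ be the first time $t$ with $\mathbf Mu_+(\varphi,x;t)=\beta$ ($\infty$ if there is none), and for $\mathbf Mx>\alpha$ let $\mathbf t_\alpha(\varphi,x)\in(0,\infty]$ be the first time $t$ with $\mathbf Mu_-(\varphi,x;t)=\alpha$. The hit maps are $$\mathbf P_\beta(\varphi,x)=u_+(\varphi,x;\cdot)^{[\mathbf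 t_\beta(\varphi,x)]}\ \text{ on } \{(\varphi,x)\in\mathbb T_\alpha:\mathbf t_\beta(\varphi,x)<\infty\},\qquad \mathbf P_\alpha(\varphi,x)=u_-(\varphi,x;\cdot)^{[\mathbf t_\alpha(\varphi,x)]}\ \text{ on } \{(\varphi,x)\in\mathbb T_\beta:\mathbf t_\alpha(\varphi,x)<\infty\},$$ and the Poincaré map is $\mathbf P=\mathbf P_\alpha\circ\mathbf P_\beta$ on its natural domain $\mathrm{Dom}(\mathbf P)\subset\mathbb T_\alpha$. A fixed point $q$ of $\mathbf P$ is called *stable* if for every $\varepsilon>0$ there is $\delta>0$ such that for every $q'\in\mathbb T_\alpha$ with $\|q'-q\|\le\delta$ one has $\mathbf P^n(q')\in\mathrm{Dom}(\mathbf P)$ and $\|\mathbf P^n(q')-q\|\le\varepsilon$ for all $n\in\mathbb N$; it is *asymptotically stable* if, in addition, $\|\mathbf P^n(q')-q\|\to0$ as $n\to\infty$ for all these $q'$; it is *unstable* if it is not stable. **Theorem.** The point $(\varphi_\alpha,x_\alpha)$ is a fixed point of $\mathbf P$, and $u_{per}$ is orbitally asymptotically stable (respectively orbitally stable, orbitally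 unstable) if and only if $(\varphi_\alpha,x_\alpha)$ is an asymptotically stable (respectively stable, unstable) fixed point of $\mathbf P$. -/

import Mathlib

open MeasureTheory Set Filter Topology
open scoped ENNReal ContDiff

noncomputable section

namespace HystDelay

/-- The Euclidean space `ℝ^N`. -/
abbrev Vec (N : ℕ) := EuclideanSpace ℝ (Fin N)

/-- The Lebesgue measure on the interval `(a, b)`. -/
abbrev vol (a b : ℝ) : Measure ℝ := volume.restrict (Ioo a b)

/-! ### Hysteresis -/

/-- The points of `(0, t]` at which `g` takes one of the threshold values `α`, `β`. -/
def thresholdTimes (α β : ℝ) (g : ℝ → ℝ) (t : ℝ) : Set ℝ :=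
  {t' | t' ∈ Ioc 0 t ∧ (g t' = α ∨ g t' = β)}

open Classical in
/-- The non-ideal relay `𝓗(g)(t)`, `t ≥ 0`, with thresholds `α < β`. For `g` continuous on `[0, t]`
the set `thresholdTimes α β g t` contains its supremum as soon as it is non-empty, so that the
`sSup` below is its maximum. -/
def relay (α β : ℝ) (g : ℝ → ℝ) (t : ℝ) : ℝ :=
  if thresholdTimes α β g t = ∅ then (if g 0 < β then 1 else -1)
  else if g (sSup (thresholdTimes α β g t)) = α then 1 else -1

/-- A switching time: a positive time at which `𝓗(g)` is discontinuous. -/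
def IsSwitchingTime (α β : ℝ) (g : ℝ → ℝ) (t : ℝ) : Prop :=
  0 < t ∧ ¬ ContinuousAt (relay α β g) t

/-! ### Function spaces -/

/-- `g` is the weak derivative of `u` on `(a, b)`. -/
def HasWeakDeriv {N : ℕ} (a b : ℝ) (u g : ℝ → Vec N) : Prop :=
  ∀ η : ℝ → ℝ, ContDiff ℝ ∞ η → HasCompactSupport η → tsupport η ⊆ Ioo a b →
    ∫ t in Ioo a b, deriv η t • u t = - ∫ t in Ioo a b, η t • g t

/-- The Slobodeckij seminorm
`(∫_a^b ∫_a^b |φ(t) - φ(ξ)|^p / |t - ξ|^(1 + s p) dξ dt)^(1/p)`. -/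
def slobSeminorm {N : ℕ} (p s a b : ℝ) (φ : ℝ → Vec N) : ℝ≥0∞ :=
  (∫⁻ t in Ioo a b, ∫⁻ ξ in Ioo a b, ‖φ t - φ ξ‖ₑ ^ p / ‖t - ξ‖ₑ ^ (1 + s * p)) ^ (1 / p)

/-- The norm of the Sobolev--Slobodeckij space `W^s_p(a, b)` (infinite outside of the space). -/
def slobNorm {N : ℕ} (p s a b : ℝ) (φ : ℝ → Vec N) : ℝ≥0∞ :=
  eLpNorm φ (ENNReal.ofReal p) (vol a b) + slobSeminorm p s a b φ

/-! ### The problem -/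

/-- The constants of the equation `u'(t) = k 𝓗(M u)(t) - B u(t) + A u(t - 2T)` and of the function
spaces, with the standing conditions on them. -/
structure Setting (N : ℕ) [NeZero N] where
  /-- half of the delay -/
  T : ℝ
  /-- lower threshold -/
  α : ℝ
  /-- upper threshold -/
  β : ℝ
  /-- coefficients of the functional `M` -/
  m : Fin N → ℝ
  k : Vec N
  A : Matrix (Fin N) (Fin N) ℝ
  B : Matrix (Fin N) (Fin N) ℝ
  σ : ℝ
  p : ℝ
  s : ℝ
  T_pos : 0 < T
  α_lt_β : α < β
  m_zero : m 0 ≠ 0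
  σ_pos : 0 < σ
  σ_le : σ ≤ T / 3
  s_pos : 0 < s
  s_lt : s < 1
  p_gt : 1 < p
  p_lt : p < min (1 / s) (1 / (1 - s))

namespace Setting

variable {N : ℕ} [NeZero N] (S : Setting N)

/-- The linear functional `M = (m_0, …, m_{N-1})` on `ℝ^N`. -/
def M (x : Vec N) : ℝ := ∑ i, S.m i * x i

/-- `(φ, x)`, where `φ` is a function on `(-2T, 0)` representing its class modulo equality almost
everywhere (its values elsewhere play no role) and `x ∈ ℝ^N`. -/
abbrev State (_S : Setting N) := (ℝ → Vec N) × Vec N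

/-- The norm of `𝔹 = L_p(-2T, 0) ∩ W^s_p(-T-σ, 0)` (infinite outside of the space). -/
def bNorm (φ : ℝ → Vec N) : ℝ≥0∞ :=
  eLpNorm φ (ENNReal.ofReal S.p) (vol (-2 * S.T) 0) + slobNorm S.p S.s (-S.T - S.σ) 0 φ

/-- The phase space `𝔹 × ℝ^N`. -/
def phase : Set S.State :=
  {q | MemLp q.1 (ENNReal.ofReal S.p) (vol (-2 * S.T) 0) ∧
    slobNorm S.p S.s (-S.T - S.σ) 0 q.1 < ⊤}

/-- The distance in `𝔹 × ℝ^N`. It vanishes exactly for states that are equal almost everywhere. -/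
def sdist (q q' : S.State) : ℝ≥0∞ := S.bNorm (fun θ => q.1 θ - q'.1 θ) + ‖q.2 - q'.2‖ₑ

/-- The distance in `𝔹 × ℝ^N` from a point to a set. -/
def setDist (q : S.State) (G : Set S.State) : ℝ≥0∞ := ⨅ q' ∈ G, S.sdist q q'

/-- `Ω` is a neighbourhood of the set `G` in `𝔹 × ℝ^N`. -/
def IsNhd (Ω G : Set S.State) : Prop :=
  Ω ⊆ S.phase ∧ ∀ q ∈ G, ∃ ε : ℝ≥0∞, 0 < ε ∧ ∀ q' ∈ S.phase, S.sdist q' q < ε → q' ∈ Ω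

/-- `u ∈ L_p(-2T, T₁) ∩ W^1_p(0, T₁)` solves `u'(t) = h(t) k - B u(t) + A u(t - 2T)` on `(0, T₁)`
with initial data `q = (φ, x)`. On `[0, T₁]`, `u` is the continuous representative of its class, so
that `u 0` is the trace `u(0+)`. -/
structure SolvesOn (h : ℝ → ℝ) (q : S.State) (T₁ : ℝ) (u : ℝ → Vec N) : Prop where
  memLp : MemLp u (ENNReal.ofReal S.p) (vol (-2 * S.T) T₁)
  continuousOn : ContinuousOn u (Icc 0 T₁)
  initial : ∀ᵐ t ∂(vol (-2 * S.T) 0), u t = q.1 t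
  initial_zero : u 0 = q.2
  equation : ∃ g : ℝ → Vec N, MemLp g (ENNReal.ofReal S.p) (vol 0 T₁) ∧ HasWeakDeriv 0 T₁ u g ∧
    ∀ᵐ t ∂(vol 0 T₁),
      g t = h t • S.k - Matrix.toEuclideanLin S.B (u t)
        + Matrix.toEuclideanLin S.A (u (t - 2 * S.T))

/-- The hysteresis `𝓗(M u)(t)`. -/
def hyst (u : ℝ → Vec N) : ℝ → ℝ := relay S.α S.β (fun t => S.M (u t))

/-- `u` is the solution `u(φ, x; ·)` on `[-2T, ∞)` of the hysteresis-delay problem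
`u'(t) = k 𝓗(M u)(t) - B u(t) + A u(t - 2T)` with initial data `q = (φ, x)`. -/
def IsSolution (q : S.State) (u : ℝ → Vec N) : Prop :=
  ∀ T₁ > 0, S.SolvesOn (S.hyst u) q T₁ u

/-- `u` is a solution on `[-2T, ∞)` of the delay problem `u'(t) = c k - B u(t) + A u(t - 2T)` with
initial data `q = (φ, x)`; here `c = ± 1` is a frozen value of the hysteresis. -/
def IsFrozenSolution (c : ℝ) (q : S.State) (u : ℝ → Vec N) : Prop :=
  ∀ T₁ > 0, S.SolvesOn (fun _ => c) q T₁ u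

/-- The solution `u_±(φ, x; ·)` for the frozen value `c = ± 1` of the hysteresis. (This linear delay
problem has exactly one solution for every `φ ∈ L_p`, `x ∈ ℝ^N`.) -/
def frozen (c : ℝ) (q : S.State) : ℝ → Vec N :=
  Classical.epsilon (S.IsFrozenSolution c q)

/-- The state `(u(t + ξ)|_{ξ ∈ (-2T, 0)}, u(t))` of `u` at time `t`. -/
def stateAt (u : ℝ → Vec N) (t : ℝ) : S.State := (fun ξ => u (t + ξ), u t)

/-! ### Periodic solutions and their stability -/

/-- `u` is a `τ`-periodic solution with initial data `q = (φ, x)`. -/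
structure IsPeriodicSolution (τ : ℝ) (q : S.State) (u : ℝ → Vec N) : Prop where
  pos : 0 < τ
  solution : S.IsSolution q u
  value : u τ = q.2
  history : ∀ᵐ ξ ∂(vol (-2 * S.T) 0), u (τ + ξ) = q.1 ξ
  hysteresis : S.hyst u τ = S.hyst u 0

/-- `u` is a symmetric `2T`-periodic solution with transverse switching and with initial data
`q = (φ_α, x_α)`. In `symmetric`, `θ ↦ u(2T + θ)`, `θ ∈ (-2T, 0)`, is the piecewise smooth
representative of `φ_α`. -/
structure IsSymmetricPeriodic (q : S.State) (u : ℝ → Vec N) : Prop where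
  mem_phase : q ∈ S.phase
  periodic : S.IsPeriodicSolution (2 * S.T) q u
  start : S.M q.2 = S.α
  switching : ∀ t ∈ Ioc 0 (2 * S.T),
    IsSwitchingTime S.α S.β (fun r => S.M (u r)) t ↔ (t = S.T ∨ t = 2 * S.T)
  at_T : S.M (u S.T) = S.β
  at_two_T : S.M (u (2 * S.T)) = S.α
  symmetric : ∀ θ ∈ Ioo (-2 * S.T) (-S.T),
    deriv (fun r => u (2 * S.T + r)) θ = - deriv (fun r => u (2 * S.T + r)) (θ + S.T)
  transverse_T : derivWithin (fun t => S.M (u t)) (Iic S.T) S.T ≠ 0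
  transverse_two_T : derivWithin (fun t => S.M (u t)) (Iic (2 * S.T)) (2 * S.T) ≠ 0

/-- The orbit `γ(u)` of a solution. -/
def orbit (u : ℝ → Vec N) : Set S.State := {q | ∃ t : ℝ, 0 ≤ t ∧ q = S.stateAt u t}

/-- The part of the orbit of a periodic solution that corresponds to `t ∈ [0, T]`. -/
def Γ₁ (u : ℝ → Vec N) : Set S.State := S.stateAt u '' Icc 0 S.T

/-- The part of the orbit of a periodic solution that corresponds to `t ∈ [T, 2T]`. -/
def Γ₂ (u : ℝ → Vec N) : Set S.State := S.stateAt u '' Icc S.T (2 * S.T)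

/-- The orbit of a `2T`-periodic solution. -/
def Γ (u : ℝ → Vec N) : Set S.State := S.Γ₁ u ∪ S.Γ₂ u

/-- The initial data that lie in `Ω₁` if the hysteresis starts at `1` and in `Ω₂` if it starts
at `-1`. -/
def startIn (Ω₁ Ω₂ : Set S.State) : Set S.State :=
  {q | (q ∈ Ω₁ ∧ S.M q.2 < S.β) ∨ (q ∈ Ω₂ ∧ S.β ≤ S.M q.2)}

/-- Orbital stability of the periodic solution `u`. -/
def OrbitallyStable (u : ℝ → Vec N) : Prop :=
  ∀ Ω, S.IsNhd Ω (S.Γ u) → ∃ Ω₁ Ω₂, S.IsNhd Ω₁ (S.Γ₁ u) ∧ S.IsNhd Ω₂ (S.Γ₂ u) ∧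
    ∀ q ∈ S.startIn Ω₁ Ω₂, ∀ v, S.IsSolution q v → S.orbit v ⊆ Ω

/-- Orbital asymptotic stability of the periodic solution `u`. -/
def OrbitallyAsymptoticallyStable (u : ℝ → Vec N) : Prop :=
  S.OrbitallyStable u ∧ ∃ Θ₁ Θ₂, S.IsNhd Θ₁ (S.Γ₁ u) ∧ S.IsNhd Θ₂ (S.Γ₂ u) ∧
    ∀ q ∈ S.startIn Θ₁ Θ₂, ∀ v, S.IsSolution q v →
      Tendsto (fun t : ℝ => S.setDist (S.stateAt v t) (S.Γ u)) atTop (𝓝 0)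

/-- Orbital instability of the periodic solution `u`. -/
def OrbitallyUnstable (u : ℝ → Vec N) : Prop := ¬ S.OrbitallyStable u

/-! ### Hit maps and the Poincaré map -/

/-- The cross-section `{(φ, x) ∈ 𝔹 × ℝ^N : M x = c}`, for `c = α` or `c = β`. -/
def crossSection (c : ℝ) : Set S.State := {q | q ∈ S.phase ∧ S.M q.2 = c}

/-- The first time (infinite if there is none) at which `M v` takes the value `c`. -/
def firstHit (v : ℝ → Vec N) (c : ℝ) : ℝ≥0∞ :=
  ⨅ τ ∈ {τ : ℝ | 0 < τ ∧ S.M (v τ) = c ∧ ∀ t ∈ Ico 0 τ, S.M (v t) ≠ c}, ENNReal.ofReal τ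

/-- The hit time `t_β(φ, x)`, of interest for `M x < β`. -/
def hitTimeβ (q : S.State) : ℝ≥0∞ := S.firstHit (S.frozen 1 q) S.β

/-- The hit time `t_α(φ, x)`, of interest for `M x > α`. -/
def hitTimeα (q : S.State) : ℝ≥0∞ := S.firstHit (S.frozen (-1) q) S.α

/-- The domain of the hit map `P_β`. -/
def domβ : Set S.State := {q | q ∈ S.crossSection S.α ∧ S.hitTimeβ q < ⊤}

/-- The hit map `P_β`; only its values on `domβ` are of interest. -/
def Pβ (q : S.State) : S.State := S.stateAt (S.frozen 1 q) (S.hitTimeβ q).toReal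

/-- The domain of the hit map `P_α`. -/
def domα : Set S.State := {q | q ∈ S.crossSection S.β ∧ S.hitTimeα q < ⊤}

/-- The hit map `P_α`; only its values on `domα` are of interest. -/
def Pα (q : S.State) : S.State := S.stateAt (S.frozen (-1) q) (S.hitTimeα q).toReal

/-- The domain of the Poincaré map. -/
def domP : Set S.State := {q | q ∈ S.domβ ∧ S.Pβ q ∈ S.domα}

/-- The Poincaré map `P = P_α ∘ P_β`; only its values on `domP` are of interest. -/
def P (q : S.State) : S.State := S.Pα (S.Pβ q)

/-- `q` is a fixed point of the Poincaré map (as an element of `𝔹 × ℝ^N`, hence up to equality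
almost everywhere). -/
def IsFixedPoint (q : S.State) : Prop := q ∈ S.domP ∧ S.sdist (S.P q) q = 0

/-- Stability of the fixed point `q` of the Poincaré map. -/
def StableFixedPoint (q : S.State) : Prop :=
  ∀ ε : ℝ≥0∞, 0 < ε → ∃ δ : ℝ≥0∞, 0 < δ ∧
    ∀ q' ∈ S.crossSection S.α, S.sdist q' q ≤ δ →
      ∀ n : ℕ, S.P^[n] q' ∈ S.domP ∧ S.sdist (S.P^[n] q') q ≤ ε

/-- Asymptotic stability of the fixed point `q` of the Poincaré map. -/
def AsymptoticallyStableFixedPoint (q : S.State) : Prop :=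
  ∀ ε : ℝ≥0∞, 0 < ε → ∃ δ : ℝ≥0∞, 0 < δ ∧
    ∀ q' ∈ S.crossSection S.α, S.sdist q' q ≤ δ →
      (∀ n : ℕ, S.P^[n] q' ∈ S.domP ∧ S.sdist (S.P^[n] q') q ≤ ε) ∧
        Tendsto (fun n : ℕ => S.sdist (S.P^[n] q') q) atTop (𝓝 0)

/-- Instability of the fixed point `q` of the Poincaré map. -/
def UnstableFixedPoint (q : S.State) : Prop := ¬ S.StableFixedPoint q

end Setting

end HystDelay

end

/-!
Both directions rest on two facts. First, near the periodic orbit the problem with hysteresis is a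
sequence of linear delay problems with the constant inputs `1` and `-1`, joined at the first hits of
the thresholds. Second, for these linear problems the state at time `t` depends Lipschitz-continuously
on the initial data in `𝔹 × ℝ^N`, uniformly for `t ∈ [0, 2T]` (`exists_sdist_stateAt_le`).

The second fact is the analytic core. In `L_p` and at the value it is Grönwall's inequality for the
integral form of the equation (`solvesOn_iff` identifies the two forms). For the Slobodeckij norm one
has to concatenate a history in `W^s_p` with a solution in `W^1_p` although the two need not match at
`0`. This is possible since `s p < 1`: the interaction term is bounded by the fractional Hardy
inequality (`hardy`, `slobSeminorm_concat`).

The two halves of the periodic solution extend to solutions `W₁`, `W₂` with constant input that are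
Lipschitz on `[-2T, 2T]` and cross their thresholds at time `T` with non-zero derivative
(`IsSymmetricPeriodic.exists_isCycle`); the Lipschitz bound makes `t ↦ W(t + ·)` continuous in the
phase space (`IsLip.exists_sdist_le`). By transversality a solution that starts near a state of `W₁`
or `W₂` first hits the threshold at nearly the same time and follows it until then
(`exists_half_cycle`). As the relay is causal, keeps its value between thresholds and restarts at
each of them (`relay_add`, `IsSolution.eq_of_first_hit_β`, `IsSolution.eq_of_first_hit_α`), the
successive returns of a solution to the cross-section `{M x = α}` are the iterates of the Poincaré
map, each return takes at least the time `T / 2`, and the solution is near the cycle in between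
whenever the returns are near the fixed point (`IsCycle.exists_nearCycle_of_iterates`).

Conversely, the points of the cross-section near the cycle lie near its first half, because `M`
exceeds `α` on the second half except at its end; hence the Poincaré map takes them near the fixed
point, and the returns of a solution that stays near the cycle are near the fixed point
(`IsCycle.exists_returns_of_nearCycle`). Here one needs that every initial state admits a global
solution (`exists_isSolution`), since orbital stability speaks of existing solutions only. That the
neighbourhoods in the definition of orbital stability can be replaced by uniform ones is compactness
of the two arcs (`IsLip.exists_uniform_nhd`).
-/

noncomputable section

namespace HystDelay

/-! ### Primitives, weak derivatives and Grönwall's inequality -/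

/-- Grönwall's inequality in integral form. -/
theorem gronwall_integral {f : ℝ → ℝ} {C K T₁ : ℝ} (hK : 0 ≤ K)
    (hf : ContinuousOn f (Icc 0 T₁)) (hf0 : ∀ t ∈ Icc 0 T₁, 0 ≤ f t)
    (h : ∀ t ∈ Icc 0 T₁, f t ≤ C + K * ∫ r in (0 : ℝ)..t, f r) :
    ∀ t ∈ Icc 0 T₁, f t ≤ C * Real.exp (K * t) := by
  intro t ht
  have hint : ∀ x ∈ Icc 0 T₁, IntervalIntegrable f volume 0 x := fun x hx =>
    (hf.mono (by rw [uIcc_of_le hx.1]; exact Icc_subset_Icc_right hx.2)).intervalIntegrable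
  have hY0 : ∀ x ∈ Icc 0 T₁, 0 ≤ ∫ r in (0 : ℝ)..x, f r := fun x hx =>
    intervalIntegral.integral_nonneg hx.1 fun r hr => hf0 r ⟨hr.1, hr.2.trans hx.2⟩
  -- the differential form, for the primitive of `f`
  have key := norm_le_gronwallBound_of_norm_deriv_right_le
    (f := fun x => ∫ r in (0 : ℝ)..x, f r) (f' := f) (δ := 0) (K := K) (ε := C) (a := 0) (b := T₁)
    ?_ ?_ (by simp) ?_ t ht
  · rw [sub_zero, Real.norm_of_nonneg (hY0 t ht)] at key
    refine (h t ht).trans ?_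
    have h1 := mul_le_mul_of_nonneg_left key hK
    rcases eq_or_lt_of_le hK with hK0 | hK0
    · simp [← hK0]
    · rw [gronwallBound_of_K_ne_0 hK0.ne'] at h1
      have : K * (0 * Real.exp (K * t) + C / K * (Real.exp (K * t) - 1))
          = C * Real.exp (K * t) - C := by field_simp; ring
      linarith
  · have := intervalIntegral.continuousOn_primitive_interval (f := f) (μ := volume) (a := 0)
      (b := T₁) (by
        rcases le_or_gt 0 T₁ with h0 | h0
        · exact (hf.mono (by rw [uIcc_of_le h0])).integrableOn_compact isCompact_uIcc
        · exact absurd (ht.1.trans ht.2) (not_le.2 h0))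
    exact this.mono (by rw [uIcc_of_le (ht.1.trans ht.2)])
  · intro x hx
    have hx' : x ∈ Icc 0 T₁ := ⟨hx.1, hx.2.le⟩
    have hmem : Icc 0 T₁ ∈ 𝓝[>] x :=
      mem_of_superset (Ioo_mem_nhdsGT hx.2) fun y hy => ⟨hx.1.trans hy.1.le, hy.2.le⟩
    refine intervalIntegral.integral_hasDerivWithinAt_right (hint x hx') (t := Ioi x) ?_ ?_
    · exact ⟨Icc 0 T₁, hmem, hf.aestronglyMeasurable measurableSet_Icc⟩
    · refine (hf x hx').mono_of_mem_nhdsWithin ?_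
      exact hmem
  · intro x hx
    have hx' : x ∈ Icc 0 T₁ := ⟨hx.1, hx.2.le⟩
    rw [Real.norm_of_nonneg (hf0 x hx'), Real.norm_of_nonneg (hY0 x hx')]
    linarith [h x hx']

variable {N : ℕ}

/-- A primitive of an integrable function has that function as its weak derivative. -/
theorem hasWeakDeriv_of_primitive {T₁ : ℝ} {u g : ℝ → Vec N}
    (hg : IntegrableOn g (Ioo 0 T₁))
    (hu : ∀ t ∈ Icc 0 T₁, u t = u 0 + ∫ r in (0 : ℝ)..t, g r) : HasWeakDeriv 0 T₁ u g := by
  intro η hη hc hs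
  have hdc : Continuous (deriv η) := hη.continuous_deriv (by simp)
  have hdη : ∀ x, HasDerivAt η (deriv η x) x := fun x =>
    (hη.differentiable (by simp) x).hasDerivAt
  have hη0 : ∀ x, x ∉ Ioo 0 T₁ → η x = 0 := fun x hx =>
    image_eq_zero_of_notMem_tsupport fun h => hx (hs h)
  have hint : ∀ a b : ℝ, ∫ t in a..b, deriv η t = η b - η a := fun a b =>
    intervalIntegral.integral_eq_sub_of_hasDerivAt (fun x _ => hdη x)
      (hdc.intervalIntegrable _ _)
  rcases le_or_gt T₁ 0 with hT | hT
  · simp [Ioo_eq_empty (not_lt.2 hT)]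
  obtain ⟨C, hC⟩ := (hc.deriv).exists_bound_of_continuous hdc
  -- Fubini's theorem for `η'(t) g(r)` on the triangle `r < t`
  set k : ℝ × ℝ → Vec N := fun z => deriv η z.1 • ({z : ℝ × ℝ | z.2 < z.1}.indicator
    (fun z => g z.2) z) with hk
  have hset : MeasurableSet {z : ℝ × ℝ | z.2 < z.1} := measurableSet_lt measurable_snd measurable_fst
  have hkint : Integrable k ((volume.restrict (Ioo 0 T₁)).prod (volume.restrict (Ioo 0 T₁))) := by
    have h1 : Integrable (fun z : ℝ × ℝ => g z.2)
        ((volume.restrict (Ioo 0 T₁)).prod (volume.restrict (Ioo 0 T₁))) :=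
      Integrable.comp_snd hg _
    exact (h1.indicator hset).bdd_smul C
      (hdc.comp continuous_fst).aestronglyMeasurable (ae_of_all _ fun z => hC z.1)
  have hL : ∫ t in Ioo 0 T₁, deriv η t • u t
      = ∫ t in Ioo 0 T₁, (deriv η t • u 0 + ∫ r in Ioo 0 T₁, k (t, r)) := by
    refine setIntegral_congr_fun measurableSet_Ioo fun t ht => ?_
    simp only [hk]
    rw [integral_smul, hu t ⟨ht.1.le, ht.2.le⟩, smul_add]
    congr 2
    rw [intervalIntegral.integral_of_le ht.1.le, ← integral_Ioc_eq_integral_Ioo,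
      integral_Ioc_eq_integral_Ioo, integral_Ioc_eq_integral_Ioo]
    have : ∀ r, ({z : ℝ × ℝ | z.2 < z.1}.indicator (fun z => g z.2) (t, r))
        = (Iio t).indicator g r := by
      intro r; by_cases h : r < t <;> simp [indicator, h]
    simp only [this]
    rw [setIntegral_indicator measurableSet_Iio]
    congr 2
    ext r; simp; intro _ h; linarith [ht.2]
  have hI : IntegrableOn (fun t => deriv η t • u 0) (Ioo 0 T₁) :=
    ((hdc.smul continuous_const).integrableOn_Icc (a := 0) (b := T₁)).mono_set Ioo_subset_Icc_self
  rw [hL, integral_add hI hkint.integral_prod_left, integral_smul_const,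
    ← integral_Ioc_eq_integral_Ioo, ← intervalIntegral.integral_of_le hT.le, hint,
    hη0 T₁ (by simp), hη0 0 (by simp), sub_zero, zero_smul, zero_add,
    integral_integral_swap hkint, ← integral_neg]
  refine setIntegral_congr_fun measurableSet_Ioo fun r hr => ?_
  have : ∀ t, k (t, r) = (Ioi r).indicator (deriv η) t • g r := by
    intro t; by_cases h : r < t <;> simp [hk, indicator, h]
  simp only [this]
  rw [integral_smul_const, setIntegral_indicator measurableSet_Ioi]
  have h2 : Ioo 0 T₁ ∩ Ioi r = Ioo r T₁ := by
    ext t; simp; constructor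
    · rintro ⟨⟨_, h⟩, h'⟩; exact ⟨h', h⟩
    · rintro ⟨h, h'⟩; exact ⟨⟨hr.1.trans h, h'⟩, h⟩
  rw [h2, ← integral_Ioc_eq_integral_Ioo, ← intervalIntegral.integral_of_le hr.2.le, hint,
    hη0 T₁ (by simp), zero_sub, neg_smul]

/-- The du Bois-Reymond lemma: a continuous function with weak derivative `g` is a primitive
of `g`. -/
theorem primitive_of_hasWeakDeriv {T₁ : ℝ} (hT : 0 < T₁) {u g : ℝ → Vec N}
    (hc : ContinuousOn u (Icc 0 T₁)) (hg : IntegrableOn g (Ioo 0 T₁))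
    (hw : HasWeakDeriv 0 T₁ u g) :
    ∀ t ∈ Icc 0 T₁, u t = u 0 + ∫ r in (0 : ℝ)..t, g r := by
  have hgI : IntegrableOn g (Icc 0 T₁) := (integrableOn_Icc_iff_integrableOn_Ioo).2 hg
  set G : ℝ → Vec N := fun t => ∫ r in (0 : ℝ)..t, g r with hG
  have hGc : ContinuousOn G (Icc 0 T₁) := by
    have := intervalIntegral.continuousOn_primitive_interval (f := g) (μ := volume) (a := 0)
      (b := T₁) (by rwa [uIcc_of_le hT.le])
    rwa [uIcc_of_le hT.le] at this
  have hGw : HasWeakDeriv 0 T₁ G g := hasWeakDeriv_of_primitive hg fun t _ => by simp [hG]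
  set w : ℝ → Vec N := fun t => u t - G t with hwdef
  have hwc : ContinuousOn w (Icc 0 T₁) := hc.sub hGc
  have hbd : ∀ (f : ℝ → ℝ) (v : ℝ → Vec N), Continuous f → ContinuousOn v (Icc 0 T₁) →
      IntegrableOn (fun t => f t • v t) (Ioo 0 T₁) := fun f v hf hv =>
    ((hf.continuousOn.smul hv).integrableOn_Icc).mono_set Ioo_subset_Icc_self
  have hw0 : ∀ η : ℝ → ℝ, ContDiff ℝ ∞ η → HasCompactSupport η → tsupport η ⊆ Ioo 0 T₁ →
      ∫ t in Ioo 0 T₁, deriv η t • w t = 0 := by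
    intro η h1 h2 h3
    have hdc : Continuous (deriv η) := h1.continuous_deriv (by simp)
    simp only [hwdef, smul_sub]
    rw [integral_sub (hbd _ _ hdc hc) (hbd _ _ hdc hGc), hw η h1 h2 h3, hGw η h1 h2 h3, sub_self]
  -- a test function of integral one
  obtain ⟨ρ, hρ, hρc, hρs, hρi⟩ : ∃ ρ : ℝ → ℝ, ContDiff ℝ ∞ ρ ∧ HasCompactSupport ρ ∧
      tsupport ρ ⊆ Ioo 0 T₁ ∧ ∫ t, ρ t = 1 := by
    let b : ContDiffBump (T₁ / 2) := ⟨T₁ / 8, T₁ / 4, by positivity, by linarith⟩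
    refine ⟨b.normed volume, b.contDiff_normed, b.hasCompactSupport_normed, ?_,
      b.integral_normed⟩
    rw [b.tsupport_normed_eq, Real.closedBall_eq_Icc]
    intro x hx
    constructor <;> [have := hx.1; have := hx.2] <;> dsimp [b] at this <;> linarith
  set c : Vec N := ∫ t in Ioo 0 T₁, ρ t • w t with hcdef
  have hae : ∀ᵐ x ∂(volume : Measure ℝ), x ∈ Ioo 0 T₁ → w x - c = 0 := by
    refine isOpen_Ioo.ae_eq_zero_of_integral_contDiff_smul_eq_zero
      (((hwc.sub continuousOn_const).mono Ioo_subset_Icc_self).locallyIntegrableOn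
        measurableSet_Ioo) ?_
    intro ζ hζ hζc hζs
    have hζ0 : ∀ x, x ∉ Ioo 0 T₁ → ζ x = 0 := fun x hx =>
      image_eq_zero_of_notMem_tsupport fun h => hx (hζs h)
    have hρ0 : ∀ x, x ∉ Ioo 0 T₁ → ρ x = 0 := fun x hx =>
      image_eq_zero_of_notMem_tsupport fun h => hx (hρs h)
    set I : ℝ := ∫ t, ζ t with hI
    -- `ψ` has mean zero, so that its primitive `η` is a test function
    set ψ : ℝ → ℝ := fun t => ζ t - I * ρ t with hψ
    have hψs : ContDiff ℝ ∞ ψ := hζ.sub (contDiff_const.mul hρ)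
    have hψc : Continuous ψ := hψs.continuous
    set η : ℝ → ℝ := fun t => ∫ r in (0 : ℝ)..t, ψ r with hη
    have hηd : ∀ x, HasDerivAt η (ψ x) x := fun x =>
      intervalIntegral.integral_hasDerivAt_right (hψc.intervalIntegrable _ _)
        hψc.stronglyMeasurable.stronglyMeasurableAtFilter hψc.continuousAt
    have hder : deriv η = ψ := funext fun x => (hηd x).deriv
    have hηs : ContDiff ℝ ∞ η := by
      rw [contDiff_infty_iff_deriv]
      exact ⟨fun x => (hηd x).differentiableAt, by rw [hder]; exact hψs⟩
    -- the supports of `ζ` and `ρ` lie in a smaller compact interval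
    obtain ⟨a, b, ha, hb, hab⟩ : ∃ a b, 0 < a ∧ b < T₁ ∧ tsupport ζ ∪ tsupport ρ ⊆ Icc a b := by
      have hK : IsCompact (tsupport ζ ∪ tsupport ρ) := hζc.union hρc
      have hne : (tsupport ζ ∪ tsupport ρ).Nonempty := by
        by_contra h
        rw [not_nonempty_iff_eq_empty, union_empty_iff] at h
        have : ρ = 0 := tsupport_eq_empty_iff.1 h.2
        simp [this] at hρi
      have hsub : tsupport ζ ∪ tsupport ρ ⊆ Ioo 0 T₁ := union_subset hζs hρs
      exact ⟨sInf _, sSup _, (hsub (hK.sInf_mem hne)).1, (hsub (hK.sSup_mem hne)).2,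
        fun x hx => ⟨csInf_le hK.bddBelow hx, le_csSup hK.bddAbove hx⟩⟩
    have hψ0 : ∀ x, x ∉ Icc a b → ψ x = 0 := by
      intro x hx
      have h1 : x ∉ tsupport ζ := fun h => hx (hab (Or.inl h))
      have h2 : x ∉ tsupport ρ := fun h => hx (hab (Or.inr h))
      simp [hψ, image_eq_zero_of_notMem_tsupport h1, image_eq_zero_of_notMem_tsupport h2]
    have hψi : ∫ t, ψ t = 0 := by
      simp only [hψ]
      rw [integral_sub (hζ.continuous.integrable_of_hasCompactSupport hζc)
        ((hρ.continuous.integrable_of_hasCompactSupport hρc).const_mul I), integral_const_mul,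
        hρi, mul_one, sub_self]
    have hη0 : ∀ x, x ∉ Icc a b → η x = 0 := by
      intro x hx
      rcases lt_or_ge x a with hxa | hxa
      · simp only [hη]
        rw [intervalIntegral.integral_symm, intervalIntegral.integral_zero_ae, neg_zero]
        refine ae_of_all _ fun y hy => hψ0 y fun h => ?_
        rcases le_total x 0 with h0 | h0
        · rw [uIoc_of_le h0] at hy; linarith [h.1, hy.2]
        · rw [uIoc_of_ge h0] at hy; linarith [h.1, hy.2]
      · have hxb : b < x := by
          by_contra h; exact hx ⟨hxa, not_lt.1 h⟩
        simp only [hη]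
        rw [intervalIntegral.integral_of_le (ha.le.trans hxa)]
        refine (setIntegral_eq_integral_of_forall_compl_eq_zero fun y hy =>
          hψ0 y fun h => hy ?_).trans hψi
        exact ⟨ha.trans_le h.1, h.2.trans hxb.le⟩
    have hηts : tsupport η ⊆ Icc a b :=
      closure_minimal (fun x hx => by by_contra h; exact hx (hη0 x h)) isClosed_Icc
    have hηcs : HasCompactSupport η := isCompact_Icc.of_isClosed_subset (isClosed_tsupport _) hηts
    have h0 := hw0 η hηs hηcs (hηts.trans fun x hx => ⟨ha.trans_le hx.1, hx.2.trans_lt hb⟩)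
    rw [hder] at h0
    simp only [hψ, sub_smul, mul_smul] at h0
    have hρI : IntegrableOn (fun t => I • ρ t • w t) (Ioo 0 T₁) :=
      (hbd _ _ hρ.continuous hwc).smul I
    rw [integral_sub (hbd _ _ hζ.continuous hwc) hρI,
      integral_smul, ← hcdef] at h0
    have hIs : I = ∫ t in Ioo 0 T₁, ζ t :=
      (setIntegral_eq_integral_of_forall_compl_eq_zero hζ0).symm
    rw [← setIntegral_eq_integral_of_forall_compl_eq_zero (s := Ioo 0 T₁)
      (fun x hx => by simp [hζ0 x hx])]
    simp only [smul_sub]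
    rw [integral_sub (hbd _ _ hζ.continuous hwc) (hbd _ _ hζ.continuous continuousOn_const),
      integral_smul_const, ← hIs]
    exact h0
  have hEq : EqOn w (fun _ => c) (Icc 0 T₁) := by
    have h1 : w =ᵐ[volume.restrict (Ioo 0 T₁)] fun _ => c := by
      filter_upwards [(ae_restrict_iff' measurableSet_Ioo).2 hae] with x hx
      exact sub_eq_zero.1 hx
    have h2 : EqOn w (fun _ => c) (Ioo 0 T₁) :=
      Measure.eqOn_open_of_ae_eq h1 isOpen_Ioo (hwc.mono Ioo_subset_Icc_self) continuousOn_const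
    refine h2.of_subset_closure hwc continuousOn_const Ioo_subset_Icc_self ?_
    rw [closure_Ioo hT.ne]
  intro t ht
  have h1 := hEq ht
  have h2 := hEq (left_mem_Icc.2 hT.le)
  have h3 : G 0 = 0 := by simp [hG]
  simp only [hwdef, h3, sub_zero] at h1 h2
  rw [h2, ← h1]; simp [hG]

/-! ### Restrictions of Lebesgue measure to intervals -/

section Intervals

variable {E : Type*} [NormedAddCommGroup E]

theorem measurePreserving_vol_add (a b s : ℝ) :
    MeasurePreserving (fun r => r + s) (vol (a - s) (b - s)) (vol a b) := by
  have h := (measurePreserving_add_right volume s).restrict_preimage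
    (measurableSet_Ioo (a := a) (b := b))
  simpa using h

theorem memLp_vol_add {v : ℝ → E} {p : ℝ≥0∞} {a b s : ℝ} (h : MemLp v p (vol a b)) :
    MemLp (fun r => v (r + s)) p (vol (a - s) (b - s)) :=
  h.comp_measurePreserving (measurePreserving_vol_add a b s)

theorem ae_vol_add {P : ℝ → Prop} {a b s : ℝ} (h : ∀ᵐ r ∂vol a b, P r) :
    ∀ᵐ r ∂vol (a - s) (b - s), P (r + s) :=
  (measurePreserving_vol_add a b s).quasiMeasurePreserving.ae h

theorem ae_vol_mono {P : ℝ → Prop} {a b a' b' : ℝ} (ha : a ≤ a') (hb : b' ≤ b)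
    (h : ∀ᵐ r ∂vol a b, P r) : ∀ᵐ r ∂vol a' b', P r :=
  ae_restrict_of_ae_restrict_of_subset (Ioo_subset_Ioo ha hb) h

theorem memLp_vol_mono {v : ℝ → E} {p : ℝ≥0∞} {a b a' b' : ℝ} (ha : a ≤ a') (hb : b' ≤ b)
    (h : MemLp v p (vol a b)) : MemLp v p (vol a' b') :=
  h.mono_measure (Measure.restrict_mono (Ioo_subset_Ioo ha hb) le_rfl)

/-- The point `b` has measure zero. -/
theorem vol_ae_eq_union {a b c : ℝ} (hab : a ≤ b) (hbc : b ≤ c) :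
    vol a c = vol a b + vol b c := by
  rw [vol, vol, vol, ← Measure.restrict_union (by
    rw [Set.disjoint_left]; intro x hx hx'; exact lt_asymm hx.2 hx'.1) measurableSet_Ioo]
  rcases eq_or_lt_of_le hab with rfl | hab
  · simp
  rcases eq_or_lt_of_le hbc with rfl | hbc
  · simp
  refine Measure.restrict_congr_set ?_
  have h1 : (Ioo a b ∪ Ioo b c : Set ℝ) =ᵐ[volume] (Ioc a b ∪ Ioo b c : Set ℝ) :=
    Ioo_ae_eq_Ioc.union (ae_eq_refl _)
  rw [Ioc_union_Ioo_eq_Ioo hab.le hbc] at h1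
  exact h1.symm

theorem ae_vol_union {P : ℝ → Prop} {a b c : ℝ} (hab : a ≤ b) (hbc : b ≤ c)
    (h1 : ∀ᵐ r ∂vol a b, P r) (h2 : ∀ᵐ r ∂vol b c, P r) : ∀ᵐ r ∂vol a c, P r := by
  rw [vol_ae_eq_union hab hbc]; exact ae_add_measure_iff.2 ⟨h1, h2⟩

theorem memLp_vol_union {v : ℝ → E} {p : ℝ≥0∞} {a b c : ℝ} (hab : a ≤ b) (hbc : b ≤ c)
    (h1 : MemLp v p (vol a b)) (h2 : MemLp v p (vol b c)) : MemLp v p (vol a c) := by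
  have hs : MeasurableSet (Iio b) := measurableSet_Iio
  have e1 : (vol a c).restrict (Iio b) = vol a b := by
    rw [vol, Measure.restrict_restrict hs]
    congr 1; ext x; simp; constructor
    · rintro ⟨h, h', _⟩; exact ⟨h', h⟩
    · rintro ⟨h, h'⟩; exact ⟨h', h, h'.trans_le hbc⟩
  have e2 : (vol a c).restrict (Iio b)ᶜ = vol b c := by
    rw [vol, Measure.restrict_restrict hs.compl]
    refine Measure.restrict_congr_set ?_
    rcases eq_or_lt_of_le hab with rfl | hab
    · have : (Iio a)ᶜ ∩ Ioo a c = Ioo a c := by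
        ext x; simp; intro h _; exact h.le
      exact Eventually.of_forall fun x => by rw [this]
    · have : (Iio b)ᶜ ∩ Ioo a c = Ico b c := by
        ext x; simp; intro h _; exact hab.trans_le h
      rw [this]; exact Ioo_ae_eq_Ico.symm
  have := MemLp.piecewise (μ := vol a c) (s := Iio b) hs (by rwa [e1]) (by rwa [e2] : MemLp v p _)
  simpa using this

theorem memLp_of_continuousOn_Icc {v : ℝ → E} {p : ℝ≥0∞} {a b : ℝ}
    (h : ContinuousOn v (Icc a b)) : MemLp v p (vol a b) := by
  obtain ⟨C, hC⟩ := isCompact_Icc.exists_bound_of_continuousOn h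
  refine MemLp.of_bound ?_ C ?_
  · exact (h.mono Ioo_subset_Icc_self).aestronglyMeasurable measurableSet_Ioo
  · exact (ae_restrict_iff' measurableSet_Ioo).2 (ae_of_all _ fun x hx => hC x (Ioo_subset_Icc_self hx))

theorem intervalIntegrable_of_vol {v : ℝ → E} {T₁ a b : ℝ}
    (h : Integrable v (vol 0 T₁)) (ha : a ∈ Icc 0 T₁) (hb : b ∈ Icc 0 T₁) :
    IntervalIntegrable v volume a b := by
  have : IntegrableOn v (Icc 0 T₁) := (integrableOn_Icc_iff_integrableOn_Ioo).2 h
  refine (this.mono_set ?_).intervalIntegrable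
  exact uIcc_subset_Icc ha hb

end Intervals

namespace Setting

variable {N : ℕ} [NeZero N] (S : Setting N)

/-! ### The integral form of the delay equation -/

theorem one_le_p : (1 : ℝ≥0∞) ≤ ENNReal.ofReal S.p := by
  rw [← ENNReal.ofReal_one]; exact ENNReal.ofReal_le_ofReal S.p_gt.le

/-- The right-hand side `h k - B v + A v(· - 2T)` of the equation. -/
def rhs (h : ℝ → ℝ) (v : ℝ → Vec N) (r : ℝ) : Vec N :=
  h r • S.k - Matrix.toEuclideanLin S.B (v r) + Matrix.toEuclideanLin S.A (v (r - 2 * S.T))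

/-- The integral form of `SolvesOn`: `v` is the primitive of the right-hand side. -/
structure IntegralSol (h : ℝ → ℝ) (q : S.State) (T₁ : ℝ) (v : ℝ → Vec N) : Prop where
  history : MemLp q.1 (ENNReal.ofReal S.p) (vol (-2 * S.T) 0)
  initial : ∀ᵐ t ∂(vol (-2 * S.T) 0), v t = q.1 t
  memLp_rhs : MemLp (S.rhs h v) (ENNReal.ofReal S.p) (vol 0 T₁)
  eq : ∀ t ∈ Icc 0 T₁, v t = q.2 + ∫ r in (0 : ℝ)..t, S.rhs h v r

/-- The matrix `B` as a continuous linear map. -/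
def Bop : Vec N →L[ℝ] Vec N := (Matrix.toEuclideanLin S.B).toContinuousLinearMap

/-- The matrix `A` as a continuous linear map. -/
def Aop : Vec N →L[ℝ] Vec N := (Matrix.toEuclideanLin S.A).toContinuousLinearMap

theorem rhs_eq (h : ℝ → ℝ) (v : ℝ → Vec N) (r : ℝ) :
    S.rhs h v r = h r • S.k - S.Bop (v r) + S.Aop (v (r - 2 * S.T)) := rfl

variable {S}

theorem integrable_of_memLp {v : ℝ → Vec N} {a b : ℝ}
    (h : MemLp v (ENNReal.ofReal S.p) (vol a b)) : Integrable v (vol a b) :=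
  h.integrable S.one_le_p

namespace IntegralSol

variable {h : ℝ → ℝ} {q : S.State} {T₁ : ℝ} {v : ℝ → Vec N}

theorem integrable_rhs (H : S.IntegralSol h q T₁ v) : Integrable (S.rhs h v) (vol 0 T₁) :=
  integrable_of_memLp H.memLp_rhs

theorem continuousOn (H : S.IntegralSol h q T₁ v) : ContinuousOn v (Icc 0 T₁) := by
  rcases lt_or_ge T₁ 0 with hT | hT
  · simp [Icc_eq_empty (not_le.2 hT)]
  have h1 : IntegrableOn (S.rhs h v) (Icc 0 T₁) :=
    (integrableOn_Icc_iff_integrableOn_Ioo).2 H.integrable_rhs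
  have := intervalIntegral.continuousOn_primitive_interval (f := S.rhs h v) (μ := volume) (a := 0)
      (b := T₁) (by rwa [uIcc_of_le hT])
  rw [uIcc_of_le hT] at this
  exact (continuousOn_const.add this).congr H.eq

theorem value_zero (H : S.IntegralSol h q T₁ v) (hT : 0 ≤ T₁) : v 0 = q.2 := by
  simpa using H.eq 0 ⟨le_rfl, hT⟩

theorem memLp_history (H : S.IntegralSol h q T₁ v) :
    MemLp v (ENNReal.ofReal S.p) (vol (-2 * S.T) 0) :=
  H.history.ae_eq (by filter_upwards [H.initial] with t ht using ht.symm)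

theorem memLp (H : S.IntegralSol h q T₁ v) (hT : 0 ≤ T₁) :
    MemLp v (ENNReal.ofReal S.p) (vol (-2 * S.T) T₁) :=
  memLp_vol_union (by linarith [S.T_pos]) hT H.memLp_history
    (memLp_of_continuousOn_Icc H.continuousOn)

theorem mono (H : S.IntegralSol h q T₁ v) {T₂ : ℝ} (hT : T₂ ≤ T₁) : S.IntegralSol h q T₂ v where
  history := H.history
  initial := H.initial
  memLp_rhs := memLp_vol_mono le_rfl hT H.memLp_rhs
  eq t ht := H.eq t ⟨ht.1, ht.2.trans hT⟩

theorem sub_eq_integral (H : S.IntegralSol h q T₁ v) {a b : ℝ} (ha : a ∈ Icc 0 T₁)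
    (hb : b ∈ Icc 0 T₁) : v b - v a = ∫ r in a..b, S.rhs h v r := by
  have h0 : (0 : ℝ) ∈ Icc 0 T₁ := ⟨le_rfl, ha.1.trans ha.2⟩
  rw [H.eq a ha, H.eq b hb, add_sub_add_left_eq_sub,
    intervalIntegral.integral_interval_sub_left (intervalIntegrable_of_vol H.integrable_rhs h0 hb)
      (intervalIntegrable_of_vol H.integrable_rhs h0 ha)]

/-- The right-hand side only depends on the class of `v` on `(-2T, 0)`, on its values on
`[0, T₁]`, and on the class of `h`. -/
theorem congr (H : S.IntegralSol h q T₁ v) {h' : ℝ → ℝ} {w : ℝ → Vec N} (hT : 0 ≤ T₁)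
    (hh : ∀ᵐ t ∂vol 0 T₁, h' t = h t)
    (hw : ∀ᵐ t ∂vol (-2 * S.T) 0, w t = v t) (hw' : ∀ t ∈ Icc 0 T₁, w t = v t) :
    S.IntegralSol h' q T₁ w := by
  have h1 : ∀ᵐ t ∂vol (-2 * S.T) T₁, w t = v t :=
    ae_vol_union (by linarith [S.T_pos]) hT hw ((ae_restrict_iff' measurableSet_Ioo).2
      (ae_of_all _ fun x hx => hw' x (Ioo_subset_Icc_self hx)))
  have h2 : ∀ᵐ t ∂vol 0 T₁, w (t - 2 * S.T) = v (t - 2 * S.T) := by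
    have := ae_vol_add (s := - (2 * S.T)) h1
    refine ae_vol_mono (by linarith) (by linarith [S.T_pos]) (this.mono fun t ht => ?_)
    simpa [sub_eq_add_neg] using ht
  have h3 : ∀ᵐ t ∂vol 0 T₁, S.rhs h' w t = S.rhs h v t := by
    filter_upwards [hh, h2, ae_vol_mono (by linarith [S.T_pos]) le_rfl h1] with t a b c
    simp only [rhs, a, b, c]
  refine ⟨H.history, ?_, H.memLp_rhs.ae_eq (h3.mono fun t ht => ht.symm), fun t ht => ?_⟩
  · filter_upwards [hw, H.initial] with t a b using a.trans b
  · rw [hw' t ht, H.eq t ht]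
    congr 1
    refine intervalIntegral.integral_congr_ae ?_
    rw [uIoc_of_le ht.1]
    have := (ae_restrict_iff' measurableSet_Ioc).1 (Ioo_ae_eq_Ioc (μ := volume) (a := (0:ℝ)) (b := t) |>
      fun e => by rw [← Measure.restrict_congr_set e]; exact ae_vol_mono le_rfl ht.2 h3)
    exact this.mono fun r hr hr' => (hr hr').symm

end IntegralSol

theorem solvesOn_iff {h : ℝ → ℝ} {q : S.State} {T₁ : ℝ} {v : ℝ → Vec N} (hT : 0 < T₁) :
    S.SolvesOn h q T₁ v ↔ S.IntegralSol h q T₁ v := by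
  constructor
  · intro H
    obtain ⟨g, hg, hw, hge⟩ := H.equation
    have hp := primitive_of_hasWeakDeriv hT H.continuousOn (integrable_of_memLp hg) hw
    have hge' : g =ᵐ[vol 0 T₁] S.rhs h v := hge
    refine ⟨?_, H.initial, hg.ae_eq hge', fun t ht => ?_⟩
    · exact (memLp_vol_mono le_rfl hT.le H.memLp).ae_eq H.initial
    · rw [hp t ht, H.initial_zero]
      congr 1
      refine intervalIntegral.integral_congr_ae ?_
      rw [uIoc_of_le ht.1]
      have := (ae_restrict_iff' measurableSet_Ioc).1
        (Ioo_ae_eq_Ioc (μ := volume) (a := (0:ℝ)) (b := t) |>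
        fun e => by rw [← Measure.restrict_congr_set e]; exact ae_vol_mono le_rfl ht.2 hge')
      exact this
  · intro H
    refine ⟨H.memLp hT.le, H.continuousOn, H.initial, H.value_zero hT.le, S.rhs h v, H.memLp_rhs,
      hasWeakDeriv_of_primitive H.integrable_rhs fun t ht => ?_, ae_of_all _ fun t => rfl⟩
    rw [H.value_zero hT.le]; exact H.eq t ht

end Setting

/-! ### Well-posedness of the delay equation with a given input -/

/-- Global solvability of `v' = f - B v` in integral form, for an integrable right-hand side. The
difference `y` of `v` and the primitive `G` of `f` solves `y' = -B y - B G`, which has a continuous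
inhomogeneity, so that variation of constants applies to it. -/
theorem exists_linear_integral_solution {E : Type*} [NormedAddCommGroup E] [NormedSpace ℝ E]
    [CompleteSpace E] (B : E →L[ℝ] E) (f : ℝ → E) (hf : Integrable f) (x : E) :
    ∃ v : ℝ → E, Continuous v ∧ ∀ t, v t = x + ∫ r in (0 : ℝ)..t, (f r - B (v r)) := by
  set G : ℝ → E := fun t => x + ∫ r in (0 : ℝ)..t, f r with hG
  have hGc : Continuous G :=
    continuous_const.add (intervalIntegral.continuous_primitive (fun _ _ => hf.intervalIntegrable) 0)
  have hexp : ∀ t : ℝ, HasDerivAt (fun t : ℝ => NormedSpace.exp (t • B))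
      (B * NormedSpace.exp (t • B)) t := fun t => hasDerivAt_exp_smul_const' B t
  have hexpc : Continuous fun t : ℝ => NormedSpace.exp (t • B) :=
    continuous_iff_continuousAt.2 fun t => (hexp t).continuousAt
  set J : ℝ → E := fun t => ∫ r in (0 : ℝ)..t, NormedSpace.exp (r • B) (-(B (G r))) with hJ
  have hJc : Continuous fun r => NormedSpace.exp (r • B) (-(B (G r))) :=
    hexpc.clm_apply (B.continuous.comp hGc).neg
  have hJd : ∀ t, HasDerivAt J (NormedSpace.exp (t • B) (-(B (G t)))) t := fun t =>
    intervalIntegral.integral_hasDerivAt_right (hJc.intervalIntegrable _ _)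
      hJc.stronglyMeasurable.stronglyMeasurableAtFilter hJc.continuousAt
  set y : ℝ → E := fun t => NormedSpace.exp ((-t) • B) (J t) with hy
  have hinv : ∀ t : ℝ, NormedSpace.exp ((-t) • B) * NormedSpace.exp (t • B) = 1 := fun t => by
    let _ : NormedAlgebra ℚ (E →L[ℝ] E) := NormedAlgebra.restrictScalars ℚ ℝ _
    rw [← NormedSpace.exp_add_of_commute]
    · simp
    · exact ((Commute.refl B).smul_left _).smul_right _
  have hyd : ∀ t, HasDerivAt y (-(B (y t + G t))) t := by
    intro t
    have h1 : HasDerivAt (fun t : ℝ => NormedSpace.exp ((-t) • B))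
        (-(B * NormedSpace.exp ((-t) • B))) t := by
      have := (hexp (-t)).scomp t (hasDerivAt_neg t)
      simpa [Function.comp_def] using this
    have h2 := h1.clm_apply (hJd t)
    convert h2 using 1
    have h3 := congrArg (fun L : E →L[ℝ] E => L (-(B (G t)))) (hinv t)
    simp only [mul_apply_eq_comp, one_apply_eq_self] at h3
    rw [h3]
    simp [hy]
    abel
  have hyc : Continuous y := continuous_iff_continuousAt.2 fun t => (hyd t).continuousAt
  have hvc : Continuous fun t => y t + G t := hyc.add hGc
  have hBc : Continuous fun t => B (y t + G t) := B.continuous.comp hvc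
  refine ⟨fun t => y t + G t, hvc, fun t => ?_⟩
  have h1 : ∫ r in (0 : ℝ)..t, -(B (y r + G r)) = y t - y 0 :=
    intervalIntegral.integral_eq_sub_of_hasDerivAt (fun r _ => hyd r)
      (hBc.neg.intervalIntegrable _ _)
  have hy0 : y 0 = 0 := by simp [hy, hJ]
  rw [intervalIntegral.integral_sub hf.intervalIntegrable (hBc.intervalIntegrable _ _)]
  rw [intervalIntegral.integral_neg, hy0, sub_zero] at h1
  simp only [hG] at h1 ⊢
  rw [← h1]
  abel

/-- Grönwall's inequality for an integral inequality with delay `d`. -/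
theorem delay_gronwall {E : Type*} [NormedAddCommGroup E] [NormedSpace ℝ E]
    {w F : ℝ → E} {x : E} {d T₁ κ a b : ℝ} (hd : 0 ≤ d) (ha : 0 ≤ a) (hb : 0 ≤ b) (hκ : 0 ≤ κ)
    (hw : ContinuousOn w (Icc 0 T₁)) (hwi : Integrable w (vol (-d) 0))
    (hF : ∀ᵐ r ∂vol 0 T₁, ‖F r‖ ≤ κ + b * ‖w r‖ + a * ‖w (r - d)‖)
    (heq : ∀ t ∈ Icc 0 T₁, w t = x + ∫ r in (0 : ℝ)..t, F r) :
    ∀ t ∈ Icc 0 T₁, ‖w t‖ ≤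
      (‖x‖ + κ * T₁ + a * ∫ r in Ioo (-d) 0, ‖w r‖) * Real.exp ((a + b) * t) := by
  refine gronwall_integral (add_nonneg ha hb) hw.norm (fun t _ => norm_nonneg _) fun t ht => ?_
  have hT : 0 ≤ T₁ := ht.1.trans ht.2
  have h0 : (0 : ℝ) ∈ Icc 0 T₁ := ⟨le_rfl, hT⟩
  have hwI : Integrable w (vol 0 T₁) :=
    memLp_one_iff_integrable.1 (memLp_of_continuousOn_Icc hw)
  have hwA : Integrable w (vol (-d) T₁) :=
    memLp_one_iff_integrable.1 (memLp_vol_union (by linarith) hT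
      (memLp_one_iff_integrable.2 hwi) (memLp_one_iff_integrable.2 hwI))
  have hwd : Integrable (fun r => w (r - d)) (vol 0 T₁) := by
    have := memLp_vol_add (s := -d) (memLp_one_iff_integrable.2 hwA)
    refine memLp_one_iff_integrable.1 (memLp_vol_mono (by linarith) (by linarith) this)
  have i1 := intervalIntegrable_of_vol hwI.norm h0 ht
  have i2 := intervalIntegrable_of_vol hwd.norm h0 ht
  have hdel : ∫ r in (0 : ℝ)..t, ‖w (r - d)‖
      ≤ (∫ r in Ioo (-d) 0, ‖w r‖) + ∫ r in (0 : ℝ)..t, ‖w r‖ := by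
    rw [intervalIntegral.integral_comp_sub_right (fun r => ‖w r‖), zero_sub,
      intervalIntegral.integral_of_le (by linarith [ht.1]), integral_Ioc_eq_integral_Ioo,
      intervalIntegral.integral_of_le ht.1, integral_Ioc_eq_integral_Ioo]
    have e : ∫ r in Ioo (-d) t, ‖w r‖ = (∫ r in Ioo (-d) 0, ‖w r‖) + ∫ r in Ioo 0 t, ‖w r‖ := by
      have := vol_ae_eq_union (a := -d) (b := 0) (c := t) (by linarith) ht.1
      rw [show volume.restrict (Ioo (-d) t) = vol (-d) 0 + vol 0 t from this,
        integral_add_measure hwi.norm]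
      exact (hwI.mono_measure (Measure.restrict_mono (Ioo_subset_Ioo le_rfl ht.2) le_rfl)).norm
    rw [← e]
    refine setIntegral_mono_set ?_ (ae_of_all _ fun _ => norm_nonneg _) ?_
    · exact (hwA.mono_measure (Measure.restrict_mono (Ioo_subset_Ioo le_rfl ht.2) le_rfl)).norm
    · exact (Ioo_subset_Ioo le_rfl (by linarith)).eventuallyLE
  have hmain : ‖∫ r in (0 : ℝ)..t, F r‖ ≤
      ∫ r in (0 : ℝ)..t, (κ + b * ‖w r‖ + a * ‖w (r - d)‖) := by
    refine intervalIntegral.norm_integral_le_of_norm_le ht.1 ?_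
      ((intervalIntegrable_const.add (i1.const_mul b)).add (i2.const_mul a))
    have := (ae_restrict_iff' measurableSet_Ioc).1 (Ioo_ae_eq_Ioc (μ := volume) (a := (0:ℝ)) (b := t)
      |> fun e => by rw [← Measure.restrict_congr_set e]; exact ae_vol_mono le_rfl ht.2 hF)
    exact this
  rw [intervalIntegral.integral_add (intervalIntegrable_const.add (i1.const_mul b))
    (i2.const_mul a), intervalIntegral.integral_add intervalIntegrable_const (i1.const_mul b),
    intervalIntegral.integral_const_mul, intervalIntegral.integral_const_mul,
    intervalIntegral.integral_const, sub_zero, smul_eq_mul] at hmain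
  have h3 := norm_add_le x (∫ r in (0 : ℝ)..t, F r)
  rw [← heq t ht] at h3
  have h4 := mul_le_mul_of_nonneg_left hdel ha
  have h5 : t * κ ≤ κ * T₁ := by rw [mul_comm]; exact mul_le_mul_of_nonneg_left ht.2 hκ
  linarith

namespace Setting

variable {N : ℕ} [NeZero N] {S : Setting N}

/-- Two solutions with the same input differ by a solution of the homogeneous equation, whose norm
is controlled by the difference of the data. -/
theorem IntegralSol.norm_sub_le {h h' : ℝ → ℝ} {q q' : S.State} {T₁ : ℝ} {v v' : ℝ → Vec N}
    (H : S.IntegralSol h q T₁ v) (H' : S.IntegralSol h' q' T₁ v')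
    (hh : ∀ᵐ t ∂vol 0 T₁, h t = h' t) :
    ∀ t ∈ Icc 0 T₁, ‖v t - v' t‖ ≤ (‖q.2 - q'.2‖ +
      ‖S.Aop‖ * ∫ r in Ioo (-2 * S.T) 0, ‖q.1 r - q'.1 r‖) *
        Real.exp ((‖S.Aop‖ + ‖S.Bop‖) * t) := by
  intro t ht
  have h0 : (0 : ℝ) ∈ Icc 0 T₁ := ⟨le_rfl, ht.1.trans ht.2⟩
  have hT := S.T_pos
  have hi : Integrable (fun r => v r - v' r) (vol (-(2 * S.T)) 0) := by
    rw [← neg_mul]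
    exact (integrable_of_memLp H.memLp_history).sub (integrable_of_memLp H'.memLp_history)
  have key := delay_gronwall (w := fun t => v t - v' t) (F := fun r => S.rhs h v r - S.rhs h' v' r)
    (x := q.2 - q'.2) (d := 2 * S.T) (T₁ := T₁) (κ := 0) (a := ‖S.Aop‖) (b := ‖S.Bop‖)
    (by linarith) (norm_nonneg _) (norm_nonneg _) le_rfl (H.continuousOn.sub H'.continuousOn)
    hi ?_ ?_ t ht
  · refine key.trans (le_of_eq ?_)
    have : ∫ r in Ioo (-(2 * S.T)) 0, ‖v r - v' r‖
        = ∫ r in Ioo (-2 * S.T) 0, ‖q.1 r - q'.1 r‖ := by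
      rw [← neg_mul]
      refine integral_congr_ae ?_
      filter_upwards [H.initial, H'.initial] with r a b
      rw [a, b]
    simp only [this, zero_mul, add_zero]
  · filter_upwards [hh] with r hr
    have e : S.rhs h v r - S.rhs h' v' r
        = -(S.Bop (v r - v' r)) + S.Aop (v (r - 2 * S.T) - v' (r - 2 * S.T)) := by
      rw [rhs_eq, rhs_eq, hr, map_sub, map_sub]; abel
    rw [e, zero_add]
    refine (norm_add_le _ _).trans (add_le_add ?_ ?_)
    · rw [norm_neg]; exact S.Bop.le_opNorm _
    · exact S.Aop.le_opNorm _
  · intro r hr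
    rw [intervalIntegral.integral_sub (intervalIntegrable_of_vol H.integrable_rhs h0 hr)
      (intervalIntegrable_of_vol H'.integrable_rhs h0 hr), H.eq r hr, H'.eq r hr]
    abel

theorem IntegralSol.unique {h h' : ℝ → ℝ} {q q' : S.State} {T₁ : ℝ} {v v' : ℝ → Vec N}
    (H : S.IntegralSol h q T₁ v) (H' : S.IntegralSol h' q' T₁ v')
    (hh : ∀ᵐ t ∂vol 0 T₁, h t = h' t) (hq : ∀ᵐ t ∂vol (-2 * S.T) 0, q.1 t = q'.1 t)
    (hx : q.2 = q'.2) : ∀ t ∈ Icc 0 T₁, v t = v' t := by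
  intro t ht
  have key := H.norm_sub_le H' hh t ht
  have : ∫ r in Ioo (-2 * S.T) 0, ‖q.1 r - q'.1 r‖ = 0 := by
    rw [integral_eq_zero_of_ae]
    filter_upwards [hq] with r hr
    simp [hr]
  rw [this, hx, sub_self, norm_zero, mul_zero, add_zero, zero_mul] at key
  exact sub_eq_zero.1 (norm_le_zero_iff.1 key)

/-- A solution with a bounded input is bounded in terms of its data. -/
theorem IntegralSol.norm_le {h : ℝ → ℝ} {q : S.State} {T₁ : ℝ} {v : ℝ → Vec N}
    (H : S.IntegralSol h q T₁ v) (hh : ∀ t, |h t| ≤ 1) :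
    ∀ t ∈ Icc 0 T₁, ‖v t‖ ≤ (‖q.2‖ + ‖S.k‖ * T₁ +
      ‖S.Aop‖ * ∫ r in Ioo (-2 * S.T) 0, ‖q.1 r‖) * Real.exp ((‖S.Aop‖ + ‖S.Bop‖) * t) := by
  intro t ht
  have hT := S.T_pos
  have key := delay_gronwall (w := v) (F := S.rhs h v)
    (x := q.2) (d := 2 * S.T) (T₁ := T₁) (κ := ‖S.k‖) (a := ‖S.Aop‖) (b := ‖S.Bop‖)
    (by linarith) (norm_nonneg _) (norm_nonneg _) (norm_nonneg _) H.continuousOn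
    (by rw [← neg_mul]; exact integrable_of_memLp H.memLp_history) ?_ H.eq t ht
  · refine key.trans (le_of_eq ?_)
    have : ∫ r in Ioo (-(2 * S.T)) 0, ‖v r‖ = ∫ r in Ioo (-2 * S.T) 0, ‖q.1 r‖ := by
      rw [← neg_mul]
      refine integral_congr_ae ?_
      filter_upwards [H.initial] with r a
      rw [a]
    rw [this]
  · refine ae_of_all _ fun r => ?_
    rw [rhs_eq]
    refine (norm_add_le _ _).trans (add_le_add ((_root_.norm_sub_le _ _).trans (add_le_add ?_ ?_)) ?_)
    · rw [norm_smul, Real.norm_eq_abs]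
      exact mul_le_of_le_one_left (norm_nonneg _) (hh r)
    · exact S.Bop.le_opNorm _
    · exact S.Aop.le_opNorm _

/-- The equation is autonomous: a solution restarted at time `s` is a solution. -/
theorem IntegralSol.shift {h : ℝ → ℝ} {q : S.State} {T₁ s : ℝ} {v : ℝ → Vec N}
    (H : S.IntegralSol h q T₁ v) (hs : 0 ≤ s) (hsT : s ≤ T₁) :
    S.IntegralSol (fun t => h (s + t)) (S.stateAt v s) (T₁ - s) (fun t => v (s + t)) := by
  have hT := S.T_pos
  have e : ∀ r, S.rhs (fun t => h (s + t)) (fun t => v (s + t)) r = S.rhs h v (s + r) := fun r => by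
    simp only [rhs, add_sub_assoc]
  refine ⟨?_, ae_of_all _ fun _ => rfl, ?_, fun t ht => ?_⟩
  · have := memLp_vol_add (s := s) (H.memLp (hs.trans hsT))
    simp only [stateAt, add_comm s]
    exact memLp_vol_mono (by linarith) (by linarith) this
  · have := memLp_vol_add (s := s) H.memLp_rhs
    have e2 : S.rhs (fun t => h (s + t)) (fun t => v (s + t)) = fun r => S.rhs h v (r + s) :=
      funext fun r => by rw [e, add_comm]
    rw [e2]
    exact memLp_vol_mono (by linarith) le_rfl this
  · simp only [stateAt, e]
    rw [intervalIntegral.integral_comp_add_left (fun r => S.rhs h v r), add_zero,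
      ← H.sub_eq_integral ⟨hs, hsT⟩ ⟨by linarith [ht.1], by linarith [ht.2]⟩]
    abel

/-- Concatenation of solutions. -/
theorem IntegralSol.glue {h h' H₀ : ℝ → ℝ} {q : S.State} {T₁ T₂ : ℝ} {v w V : ℝ → Vec N}
    (hT₁ : 0 ≤ T₁) (hT₂ : 0 ≤ T₂)
    (H : S.IntegralSol h q T₁ v) (H' : S.IntegralSol h' (S.stateAt v T₁) T₂ w)
    (hV : ∀ t ≤ T₁, V t = v t) (hV' : ∀ t ∈ Icc 0 T₂, V (T₁ + t) = w t)
    (hh : ∀ᵐ t ∂vol 0 T₁, H₀ t = h t) (hh' : ∀ᵐ t ∂vol 0 T₂, H₀ (T₁ + t) = h' t) :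
    S.IntegralSol H₀ q (T₁ + T₂) V := by
  have hT := S.T_pos
  have A := H.congr (h' := H₀) (w := V) hT₁ hh
    ((ae_restrict_iff' measurableSet_Ioo).2 (ae_of_all _ fun t ht => hV t (ht.2.le.trans hT₁)))
    (fun t ht => hV t ht.2)
  have B : S.IntegralSol (fun t => H₀ (T₁ + t)) (S.stateAt v T₁) T₂ (fun t => V (T₁ + t)) := by
    refine H'.congr hT₂ hh' ?_ hV'
    filter_upwards [H'.initial, ae_restrict_mem measurableSet_Ioo] with t ht ht'
    rw [ht]; exact hV _ (by linarith [ht'.2])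
  have e : ∀ r, S.rhs (fun t => H₀ (T₁ + t)) (fun t => V (T₁ + t)) r = S.rhs H₀ V (T₁ + r) :=
    fun r => by simp only [rhs, add_sub_assoc]
  have hm : MemLp (S.rhs H₀ V) (ENNReal.ofReal S.p) (vol 0 (T₁ + T₂)) := by
    refine memLp_vol_union hT₁ (by linarith) A.memLp_rhs ?_
    have := memLp_vol_add (s := -T₁) B.memLp_rhs
    have e3 : (fun r => S.rhs (fun t => H₀ (T₁ + t)) (fun t => V (T₁ + t)) (r + -T₁))
        = S.rhs H₀ V := funext fun r => by rw [e]; congr 1; ring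
    rw [e3] at this
    exact memLp_vol_mono (by linarith) (by linarith) this
  have hint := integrable_of_memLp hm
  refine ⟨A.history, A.initial, hm, fun t ht => ?_⟩
  rcases le_total t T₁ with h1 | h1
  · exact A.eq t ⟨ht.1, h1⟩
  have h2 := B.eq (t - T₁) ⟨by linarith, by linarith [ht.2]⟩
  simp only [e] at h2
  rw [intervalIntegral.integral_comp_add_left (fun r => S.rhs H₀ V r), add_zero,
    add_sub_cancel] at h2
  have h3 := A.eq T₁ ⟨hT₁, le_rfl⟩
  have h4 : (S.stateAt v T₁).2 = V T₁ := (hV T₁ le_rfl).symm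
  rw [h2, h4, h3, add_assoc, intervalIntegral.integral_add_adjacent_intervals]
  · exact intervalIntegrable_of_vol hint ⟨le_rfl, by linarith⟩ ⟨hT₁, by linarith⟩
  · exact intervalIntegrable_of_vol hint ⟨hT₁, by linarith⟩ ht

/-- Solvability for a constant input on one delay interval. -/
theorem exists_integralSol_step (c : ℝ) (q : S.State)
    (hq : MemLp q.1 (ENNReal.ofReal S.p) (vol (-2 * S.T) 0)) :
    ∃ v, S.IntegralSol (fun _ => c) q (2 * S.T) v := by
  have hT := S.T_pos
  obtain ⟨f, hf⟩ : ∃ f : ℝ → Vec N, f = (Ioo 0 (2 * S.T)).indicator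
    (fun r => c • S.k + S.Aop (q.1 (r - 2 * S.T))) := ⟨_, rfl⟩
  have hq2 : MemLp (fun r => q.1 (r - 2 * S.T)) (ENNReal.ofReal S.p) (vol 0 (2 * S.T)) := by
    have := memLp_vol_add (s := -(2 * S.T)) hq
    simp only [← sub_eq_add_neg] at this
    exact memLp_vol_mono (by linarith) (by linarith) this
  have hfm : MemLp (fun r => c • S.k + S.Aop (q.1 (r - 2 * S.T))) (ENNReal.ofReal S.p)
      (vol 0 (2 * S.T)) := by
    have h1 : MemLp (fun r => S.Aop (q.1 (r - 2 * S.T))) (ENNReal.ofReal S.p)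
      (vol 0 (2 * S.T)) := S.Aop.comp_memLp' hq2
    have h2 : MemLp (fun _ : ℝ => c • S.k) (ENNReal.ofReal S.p) (vol 0 (2 * S.T)) :=
      memLp_const _
    exact h2.add h1
  have hfi : Integrable f := by
    rw [hf]
    exact (integrable_indicator_iff measurableSet_Ioo).2 (integrable_of_memLp hfm)
  obtain ⟨y, hyc, hy⟩ := exists_linear_integral_solution S.Bop f hfi q.2
  obtain ⟨v, hv⟩ : ∃ v : ℝ → Vec N, v = fun t => if t < 0 then q.1 t else y t := ⟨_, rfl⟩
  have hvneg : ∀ t, t < 0 → v t = q.1 t := fun t ht => by simp [hv, ht]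
  have hvpos : ∀ t, 0 ≤ t → v t = y t := fun t ht => by simp [hv, not_lt.2 ht]
  have hrhs : ∀ r ∈ Ioo 0 (2 * S.T), S.rhs (fun _ => c) v r = f r - S.Bop (y r) := by
    intro r hr
    rw [rhs_eq, hvneg (r - 2 * S.T) (by linarith [hr.2]), hvpos r hr.1.le, hf, indicator_of_mem hr]
    abel
  have hinit : ∀ᵐ t ∂vol (-2 * S.T) 0, v t = q.1 t :=
    (ae_restrict_iff' measurableSet_Ioo).2 (ae_of_all _ fun t ht => hvneg t ht.2)
  have hmem : MemLp (S.rhs (fun _ => c) v) (ENNReal.ofReal S.p) (vol 0 (2 * S.T)) := by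
    have h1 : MemLp (fun r => (c • S.k + S.Aop (q.1 (r - 2 * S.T))) - S.Bop (y r))
        (ENNReal.ofReal S.p) (vol 0 (2 * S.T)) :=
      hfm.sub (memLp_of_continuousOn_Icc (S.Bop.continuous.comp hyc).continuousOn)
    refine h1.ae_eq ((ae_restrict_iff' measurableSet_Ioo).2 (ae_of_all _ fun r hr => ?_))
    rw [hrhs r hr, hf, indicator_of_mem hr]
  refine ⟨v, hq, hinit, hmem, fun t ht => ?_⟩
  rw [hvpos t ht.1, hy t]
  congr 1
  refine intervalIntegral.integral_congr_ae ?_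
  rw [uIoc_of_le ht.1]
  have : ∀ᵐ r ∂(volume : Measure ℝ), r ≠ 2 * S.T := Measure.ae_ne volume _
  filter_upwards [this] with r hr hr'
  exact (hrhs r ⟨hr'.1, lt_of_le_of_ne (hr'.2.trans ht.2) hr⟩).symm

/-- Solutions on longer and longer intervals that solve the same problem on the common part can be
combined into one function. -/
theorem exists_global_of_forall_nat {q : S.State} (w : ℕ → ℝ → Vec N)
    (hw : ∀ n, ∀ᵐ t ∂vol (-2 * S.T) 0, w n t = q.1 t)
    (hww : ∀ m n : ℕ, m ≤ n → ∀ t ∈ Icc (0 : ℝ) m, w n t = w m t) :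
    ∃ V : ℝ → Vec N, ∀ n, (∀ᵐ t ∂vol (-2 * S.T) 0, V t = w n t) ∧
      ∀ t ∈ Icc (0 : ℝ) n, V t = w n t := by
  refine ⟨fun t => if t < 0 then q.1 t else w ⌈t⌉₊ t, fun n => ⟨?_, fun t ht => ?_⟩⟩
  · filter_upwards [hw n, ae_restrict_mem measurableSet_Ioo] with t h1 h2
    simp [h2.2, h1]
  · simp only [not_lt.2 ht.1, if_false]
    exact (hww _ _ (Nat.ceil_le.2 ht.2) t ⟨ht.1, Nat.le_ceil t⟩).symm

/-- Every problem with constant input has a global solution. -/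
theorem exists_isFrozenSolution (c : ℝ) (q : S.State)
    (hq : MemLp q.1 (ENNReal.ofReal S.p) (vol (-2 * S.T) 0)) :
    ∃ v, S.IsFrozenSolution c q v := by
  have hT := S.T_pos
  have step : ∀ n : ℕ, ∃ v, S.IntegralSol (fun _ => c) q (2 * S.T * (n + 1)) v := by
    intro n
    induction n with
    | zero => simpa using exists_integralSol_step c q hq
    | succ n ih =>
      obtain ⟨v, hv⟩ := ih
      have h0 : 0 ≤ 2 * S.T * ((n : ℝ) + 1) := by positivity
      obtain ⟨w, hw⟩ := exists_integralSol_step c (S.stateAt v (2 * S.T * (n + 1)))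
        (hv.shift h0 le_rfl).history
      set V : ℝ → Vec N := fun t => if t ≤ 2 * S.T * (n + 1) then v t
        else w (t - 2 * S.T * (n + 1)) with hV
      refine ⟨V, ?_⟩
      have := IntegralSol.glue (V := V) (H₀ := fun _ => c) h0 (by linarith) hv hw
        (fun t ht => by simp [hV, ht]) (fun t ht => ?_) (ae_of_all _ fun _ => rfl)
        (ae_of_all _ fun _ => rfl)
      · convert this using 1; push_cast; ring
      · rcases eq_or_lt_of_le ht.1 with h | h
        · rw [← h, hw.value_zero (by linarith)]; simp [hV, stateAt]
        · simp [hV, not_le.2 h]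
  have step' : ∀ n : ℕ, ∃ v, S.IntegralSol (fun _ => c) q n v := by
    intro n
    obtain ⟨m, hm⟩ := exists_nat_ge ((n : ℝ) / (2 * S.T))
    obtain ⟨v, hv⟩ := step m
    refine ⟨v, hv.mono ?_⟩
    rw [div_le_iff₀ (by linarith)] at hm
    nlinarith
  choose w hw using step'
  obtain ⟨V, hV⟩ := exists_global_of_forall_nat (q := q) w (fun n => (hw n).initial)
    (fun (m n : ℕ) hmn => ((hw n).mono (by exact_mod_cast hmn)).unique (hw m) (ae_of_all _ fun _ => rfl)
      (ae_of_all _ fun _ => rfl) rfl)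
  refine ⟨V, fun T₁ hT₁ => (solvesOn_iff hT₁).2 ?_⟩
  obtain ⟨n, hn⟩ := exists_nat_ge T₁
  exact ((hw n).congr n.cast_nonneg (ae_of_all _ fun _ => rfl) (hV n).1 (hV n).2).mono hn

end Setting

/-! ### The Slobodeckij seminorm -/

section Slobodeckij

variable {N : ℕ} {p s a b : ℝ} {f g : ℝ → Vec N}

/-- The integrand of the Slobodeckij seminorm, with a real power as its weight. -/
def slobKernel (p s : ℝ) (f : ℝ → Vec N) (t ξ : ℝ) : ℝ≥0∞ :=
  ‖f t - f ξ‖ₑ ^ p * ENNReal.ofReal (|t - ξ| ^ (-(1 + s * p)))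

/-- The two forms of the integrand agree on the diagonal, too, where both vanish. -/
theorem slobKernel_eq_div (hp : 0 < p) (f : ℝ → Vec N) (t ξ : ℝ) :
    ‖f t - f ξ‖ₑ ^ p / ‖t - ξ‖ₑ ^ (1 + s * p) = slobKernel p s f t ξ := by
  rcases eq_or_ne t ξ with rfl | h
  · simp [slobKernel, ENNReal.zero_rpow_of_pos hp]
  · have h0 : 0 < |t - ξ| := abs_pos.2 (sub_ne_zero.2 h)
    rw [slobKernel, Real.enorm_eq_ofReal_abs, ENNReal.ofReal_rpow_of_pos h0, div_eq_mul_inv,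
      ← ENNReal.ofReal_inv_of_pos (Real.rpow_pos_of_pos h0 _), Real.rpow_neg h0.le]

theorem slobKernel_comm (f : ℝ → Vec N) (t ξ : ℝ) :
    slobKernel p s f t ξ = slobKernel p s f ξ t := by
  rw [slobKernel, slobKernel, abs_sub_comm, enorm_sub_rev]

theorem measurable_slobKernel (hf : StronglyMeasurable f) :
    Measurable fun z : ℝ × ℝ => slobKernel p s f z.1 z.2 := by
  have h1 : Measurable fun z : ℝ × ℝ => ‖f z.1 - f z.2‖ₑ :=
    ((hf.comp_measurable measurable_fst).sub (hf.comp_measurable measurable_snd)).enorm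
  exact (h1.pow_const p).mul (by fun_prop)

theorem slobSeminorm_eq (hp : 0 < p) : slobSeminorm p s a b f =
    (∫⁻ t in Ioo a b, ∫⁻ ξ in Ioo a b, slobKernel p s f t ξ) ^ (1 / p) := by
  simp only [slobSeminorm, slobKernel_eq_div hp]

theorem slobSeminorm_rpow (hp : 0 < p) : slobSeminorm p s a b f ^ p =
    ∫⁻ t in Ioo a b, ∫⁻ ξ in Ioo a b, slobKernel p s f t ξ := by
  rw [slobSeminorm_eq hp, ← ENNReal.rpow_mul, one_div_mul_cancel hp.ne', ENNReal.rpow_one]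

theorem slobSeminorm_congr (h : ∀ᵐ t ∂vol a b, f t = g t) :
    slobSeminorm p s a b f = slobSeminorm p s a b g := by
  unfold slobSeminorm
  congr 1
  refine lintegral_congr_ae ?_
  filter_upwards [h] with t ht
  refine lintegral_congr_ae ?_
  filter_upwards [h] with ξ hξ
  rw [ht, hξ]

theorem slobSeminorm_mono (hp : 0 < p) {a' b' : ℝ} (ha : a ≤ a') (hb : b' ≤ b) :
    slobSeminorm p s a' b' f ≤ slobSeminorm p s a b f := by
  unfold slobSeminorm
  refine ENNReal.rpow_le_rpow ?_ (by positivity)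
  exact (lintegral_mono fun t => lintegral_mono_set (Ioo_subset_Ioo ha hb)).trans
    (lintegral_mono_set (Ioo_subset_Ioo ha hb))

theorem lintegral_vol_add (F : ℝ → ℝ≥0∞) (a b s : ℝ) :
    ∫⁻ r in Ioo (a - s) (b - s), F (r + s) = ∫⁻ r in Ioo a b, F r :=
  (measurePreserving_vol_add a b s).lintegral_comp_emb
    (MeasurableEquiv.addRight s).measurableEmbedding F

theorem eLpNorm_vol_add {E : Type*} [NormedAddCommGroup E] {v : ℝ → E} {r : ℝ≥0∞} {a b s : ℝ}
    (h : AEStronglyMeasurable v (vol a b)) :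
    eLpNorm (fun x => v (s + x)) r (vol (a - s) (b - s)) = eLpNorm v r (vol a b) := by
  simp only [add_comm s]
  exact eLpNorm_comp_measurePreserving h (measurePreserving_vol_add a b s)

theorem slobSeminorm_add (f : ℝ → Vec N) (a b τ : ℝ) :
    slobSeminorm p s (a - τ) (b - τ) (fun r => f (τ + r)) = slobSeminorm p s a b f := by
  unfold slobSeminorm
  congr 1
  rw [← lintegral_vol_add _ a b τ]
  refine lintegral_congr fun t => ?_
  rw [← lintegral_vol_add _ a b τ]
  refine lintegral_congr fun ξ => ?_
  simp only [add_comm τ, add_sub_add_right_eq_sub]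

theorem slobSeminorm_neg : slobSeminorm p s a b (fun t => -f t) = slobSeminorm p s a b f := by
  unfold slobSeminorm
  simp only [neg_sub_neg, fun t ξ => enorm_sub_rev (f ξ) (f t)]

/-- Minkowski's inequality for the Slobodeckij seminorm. -/
theorem slobSeminorm_add_le (hp : 1 ≤ p) (hf : AEStronglyMeasurable f (vol a b))
    (hg : AEStronglyMeasurable g (vol a b)) :
    slobSeminorm p s a b (fun t => f t + g t) ≤
      slobSeminorm p s a b f + slobSeminorm p s a b g := by
  have hp0 : 0 < p := by linarith
  obtain ⟨f', hf', hff'⟩ := hf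
  obtain ⟨g', hg', hgg'⟩ := hg
  rw [slobSeminorm_congr (f := fun t => f t + g t) (g := fun t => f' t + g' t)
    (by filter_upwards [hff', hgg'] with t h1 h2; rw [h1, h2]),
    slobSeminorm_congr hff', slobSeminorm_congr hgg']
  set H : (ℝ → Vec N) → ℝ × ℝ → ℝ≥0∞ := fun f z =>
    ‖f z.1 - f z.2‖ₑ * ENNReal.ofReal (|z.1 - z.2| ^ (-(1 + s * p))) ^ (1 / p) with hH
  have hHm : ∀ f : ℝ → Vec N, StronglyMeasurable f → Measurable (H f) := by
    intro f hf
    have h1 : Measurable fun z : ℝ × ℝ => ‖f z.1 - f z.2‖ₑ :=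
      ((hf.comp_measurable measurable_fst).sub (hf.comp_measurable measurable_snd)).enorm
    exact h1.mul (by fun_prop)
  have hS : ∀ f : ℝ → Vec N, StronglyMeasurable f → slobSeminorm p s a b f =
      (∫⁻ z, H f z ^ p ∂((vol a b).prod (vol a b))) ^ (1 / p) := by
    intro f hf
    rw [slobSeminorm_eq hp0, lintegral_prod _ ((hHm f hf).pow_const p).aemeasurable]
    congr 1
    refine lintegral_congr fun t => lintegral_congr fun ξ => ?_
    simp only [hH, slobKernel]
    rw [ENNReal.mul_rpow_of_nonneg _ _ hp0.le, ← ENNReal.rpow_mul, one_div_mul_cancel hp0.ne',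
      ENNReal.rpow_one]
  rw [hS (fun t => f' t + g' t) (hf'.add hg'), hS _ hf', hS _ hg']
  refine le_trans (ENNReal.rpow_le_rpow (lintegral_mono fun z => ?_) (by positivity))
    (ENNReal.lintegral_Lp_add_le (hHm f' hf').aemeasurable (hHm g' hg').aemeasurable hp)
  refine ENNReal.rpow_le_rpow ?_ hp0.le
  simp only [hH, Pi.add_apply]
  rw [← add_mul]
  gcongr
  rw [add_sub_add_comm]
  exact enorm_add_le _ _

/-! ### Integrals of power weights -/

/-- The integral of `|x| ^ γ` over `(-L, L)`. -/
def powerMass (γ L : ℝ) : ℝ≥0∞ := ∫⁻ x in Ioo (-L) L, ENNReal.ofReal (|x| ^ γ)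

theorem powerMass_lt_top {γ L : ℝ} (hγ : -1 < γ) (hL : 0 ≤ L) : powerMass γ L < ⊤ := by
  have h1 : IntervalIntegrable (fun x : ℝ => |x| ^ γ) volume 0 L := by
    refine (intervalIntegral.intervalIntegrable_rpow' hγ).congr ?_
    intro x hx
    rw [uIoc_of_le hL] at hx
    simp only [abs_of_pos hx.1]
  have h2 : IntervalIntegrable (fun x : ℝ => |x| ^ γ) volume 0 (-L) := by
    rw [IntervalIntegrable.iff_comp_neg]; simpa using h1
  have h3 := (h2.symm.trans h1)
  rw [intervalIntegrable_iff_integrableOn_Ioo_of_le (by linarith)] at h3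
  refine lt_of_le_of_lt (lintegral_mono fun x => ?_) h3.2
  rw [Real.enorm_eq_ofReal_abs]
  exact ENNReal.ofReal_le_ofReal (le_abs_self _)

theorem lintegral_abs_sub_rpow_le {γ a b L : ℝ} (r : ℝ) (ha : -L ≤ a - r) (hb : b - r ≤ L) :
    ∫⁻ t in Ioo a b, ENNReal.ofReal (|t - r| ^ γ) ≤ powerMass γ L := by
  rw [← lintegral_vol_add _ a b r]
  simp only [add_sub_cancel_right]
  exact lintegral_mono_set (Ioo_subset_Ioo ha hb)

/-! ### Embedding of `W^1_p` into the Slobodeckij space -/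

/-- Hölder's inequality against the constant `1` on an interval. -/
theorem lintegral_rpow_le_of_interval {G : ℝ → ℝ≥0∞} (hG : Measurable G) (hp : 1 < p) (hab : a ≤ b) :
    (∫⁻ r in Ioo a b, G r) ^ p ≤
      ENNReal.ofReal ((b - a) ^ (p - 1)) * ∫⁻ r in Ioo a b, G r ^ p := by
  have hp0 : 0 < p := by linarith
  have hpq := Real.HolderConjugate.conjExponent hp
  have h := ENNReal.lintegral_mul_le_Lp_mul_Lq (volume.restrict (Ioo a b)) hpq hG.aemeasurable
    (g := fun _ => 1) aemeasurable_const
  simp only [Pi.mul_apply, mul_one, ENNReal.one_rpow, lintegral_one, Measure.restrict_apply,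
    MeasurableSet.univ, univ_inter, Real.volume_Ioo] at h
  refine (ENNReal.rpow_le_rpow h hp0.le).trans (le_of_eq ?_)
  rw [ENNReal.mul_rpow_of_nonneg _ _ hp0.le, ← ENNReal.rpow_mul, ← ENNReal.rpow_mul,
    one_div_mul_cancel hp0.ne', ENNReal.rpow_one, mul_comm]
  congr 1
  have e : 1 / p.conjExponent * p = p - 1 := by
    rw [Real.conjExponent]; field_simp
  rw [e, ENNReal.ofReal_rpow_of_nonneg (by linarith) (by linarith)]

/-- A function on `(0, L)` with derivative `g ∈ L_p` has finite Slobodeckij energy. For `r` between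
`ξ` and `t`, `|t - ξ|` is at least the geometric mean of `|t - r|` and `|ξ - r|`, which separates
the variables after Hölder's inequality. -/
theorem slobEnergy_le_of_primitive {L : ℝ} {G : ℝ → ℝ≥0∞} (hp : 1 < p)
    (hps : p * (1 - s) < 2) (hG : Measurable G)
    (hf : ∀ ξ t, 0 < ξ → ξ ≤ t → t < L → ‖f t - f ξ‖ₑ ≤ ∫⁻ r in Ioo ξ t, G r) :
    ∫⁻ t in Ioo 0 L, ∫⁻ ξ in Ioo 0 L, slobKernel p s f t ξ ≤
      powerMass ((p - 2 - s * p) / 2) L ^ 2 * ∫⁻ r in Ioo 0 L, G r ^ p := by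
  have hp0 : 0 < p := by linarith
  set e : ℝ := (p - 2 - s * p) / 2 with he
  set A : ℝ → ℝ → ℝ≥0∞ := fun t r => ENNReal.ofReal (|t - r| ^ e) with hA
  have hAm : Measurable fun z : ℝ × ℝ => A z.1 z.2 := by simp only [hA]; fun_prop
  have hGm : Measurable fun r => G r ^ p := hG.pow_const p
  have hmass : ∀ r ∈ Ioo 0 L, ∫⁻ t in Ioo 0 L, A t r ≤ powerMass e L := fun r hr =>
    lintegral_abs_sub_rpow_le r (by linarith [hr.2]) (by linarith [hr.1])
  -- the pointwise bound, first for `ξ ≤ t`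
  have key : ∀ ξ t, 0 < ξ → ξ ≤ t → t < L → slobKernel p s f t ξ ≤
      ∫⁻ r in Ioo 0 L, A t r * (A ξ r * G r ^ p) := by
    intro ξ t hξ hξt htL
    rcases eq_or_lt_of_le hξt with rfl | hlt
    · simp [slobKernel, ENNReal.zero_rpow_of_pos hp0]
    have h0 : 0 < t - ξ := sub_pos.2 hlt
    have h1 : ‖f t - f ξ‖ₑ ^ p ≤
        ENNReal.ofReal ((t - ξ) ^ (p - 1)) * ∫⁻ r in Ioo ξ t, G r ^ p :=
      (ENNReal.rpow_le_rpow (hf ξ t hξ hξt htL) hp0.le).trans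
        (lintegral_rpow_le_of_interval hG hp hξt)
    calc slobKernel p s f t ξ
        ≤ (ENNReal.ofReal ((t - ξ) ^ (p - 1)) * ∫⁻ r in Ioo ξ t, G r ^ p) *
          ENNReal.ofReal (|t - ξ| ^ (-(1 + s * p))) := by
          unfold slobKernel; gcongr
      _ = ENNReal.ofReal ((t - ξ) ^ (2 * e)) * ∫⁻ r in Ioo ξ t, G r ^ p := by
          rw [mul_right_comm, ← ENNReal.ofReal_mul (by positivity), abs_of_pos h0,
            ← Real.rpow_add h0]
          congr 4; rw [he]; ring
      _ = ∫⁻ r in Ioo ξ t, ENNReal.ofReal ((t - ξ) ^ (2 * e)) * G r ^ p :=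
          (lintegral_const_mul _ hGm).symm
      _ ≤ ∫⁻ r in Ioo ξ t, A t r * (A ξ r * G r ^ p) := by
          refine setLIntegral_mono' measurableSet_Ioo fun r hr => ?_
          rw [← mul_assoc]
          gcongr
          have h2 : 0 < t - r := sub_pos.2 hr.2
          have h3 : 0 < r - ξ := sub_pos.2 hr.1
          simp only [hA]
          rw [abs_of_pos h2, abs_sub_comm, abs_of_pos h3, ← ENNReal.ofReal_mul (by positivity),
            ← Real.mul_rpow h2.le h3.le]
          refine ENNReal.ofReal_le_ofReal ?_
          rw [mul_comm, Real.rpow_mul h0.le, mul_comm, ← Real.rpow_mul h0.le, mul_comm,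
            Real.rpow_mul h0.le]
          refine Real.rpow_le_rpow_of_nonpos (by positivity) ?_ (by rw [he]; nlinarith)
          rw [Real.rpow_two]
          nlinarith
      _ ≤ _ := lintegral_mono_set (Ioo_subset_Ioo hξ.le htL.le)
  have key' : ∀ t ∈ Ioo 0 L, ∀ ξ ∈ Ioo 0 L, slobKernel p s f t ξ ≤
      ∫⁻ r in Ioo 0 L, A t r * (A ξ r * G r ^ p) := by
    intro t ht ξ hξ
    rcases le_total ξ t with h | h
    · exact key ξ t hξ.1 h ht.2
    · rw [slobKernel_comm]
      refine (key t ξ ht.1 h hξ.2).trans (le_of_eq (lintegral_congr fun r => ?_))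
      ring
  calc ∫⁻ t in Ioo 0 L, ∫⁻ ξ in Ioo 0 L, slobKernel p s f t ξ
      ≤ ∫⁻ t in Ioo 0 L, ∫⁻ ξ in Ioo 0 L, ∫⁻ r in Ioo 0 L, A t r * (A ξ r * G r ^ p) :=
        setLIntegral_mono' measurableSet_Ioo fun t ht =>
          setLIntegral_mono' measurableSet_Ioo fun ξ hξ => key' t ht ξ hξ
    _ ≤ ∫⁻ t in Ioo 0 L, ∫⁻ r in Ioo 0 L, A t r * (powerMass e L * G r ^ p) := by
        refine lintegral_mono fun t => ?_
        rw [lintegral_lintegral_swap]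
        · refine setLIntegral_mono' measurableSet_Ioo fun r hr => ?_
          rw [lintegral_const_mul _ (by fun_prop), lintegral_mul_const _ (by fun_prop)]
          gcongr
          exact hmass r hr
        · refine Measurable.aemeasurable ?_
          exact (hAm.comp (measurable_const.prodMk measurable_snd)).mul
            (hAm.mul (hGm.comp measurable_snd))
    _ = ∫⁻ r in Ioo 0 L, ∫⁻ t in Ioo 0 L, A t r * (powerMass e L * G r ^ p) := by
        refine lintegral_lintegral_swap (Measurable.aemeasurable ?_)
        exact hAm.mul ((hGm.comp measurable_snd).const_mul _)
    _ ≤ ∫⁻ r in Ioo 0 L, powerMass e L * (powerMass e L * G r ^ p) := by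
        refine setLIntegral_mono' measurableSet_Ioo fun r hr => ?_
        rw [lintegral_mul_const _ (by fun_prop)]
        gcongr
        exact hmass r hr
    _ = _ := by
        rw [lintegral_const_mul _ (hGm.const_mul _), lintegral_const_mul _ hGm, sq, mul_assoc]

end Slobodeckij

/-! ### The fractional Hardy inequality -/

section Hardy

variable {N : ℕ} {p s : ℝ}

/-- The average over `y ∈ (2Kx, Kx)` of `‖f x‖ ^ p ≤ 2 ^ (p - 1) (‖f y‖ ^ p + ‖f x - f y‖ ^ p)`,
multiplied by `|x| ^ (-sp)`. -/
theorem hardy_pointwise {f : ℝ → Vec N} (hf : StronglyMeasurable f) (hp : 1 < p) (hs : 0 < s)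
    {K x : ℝ} (hK : 1 ≤ K) (hx : x < 0) :
    ‖f x‖ₑ ^ p * ENNReal.ofReal (|x| ^ (-(s * p))) ≤
      ENNReal.ofReal (2 ^ (p - 1) / K) * ∫⁻ y in Ioo (2 * K * x) (K * x),
        (ENNReal.ofReal (|x| ^ (-(1 + s * p))) * ‖f y‖ₑ ^ p +
          ENNReal.ofReal ((2 * K) ^ (1 + s * p)) * slobKernel p s f x y) := by
  have hp0 : 0 < p := by linarith
  have hK0 : 0 < K := by linarith
  have hsp : 0 < s * p := by positivity
  have hx0 : 0 < |x| := abs_pos.2 hx.ne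
  have hvol : volume (Ioo (2 * K * x) (K * x)) = ENNReal.ofReal (K * |x|) := by
    rw [Real.volume_Ioo, abs_of_neg hx]; congr 1; ring
  have h1 : ∀ y ∈ Ioo (2 * K * x) (K * x),
      ENNReal.ofReal (|x| ^ (-(1 + s * p))) * ‖f x‖ₑ ^ p ≤ ENNReal.ofReal (2 ^ (p - 1)) *
        (ENNReal.ofReal (|x| ^ (-(1 + s * p))) * ‖f y‖ₑ ^ p +
          ENNReal.ofReal ((2 * K) ^ (1 + s * p)) * slobKernel p s f x y) := by
    intro y hy
    have hxy : 0 < |x - y| := by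
      rw [abs_pos, sub_ne_zero]; rintro rfl; nlinarith [hy.2]
    have e1 : ‖f x‖ₑ ^ p ≤ ENNReal.ofReal (2 ^ (p - 1)) * (‖f y‖ₑ ^ p + ‖f x - f y‖ₑ ^ p) := by
      have : ‖f x‖ₑ ≤ ‖f y‖ₑ + ‖f x - f y‖ₑ := by
        have := enorm_add_le (f y) (f x - f y)
        rwa [add_sub_cancel] at this
      refine (ENNReal.rpow_le_rpow this hp0.le).trans ?_
      refine (ENNReal.rpow_add_le_mul_rpow_add_rpow _ _ hp.le).trans (le_of_eq ?_)
      rw [← ENNReal.ofReal_rpow_of_pos (by norm_num)]; simp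
    have e2 : ENNReal.ofReal (|x| ^ (-(1 + s * p))) ≤
        ENNReal.ofReal ((2 * K) ^ (1 + s * p)) * ENNReal.ofReal (|x - y| ^ (-(1 + s * p))) := by
      rw [← ENNReal.ofReal_mul (by positivity)]
      refine ENNReal.ofReal_le_ofReal ?_
      have : |x| ^ (-(1 + s * p)) =
          (2 * K) ^ (1 + s * p) * (2 * K * |x|) ^ (-(1 + s * p)) := by
        rw [Real.mul_rpow (by positivity) hx0.le, ← mul_assoc, ← Real.rpow_add (by positivity),
          add_neg_cancel, Real.rpow_zero, one_mul]
      rw [this]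
      refine mul_le_mul_of_nonneg_left ?_ (by positivity)
      refine Real.rpow_le_rpow_of_nonpos hxy ?_ (by linarith)
      rw [abs_of_neg hx, abs_of_pos (by nlinarith [hy.2])]
      nlinarith [hy.1]
    calc ENNReal.ofReal (|x| ^ (-(1 + s * p))) * ‖f x‖ₑ ^ p
        ≤ ENNReal.ofReal (|x| ^ (-(1 + s * p))) *
          (ENNReal.ofReal (2 ^ (p - 1)) * (‖f y‖ₑ ^ p + ‖f x - f y‖ₑ ^ p)) := by gcongr
      _ = ENNReal.ofReal (2 ^ (p - 1)) * (ENNReal.ofReal (|x| ^ (-(1 + s * p))) * ‖f y‖ₑ ^ p +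
          ‖f x - f y‖ₑ ^ p * ENNReal.ofReal (|x| ^ (-(1 + s * p)))) := by ring
      _ ≤ ENNReal.ofReal (2 ^ (p - 1)) * (ENNReal.ofReal (|x| ^ (-(1 + s * p))) * ‖f y‖ₑ ^ p +
          ‖f x - f y‖ₑ ^ p * (ENNReal.ofReal ((2 * K) ^ (1 + s * p)) *
            ENNReal.ofReal (|x - y| ^ (-(1 + s * p))))) := by gcongr
      _ = _ := by rw [slobKernel]; ring
  have h2 := setLIntegral_mono' (μ := volume) measurableSet_Ioo h1
  have hm : Measurable fun y => ENNReal.ofReal (|x| ^ (-(1 + s * p))) * ‖f y‖ₑ ^ p +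
          ENNReal.ofReal ((2 * K) ^ (1 + s * p)) * slobKernel p s f x y :=
    ((hf.enorm.pow_const p).const_mul _).add
      (((measurable_slobKernel hf).comp (measurable_const.prodMk measurable_id)).const_mul _)
  rw [lintegral_const_mul _ hm, setLIntegral_const, hvol] at h2
  have h3 : ‖f x‖ₑ ^ p * ENNReal.ofReal (|x| ^ (-(s * p))) = ENNReal.ofReal (1 / K) *
      (ENNReal.ofReal (|x| ^ (-(1 + s * p))) * ‖f x‖ₑ ^ p * ENNReal.ofReal (K * |x|)) := by
    rw [mul_right_comm, ← mul_assoc, ← ENNReal.ofReal_mul (by positivity),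
      ← ENNReal.ofReal_mul (by positivity), mul_comm]
    congr 2
    rw [show -(1 + s * p) = -(s * p) - 1 by ring, Real.rpow_sub_one hx0.ne']
    field_simp
  rw [h3]
  refine (mul_le_mul_right h2 _).trans (le_of_eq ?_)
  rw [← mul_assoc, ← ENNReal.ofReal_mul (by positivity)]
  congr 2
  ring

/-- The set of the `x` with `2Kx < y < Kx` is an interval of length `|y| / (2K)`, on which `|x|` is
at least `|y| / (2K)`. -/
theorem hardy_weight_le {θ K y : ℝ} (hK : 1 ≤ K) (hθ : 0 < θ) (hy : y < 0) (A : Set ℝ) :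
    ∫⁻ x in A, {x | 2 * K * x < y ∧ y < K * x}.indicator
      (fun x => ENNReal.ofReal (|x| ^ (-(1 + θ)))) x ≤
      ENNReal.ofReal ((2 * K) ^ θ) * ENNReal.ofReal (|y| ^ (-θ)) := by
  have hK0 : 0 < K := by linarith
  have hc : 0 < |y| / (2 * K) := div_pos (abs_pos.2 hy.ne) (by positivity)
  have hsub : {x : ℝ | 2 * K * x < y ∧ y < K * x} ⊆ Ioo (y / K) (y / (2 * K)) := by
    rintro x ⟨h1, h2⟩
    constructor
    · rw [div_lt_iff₀ hK0]; linarith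
    · rw [lt_div_iff₀ (by positivity)]; linarith
  calc ∫⁻ x in A, {x | 2 * K * x < y ∧ y < K * x}.indicator
        (fun x => ENNReal.ofReal (|x| ^ (-(1 + θ)))) x
      ≤ ∫⁻ x, (Ioo (y / K) (y / (2 * K))).indicator
        (fun _ => ENNReal.ofReal ((|y| / (2 * K)) ^ (-(1 + θ)))) x := by
        refine (setLIntegral_le_lintegral _ _).trans (lintegral_mono fun x => ?_)
        by_cases hx : x ∈ {x : ℝ | 2 * K * x < y ∧ y < K * x}
        · rw [indicator_of_mem hx, indicator_of_mem (hsub hx)]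
          refine ENNReal.ofReal_le_ofReal (Real.rpow_le_rpow_of_nonpos hc ?_ (by linarith))
          have hx0 : x < 0 := by nlinarith [hx.1.trans hx.2]
          rw [abs_of_neg hy, abs_of_neg hx0, div_le_iff₀ (by positivity)]
          nlinarith [hx.1]
        · rw [indicator_of_notMem hx]; exact zero_le
    _ = ENNReal.ofReal ((|y| / (2 * K)) ^ (-(1 + θ))) * ENNReal.ofReal (|y| / (2 * K)) := by
        rw [lintegral_indicator measurableSet_Ioo, setLIntegral_const, Real.volume_Ioo]
        congr 2
        rw [abs_of_neg hy]; field_simp; ring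
    _ = _ := by
        rw [← ENNReal.ofReal_mul (by positivity), ← ENNReal.ofReal_mul (by positivity)]
        congr 1
        rw [show -(1 + θ) = -θ - 1 by ring, Real.rpow_sub_one hc.ne', div_mul_cancel₀ _ hc.ne',
          Real.div_rpow (abs_nonneg _) (by positivity), Real.rpow_neg (by positivity : 0 ≤ 2 * K)]
        field_simp

theorem measurable_slobKernel_right {f : ℝ → Vec N} (hf : StronglyMeasurable f) (x : ℝ) :
    Measurable fun y => slobKernel p s f x y := by
  have h := (measurable_slobKernel (p := p) (s := s) hf).comp (measurable_prodMk_left (x := x))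
  exact h

theorem measurable_hardy_weight (K θ : ℝ) :
    Measurable fun z : ℝ × ℝ => {x | 2 * K * x < z.2 ∧ z.2 < K * x}.indicator
      (fun x => ENNReal.ofReal (|x| ^ (-(1 + θ)))) z.1 := by
  have h1 : MeasurableSet {z : ℝ × ℝ | 2 * K * z.1 < z.2} :=
    measurableSet_lt (by fun_prop) (by fun_prop)
  have h2 : MeasurableSet {z : ℝ × ℝ | z.2 < K * z.1} :=
    measurableSet_lt (by fun_prop) (by fun_prop)
  have h3 : Measurable fun z : ℝ × ℝ => ENNReal.ofReal (|z.1| ^ (-(1 + θ))) := by fun_prop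
  exact h3.indicator (h1.inter h2)

/-- The main step towards Hardy's inequality: near the singularity, the weighted integral is
controlled by a small multiple of itself and by the Slobodeckij energy. -/
theorem hardy_near {f : ℝ → Vec N} (hf : StronglyMeasurable f) (hp : 1 < p) (hs : 0 < s)
    {K L δ : ℝ} (hK : 1 ≤ K) (hL : 0 < L) (hδ : 0 < δ) :
    ∫⁻ x in Ioo (-(L / (2 * K))) (-δ), ‖f x‖ₑ ^ p * ENNReal.ofReal (|x| ^ (-(s * p))) ≤
      ENNReal.ofReal (2 ^ (p - 1) / K * (2 * K) ^ (s * p)) *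
        (∫⁻ x in Ioo (-L) (-δ), ‖f x‖ₑ ^ p * ENNReal.ofReal (|x| ^ (-(s * p)))) +
      ENNReal.ofReal (2 ^ (p - 1) / K) * ENNReal.ofReal ((2 * K) ^ (1 + s * p)) *
        ∫⁻ x in Ioo (-L) 0, ∫⁻ y in Ioo (-L) 0, slobKernel p s f x y := by
  have hK0 : 0 < K := by linarith
  have hθ : 0 < s * p := mul_pos hs (by linarith)
  set c1 : ℝ≥0∞ := ENNReal.ofReal (2 ^ (p - 1) / K) with hc1
  set c2 : ℝ≥0∞ := ENNReal.ofReal ((2 * K) ^ (1 + s * p)) with hc2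
  have hFm : Measurable fun x => ‖f x‖ₑ ^ p := hf.enorm.pow_const p
  have hkm : ∀ x, Measurable fun y => slobKernel p s f x y := fun x =>
    measurable_slobKernel_right hf x
  set w : ℝ → ℝ → ℝ≥0∞ := fun x y => {x | 2 * K * x < y ∧ y < K * x}.indicator
    (fun x => ENNReal.ofReal (|x| ^ (-(1 + s * p)))) x with hw
  have hwm : Measurable fun z : ℝ × ℝ => w z.1 z.2 := by
    simp only [hw]; exact measurable_hardy_weight K (s * p)
  set A : Set ℝ := Ioo (-(L / (2 * K))) (-δ) with hA
  have hA0 : ∀ x ∈ A, x < 0 := fun x hx => by linarith [hx.2]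
  have h1 : ∫⁻ x in A, ‖f x‖ₑ ^ p * ENNReal.ofReal (|x| ^ (-(s * p))) ≤
      ∫⁻ x in A, ((∫⁻ y in Ioo (-L) (-δ), c1 * (w x y * ‖f y‖ₑ ^ p)) +
        c1 * c2 * ∫⁻ y in Ioo (-L) 0, slobKernel p s f x y) := by
    refine setLIntegral_mono' measurableSet_Ioo fun x hx => ?_
    have hx0 : x < 0 := hA0 x hx
    have hxL : -L < 2 * K * x := by
      have := hx.1
      rw [← neg_div, div_lt_iff₀ (by positivity)] at this
      linarith
    have hxδ : K * x < -δ := by nlinarith [hx.2]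
    refine (hardy_pointwise hf hp hs hK hx0).trans ?_
    rw [lintegral_add_left (hFm.const_mul _), mul_add, lintegral_const_mul _ (hkm x), ← mul_assoc]
    refine add_le_add ?_ ?_
    · rw [← lintegral_const_mul _ (hFm.const_mul _)]
      refine le_trans ?_ (lintegral_mono_set (Ioo_subset_Ioo hxL.le hxδ.le))
      refine setLIntegral_mono' measurableSet_Ioo fun y hy => ?_
      simp only [hw]
      rw [indicator_of_mem (show x ∈ {x | 2 * K * x < y ∧ y < K * x} from hy)]
    · gcongr
      linarith
  refine h1.trans ?_
  rw [lintegral_add_right _ ((measurable_slobKernel hf).lintegral_prod_right'.const_mul _)]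
  refine add_le_add ?_ ?_
  · have hFWm : Measurable fun x => ‖f x‖ₑ ^ p * ENNReal.ofReal (|x| ^ (-(s * p))) :=
      hFm.mul (by fun_prop)
    rw [lintegral_lintegral_swap
      (((hwm.mul (hFm.comp measurable_snd)).const_mul c1).aemeasurable),
      ← lintegral_const_mul _ hFWm]
    refine setLIntegral_mono' measurableSet_Ioo fun y hy => ?_
    have hwy : Measurable fun x => w x y := hwm.comp (measurable_id.prodMk measurable_const)
    rw [lintegral_const_mul _ (hwy.mul_const _), lintegral_mul_const _ hwy]
    have h2 : ∫⁻ x in A, w x y ≤ ENNReal.ofReal ((2 * K) ^ (s * p)) *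
        ENNReal.ofReal (|y| ^ (-(s * p))) := hardy_weight_le hK hθ (by linarith [hy.2] : y < 0) A
    rw [ENNReal.ofReal_mul (by positivity)]
    calc _ ≤ c1 * (ENNReal.ofReal ((2 * K) ^ (s * p)) * ENNReal.ofReal (|y| ^ (-(s * p))) *
          ‖f y‖ₑ ^ p) := by gcongr
      _ = _ := by ring
  · rw [lintegral_const_mul _ (measurable_slobKernel hf).lintegral_prod_right']
    gcongr
    intro x hx
    refine ⟨?_, hA0 x hx⟩
    have h2 : L / (2 * K) ≤ L := div_le_self hL.le (by linarith)
    linarith [hx.1]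

/-- The fractional Hardy inequality on an interval, for `s p < 1`. The weighted integral over
`(-L, -δ)` is finite, so that the multiple of it in `hardy_near` can be absorbed into the left-hand
side when its factor is less than one. -/
theorem hardy (hp : 1 < p) (hs : 0 < s) (hsp : s * p < 1) {L : ℝ} (hL : 0 < L) :
    ∃ C : ℝ≥0∞, C < ⊤ ∧ ∀ f : ℝ → Vec N, StronglyMeasurable f →
      ∫⁻ x in Ioo (-L) 0, ‖f x‖ₑ ^ p * ENNReal.ofReal (|x| ^ (-(s * p))) ≤
        C * ((∫⁻ x in Ioo (-L) 0, ‖f x‖ₑ ^ p) +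
          ∫⁻ x in Ioo (-L) 0, ∫⁻ y in Ioo (-L) 0, slobKernel p s f x y) := by
  have hp0 : 0 < p := by linarith
  have hθ : 0 < s * p := by positivity
  -- the factor in `hardy_near` decays like `K ^ (s p - 1)`
  obtain ⟨K, hK1, hK⟩ : ∃ K : ℝ, 1 ≤ K ∧ 2 ^ (p - 1) / K * (2 * K) ^ (s * p) ≤ 1 / 2 := by
    have h1 : Tendsto (fun K : ℝ => 2 ^ (p - 1) * 2 ^ (s * p) * K ^ (-(1 - s * p))) atTop
        (𝓝 (2 ^ (p - 1) * 2 ^ (s * p) * 0)) :=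
      (tendsto_rpow_neg_atTop (by linarith)).const_mul _
    rw [mul_zero] at h1
    obtain ⟨K, hK1, hK2⟩ :=
      ((h1.eventually_le_const (by norm_num : (0 : ℝ) < 1 / 2)).and (eventually_ge_atTop 1)).exists
    refine ⟨K, hK2, le_trans (le_of_eq ?_) hK1⟩
    have hK0 : 0 < K := by linarith
    rw [show -(1 - s * p) = s * p - 1 by ring, Real.rpow_sub_one hK0.ne',
      Real.mul_rpow (by norm_num) hK0.le]
    field_simp
  have hK0 : 0 < K := by linarith
  set c1 : ℝ≥0∞ := ENNReal.ofReal (2 ^ (p - 1) / K) with hc1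
  set c2 : ℝ≥0∞ := ENNReal.ofReal ((2 * K) ^ (1 + s * p)) with hc2
  set c3 : ℝ≥0∞ := ENNReal.ofReal ((L / (2 * K)) ^ (-(s * p))) with hc3
  refine ⟨2 * (c1 * c2 + c3), by finiteness, fun f hf => ?_⟩
  set F : ℝ → ℝ≥0∞ := fun x => ‖f x‖ₑ ^ p with hF
  have hFm : Measurable F := hf.enorm.pow_const p
  set W : ℝ → ℝ≥0∞ := fun x => ENNReal.ofReal (|x| ^ (-(s * p))) with hW
  have hWm : Measurable W := by simp only [hW]; fun_prop
  set J : ℝ≥0∞ := ∫⁻ x in Ioo (-L) 0, F x with hJ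
  set E : ℝ≥0∞ := ∫⁻ x in Ioo (-L) 0, ∫⁻ y in Ioo (-L) 0, slobKernel p s f x y with hE
  rcases eq_or_ne J ⊤ with hJt | hJt
  · have hc3' : c3 ≠ 0 := by
      rw [hc3, Ne, ENNReal.ofReal_eq_zero, not_le]; positivity
    rw [hJt, top_add, ENNReal.mul_top (by simp [hc3'])]
    exact le_top
  have hWle : ∀ {δ x : ℝ}, 0 < δ → x ≤ -δ → W x ≤ ENNReal.ofReal (δ ^ (-(s * p))) := by
    intro δ x hδ hx
    refine ENNReal.ofReal_le_ofReal (Real.rpow_le_rpow_of_nonpos hδ ?_ (by linarith))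
    rw [abs_of_neg (by linarith)]; linarith
  -- the estimate away from the singularity, uniformly in the distance `δ` to it
  have main : ∀ δ : ℝ, 0 < δ →
      ∫⁻ x in Ioo (-L) (-δ), F x * W x ≤ 2 * (c1 * c2 + c3) * (J + E) := by
    intro δ hδ
    set I : ℝ≥0∞ := ∫⁻ x in Ioo (-L) (-δ), F x * W x with hI
    have hIt : I ≠ ⊤ := by
      refine ne_top_of_le_ne_top (b := J * ENNReal.ofReal (δ ^ (-(s * p))))
        (ENNReal.mul_ne_top hJt ENNReal.ofReal_ne_top) ?_
      calc I ≤ ∫⁻ x in Ioo (-L) (-δ), F x * ENNReal.ofReal (δ ^ (-(s * p))) := by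
            refine setLIntegral_mono' measurableSet_Ioo fun x hx => ?_
            gcongr; exact hWle hδ hx.2.le
        _ = (∫⁻ x in Ioo (-L) (-δ), F x) * ENNReal.ofReal (δ ^ (-(s * p))) :=
            lintegral_mul_const _ hFm
        _ ≤ _ := by gcongr; exact lintegral_mono_set (Ioo_subset_Ioo le_rfl (by linarith))
    set A : Set ℝ := Ioo (-(L / (2 * K))) (-δ) with hA
    have hLK : 0 < L / (2 * K) := by positivity
    have hnear : ∫⁻ x in A, F x * W x ≤ 1 / 2 * I + c1 * c2 * E := by
      refine (hardy_near hf hp hs hK1 hL hδ).trans (add_le_add (mul_le_mul_left ?_ _) le_rfl)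
      refine (ENNReal.ofReal_le_ofReal hK).trans (le_of_eq ?_)
      rw [ENNReal.ofReal_div_of_pos (by norm_num)]; simp
    have hfar : ∫⁻ x in Ioc (-L) (-(L / (2 * K))), F x * W x ≤ c3 * J := by
      calc ∫⁻ x in Ioc (-L) (-(L / (2 * K))), F x * W x
          ≤ ∫⁻ x in Ioc (-L) (-(L / (2 * K))), c3 * F x := by
            refine setLIntegral_mono' measurableSet_Ioc fun x hx => ?_
            rw [mul_comm]; gcongr; exact hWle hLK hx.2
        _ = c3 * ∫⁻ x in Ioc (-L) (-(L / (2 * K))), F x := lintegral_const_mul _ hFm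
        _ ≤ _ := by
            gcongr
            exact lintegral_mono_set fun x hx => ⟨hx.1, by linarith [hx.2]⟩
    have hIle : I ≤ I / 2 + (c1 * c2 + c3) * (J + E) := by
      calc I ≤ ∫⁻ x in A ∪ Ioc (-L) (-(L / (2 * K))), F x * W x := by
            refine lintegral_mono_set fun x hx => ?_
            rcases le_or_gt x (-(L / (2 * K))) with h | h
            · exact Or.inr ⟨hx.1, h⟩
            · exact Or.inl ⟨h, hx.2⟩
        _ ≤ (1 / 2 * I + c1 * c2 * E) + c3 * J :=
            (lintegral_union_le _ _ _).trans (add_le_add hnear hfar)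
        _ = I / 2 + (c1 * c2 * E + c3 * J) := by
            rw [add_assoc, one_div, mul_comm, ← div_eq_mul_inv]
        _ ≤ _ := by
            gcongr
            rw [add_mul]
            gcongr
            · exact le_add_self
            · exact le_self_add
    have h2 : I / 2 + I / 2 ≤ I / 2 + (c1 * c2 + c3) * (J + E) := by rwa [ENNReal.add_halves]
    have h3 : I / 2 ≤ (c1 * c2 + c3) * (J + E) :=
      (ENNReal.add_le_add_iff_left (ENNReal.div_ne_top hIt (by norm_num))).1 h2
    rw [ENNReal.div_le_iff (by norm_num) (by norm_num)] at h3
    refine h3.trans (le_of_eq (by ring))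
  -- monotone convergence as `δ → 0`
  have hun : Ioo (-L) 0 = ⋃ n : ℕ, Ioo (-L) (-(1 / ((n : ℝ) + 1))) := by
    ext x
    simp only [mem_Ioo, mem_iUnion, exists_and_left]
    refine and_congr_right fun _ => ⟨fun hx => ?_, fun ⟨n, hn⟩ => ?_⟩
    · obtain ⟨n, hn⟩ := exists_nat_one_div_lt (neg_pos.2 hx)
      exact ⟨n, by linarith⟩
    · have : (0 : ℝ) < 1 / (n + 1) := by positivity
      linarith
  rw [hun, setLIntegral_iUnion_of_directed]
  · exact iSup_le fun n => main _ (by positivity)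
  · refine (monotone_nat_of_le_succ fun n => ?_).directed_le
    refine Ioo_subset_Ioo le_rfl (neg_le_neg ?_)
    exact one_div_le_one_div_of_le (by positivity) (by push_cast; linarith)

end Hardy

/-! ### Concatenation of functions in the Slobodeckij space -/

section Concatenation

variable {N : ℕ} {p s : ℝ}

theorem lintegral_mul_add_mul {μ : Measure ℝ} {f g : ℝ → ℝ≥0∞} (hf : Measurable f)
    (hg : Measurable g) (c a b : ℝ≥0∞) :
    ∫⁻ x, c * (a * f x + b * g x) ∂μ = c * (a * ∫⁻ x, f x ∂μ + b * ∫⁻ x, g x ∂μ) := by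
  have h1 : Measurable fun x => a * f x + b * g x := (hf.const_mul a).add (hg.const_mul b)
  rw [lintegral_const_mul c h1, lintegral_add_left (hf.const_mul a), lintegral_const_mul a hf,
    lintegral_const_mul b hg]

theorem lintegral_abs_sub_rpow_neg_le {θ t L : ℝ} (hθ : 0 < θ) (ht : t < 0) :
    ∫⁻ ξ in Ioo 0 L, ENNReal.ofReal (|t - ξ| ^ (-(1 + θ))) ≤
      ENNReal.ofReal (1 / θ) * ENNReal.ofReal (|t| ^ (-θ)) := by
  have ht' : 0 < -t := neg_pos.2 ht
  have h1 := lintegral_vol_add (fun r => ENNReal.ofReal (|r| ^ (-(1 + θ)))) (-t) (L - t) (-t)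
  simp only [sub_neg_eq_add, neg_add_cancel, sub_add_cancel, ← sub_eq_add_neg] at h1
  simp only [abs_sub_comm t]
  rw [h1, ← ENNReal.ofReal_mul (by positivity)]
  have hI : IntegrableOn (fun r : ℝ => r ^ (-(1 + θ))) (Ioi (-t)) :=
    integrableOn_Ioi_rpow_of_lt (by linarith) ht'
  calc ∫⁻ r in Ioo (-t) (L - t), ENNReal.ofReal (|r| ^ (-(1 + θ)))
      ≤ ∫⁻ r in Ioi (-t), ENNReal.ofReal (|r| ^ (-(1 + θ))) :=
        lintegral_mono_set Ioo_subset_Ioi_self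
    _ = ∫⁻ r in Ioi (-t), ENNReal.ofReal (r ^ (-(1 + θ))) := by
        refine setLIntegral_congr_fun measurableSet_Ioi fun r hr => ?_
        simp only [abs_of_pos (ht'.trans hr)]
    _ = ENNReal.ofReal (∫ r in Ioi (-t), r ^ (-(1 + θ))) := by
        rw [ofReal_integral_eq_lintegral_ofReal hI]
        filter_upwards [ae_restrict_mem measurableSet_Ioi] with r hr
        exact Real.rpow_nonneg (ht'.trans hr).le _
    _ ≤ _ := by
        refine ENNReal.ofReal_le_ofReal (le_of_eq ?_)
        rw [integral_Ioi_rpow_of_lt (by linarith) ht', abs_of_neg ht,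
          show -(1 + θ) + 1 = -θ by ring]
        field_simp

/-- The interaction of the values of `f` on both sides of `0`. -/
theorem slobEnergy_cross_le {f : ℝ → Vec N} (hf : StronglyMeasurable f) (hp : 1 < p) (hs : 0 < s)
    {a L : ℝ} {d : ℝ≥0∞} (hd : ∀ᵐ ξ ∂vol 0 L, ‖f ξ‖ₑ ≤ d) :
    ∫⁻ t in Ioo (-a) 0, ∫⁻ ξ in Ioo 0 L, slobKernel p s f t ξ ≤
      2 ^ (p - 1) * (ENNReal.ofReal (1 / (s * p)) *
        (∫⁻ t in Ioo (-a) 0, ‖f t‖ₑ ^ p * ENNReal.ofReal (|t| ^ (-(s * p)))) +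
        d ^ p * powerMass (-(1 + s * p) / 2) L * powerMass (-(1 + s * p) / 2) a) := by
  have hp0 : 0 < p := by linarith
  have hθ : 0 < s * p := mul_pos hs hp0
  set γ : ℝ := -(1 + s * p) / 2 with hγ
  have hFm : Measurable fun x => ‖f x‖ₑ ^ p := hf.enorm.pow_const p
  have hin : ∀ t ∈ Ioo (-a) 0, ∫⁻ ξ in Ioo 0 L, slobKernel p s f t ξ ≤
      2 ^ (p - 1) * (ENNReal.ofReal (1 / (s * p)) *
        (‖f t‖ₑ ^ p * ENNReal.ofReal (|t| ^ (-(s * p)))) +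
        d ^ p * powerMass γ L * ENNReal.ofReal (|t| ^ γ)) := by
    intro t ht
    have ht0 : 0 < -t := neg_pos.2 ht.2
    -- for the bounded values, `|t - ξ| ^ 2 ≥ |t| |ξ|` separates the variables
    have h1 : ∀ᵐ ξ ∂vol 0 L, slobKernel p s f t ξ ≤ 2 ^ (p - 1) *
        (‖f t‖ₑ ^ p * ENNReal.ofReal (|t - ξ| ^ (-(1 + s * p))) +
          d ^ p * ENNReal.ofReal (|t| ^ γ) * ENNReal.ofReal (|ξ| ^ γ)) := by
      filter_upwards [hd, ae_restrict_mem measurableSet_Ioo] with ξ hξ hξ0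
      have e1 : ‖f t - f ξ‖ₑ ^ p ≤ 2 ^ (p - 1) * (‖f t‖ₑ ^ p + d ^ p) := by
        refine (ENNReal.rpow_le_rpow ((enorm_sub_le).trans (add_le_add le_rfl hξ)) hp0.le).trans ?_
        exact ENNReal.rpow_add_le_mul_rpow_add_rpow _ _ hp.le
      have e2 : ENNReal.ofReal (|t - ξ| ^ (-(1 + s * p))) ≤
          ENNReal.ofReal (|t| ^ γ) * ENNReal.ofReal (|ξ| ^ γ) := by
        rw [← ENNReal.ofReal_mul (by positivity), abs_of_neg ht.2, abs_of_pos hξ0.1,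
          abs_of_neg (by linarith [hξ0.1]), ← Real.mul_rpow ht0.le hξ0.1.le]
        refine ENNReal.ofReal_le_ofReal ?_
        have e3 : (-(t - ξ)) ^ (-(1 + s * p)) = ((-(t - ξ)) ^ (2 : ℝ)) ^ γ := by
          rw [← Real.rpow_mul (by linarith [hξ0.1])]; congr 1; rw [hγ]; ring
        rw [e3, Real.rpow_two]
        refine Real.rpow_le_rpow_of_nonpos (mul_pos ht0 hξ0.1) ?_ (by rw [hγ]; linarith)
        nlinarith [mul_pos ht0 hξ0.1, sq_nonneg t, sq_nonneg ξ]
      calc slobKernel p s f t ξ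
          ≤ 2 ^ (p - 1) * (‖f t‖ₑ ^ p + d ^ p) * ENNReal.ofReal (|t - ξ| ^ (-(1 + s * p))) := by
            rw [slobKernel]; gcongr
        _ = 2 ^ (p - 1) * (‖f t‖ₑ ^ p * ENNReal.ofReal (|t - ξ| ^ (-(1 + s * p))) +
            d ^ p * ENNReal.ofReal (|t - ξ| ^ (-(1 + s * p)))) := by ring
        _ ≤ _ := by
            rw [mul_assoc (d ^ p)]
            gcongr
    have hm1 : Measurable fun ξ : ℝ => ENNReal.ofReal (|t - ξ| ^ (-(1 + s * p))) := by fun_prop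
    have hm2 : Measurable fun ξ : ℝ => ENNReal.ofReal (|ξ| ^ γ) := by fun_prop
    refine (lintegral_mono_ae h1).trans ?_
    rw [lintegral_mul_add_mul hm1 hm2]
    have h3 : ∫⁻ ξ in Ioo 0 L, ENNReal.ofReal (|ξ| ^ γ) ≤ powerMass γ L := by
      refine lintegral_mono_set fun x hx => ⟨?_, hx.2⟩
      linarith [hx.1, hx.1.trans hx.2]
    refine mul_le_mul_right (add_le_add ?_ ?_) _
    · refine (mul_le_mul_right (lintegral_abs_sub_rpow_neg_le hθ ht.2) _).trans (le_of_eq ?_)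
      ring
    · refine (mul_le_mul_right h3 _).trans (le_of_eq ?_)
      ring
  refine (setLIntegral_mono' measurableSet_Ioo hin).trans ?_
  have hm3 : Measurable fun t => ‖f t‖ₑ ^ p * ENNReal.ofReal (|t| ^ (-(s * p))) :=
    hFm.mul (by fun_prop)
  have hm4 : Measurable fun t : ℝ => ENNReal.ofReal (|t| ^ γ) := by fun_prop
  rw [lintegral_mul_add_mul hm3 hm4]
  gcongr
  refine lintegral_mono_set fun x hx => ⟨hx.1, ?_⟩
  linarith [hx.2, hx.1.trans hx.2]

theorem lintegral_slobKernel_congr {f g : ℝ → Vec N} {μ ν : Measure ℝ}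
    (hμ : ∀ᵐ t ∂μ, f t = g t) (hν : ∀ᵐ t ∂ν, f t = g t) :
    ∫⁻ t, ∫⁻ ξ, slobKernel p s f t ξ ∂ν ∂μ = ∫⁻ t, ∫⁻ ξ, slobKernel p s g t ξ ∂ν ∂μ := by
  refine lintegral_congr_ae ?_
  filter_upwards [hμ] with t ht
  refine lintegral_congr_ae ?_
  filter_upwards [hν] with ξ hξ
  rw [slobKernel, slobKernel, ht, hξ]

/-- A function that lies in the Slobodeckij space on `(-a, 0)` and in `W^1_p` on `(0, L)` lies in
the Slobodeckij space on `(-a, L)`, whether or not it is continuous at `0`, since `s p < 1`. -/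
theorem slobSeminorm_concat (hp : 1 < p) (hs : 0 < s) (hs1 : s < 1) (hsp : s * p < 1)
    (hps : p * (1 - s) < 2) {a L : ℝ} (ha : 0 < a) (hL : 0 < L) :
    ∃ C : ℝ≥0∞, C < ⊤ ∧ ∀ (f : ℝ → Vec N) (G : ℝ → ℝ≥0∞) (d : ℝ≥0∞),
      AEStronglyMeasurable f (vol (-a) L) → Measurable G →
      (∀ ξ t, 0 < ξ → ξ ≤ t → t < L → ‖f t - f ξ‖ₑ ≤ ∫⁻ r in Ioo ξ t, G r) →
      (∀ ξ ∈ Ioo 0 L, ‖f ξ‖ₑ ≤ d) →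
      slobSeminorm p s (-a) L f ^ p ≤ C * ((∫⁻ t in Ioo (-a) 0, ‖f t‖ₑ ^ p) +
        slobSeminorm p s (-a) 0 f ^ p + d ^ p + ∫⁻ r in Ioo 0 L, G r ^ p) := by
  have hp0 : 0 < p := by linarith
  have hθ : 0 < s * p := mul_pos hs hp0
  obtain ⟨CH, hCH, hH⟩ := hardy (N := N) hp hs hsp ha
  set D : ℝ≥0∞ := powerMass ((p - 2 - s * p) / 2) L ^ 2 with hD
  have hDt : D < ⊤ := ENNReal.pow_lt_top (powerMass_lt_top (by nlinarith) hL.le)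
  set X1 : ℝ≥0∞ := 2 ^ (p - 1) * (ENNReal.ofReal (1 / (s * p)) * CH) with hX1
  set X2 : ℝ≥0∞ := 2 ^ (p - 1) *
    (powerMass (-(1 + s * p) / 2) L * powerMass (-(1 + s * p) / 2) a) with hX2
  have h2p : (2 : ℝ≥0∞) ^ (p - 1) < ⊤ :=
    ENNReal.rpow_lt_top_of_nonneg (by linarith) ENNReal.ofNat_ne_top
  have hX1t : X1 < ⊤ := ENNReal.mul_lt_top h2p (ENNReal.mul_lt_top ENNReal.ofReal_lt_top hCH)
  have hX2t : X2 < ⊤ := ENNReal.mul_lt_top h2p (ENNReal.mul_lt_top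
    (powerMass_lt_top (by linarith) hL.le) (powerMass_lt_top (by linarith) ha.le))
  refine ⟨1 + D + 2 * X1 + 2 * X2, ?_, fun f G d hf hG hprim hd => ?_⟩
  · refine ENNReal.add_lt_top.2 ⟨ENNReal.add_lt_top.2 ⟨ENNReal.add_lt_top.2 ⟨by simp, hDt⟩, ?_⟩, ?_⟩
    · exact ENNReal.mul_lt_top (by simp) hX1t
    · exact ENNReal.mul_lt_top (by simp) hX2t
  obtain ⟨f', hf', hff'⟩ := hf
  have hneg : ∀ᵐ t ∂vol (-a) 0, f t = f' t := ae_vol_mono le_rfl hL.le hff'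
  have hpos : ∀ᵐ t ∂vol 0 L, f t = f' t := ae_vol_mono (by linarith) le_rfl hff'
  set J := ∫⁻ t in Ioo (-a) 0, ‖f t‖ₑ ^ p with hJ
  set I := ∫⁻ r in Ioo 0 L, G r ^ p with hI
  have hS : slobSeminorm p s (-a) 0 f ^ p =
    ∫⁻ t in Ioo (-a) 0, ∫⁻ ξ in Ioo (-a) 0, slobKernel p s f' t ξ := by
    rw [slobSeminorm_rpow hp0]; exact lintegral_slobKernel_congr hneg hneg
  set S := slobSeminorm p s (-a) 0 f ^ p with hSdef
  have hJ' : ∫⁻ t in Ioo (-a) 0, ‖f' t‖ₑ ^ p = J := by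
    rw [hJ]; refine lintegral_congr_ae ?_
    filter_upwards [hneg] with t ht
    rw [ht]
  have hPP : ∫⁻ t in Ioo 0 L, ∫⁻ ξ in Ioo 0 L, slobKernel p s f' t ξ ≤ D * I := by
    rw [← lintegral_slobKernel_congr (p := p) (s := s) hpos hpos]
    exact slobEnergy_le_of_primitive hp hps hG hprim
  have hNP : ∫⁻ t in Ioo (-a) 0, ∫⁻ ξ in Ioo 0 L, slobKernel p s f' t ξ ≤
      X1 * (J + S) + X2 * d ^ p := by
    have hd' : ∀ᵐ ξ ∂vol 0 L, ‖f' ξ‖ₑ ≤ d := by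
      filter_upwards [hpos, ae_restrict_mem measurableSet_Ioo] with ξ h1 h2
      rw [← h1]; exact hd ξ h2
    refine (slobEnergy_cross_le hf' hp hs hd').trans ?_
    have := hH f' hf'
    rw [hJ', ← hS] at this
    refine (mul_le_mul_right (add_le_add_left (mul_le_mul_right this _) _) _).trans (le_of_eq ?_)
    rw [hX1, hX2]; ring
  have hPN : ∫⁻ t in Ioo 0 L, ∫⁻ ξ in Ioo (-a) 0, slobKernel p s f' t ξ =
      ∫⁻ t in Ioo (-a) 0, ∫⁻ ξ in Ioo 0 L, slobKernel p s f' t ξ := by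
    rw [lintegral_lintegral_swap (measurable_slobKernel hf').aemeasurable]
    simp only [fun t ξ => slobKernel_comm (p := p) (s := s) f' t ξ]
  have hun : vol (-a) L = vol (-a) 0 + vol 0 L :=
    vol_ae_eq_union (by linarith) hL.le
  have hkm : ∀ c b : ℝ, Measurable fun t => ∫⁻ ξ in Ioo c b, slobKernel p s f' t ξ := fun c b =>
    (measurable_slobKernel hf').lintegral_prod_right'
  have htot : slobSeminorm p s (-a) L f ^ p =
      (S + ∫⁻ t in Ioo (-a) 0, ∫⁻ ξ in Ioo 0 L, slobKernel p s f' t ξ) +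
      ((∫⁻ t in Ioo 0 L, ∫⁻ ξ in Ioo (-a) 0, slobKernel p s f' t ξ) +
        ∫⁻ t in Ioo 0 L, ∫⁻ ξ in Ioo 0 L, slobKernel p s f' t ξ) := by
    rw [slobSeminorm_rpow hp0, lintegral_slobKernel_congr hff' hff', hun]
    simp only [lintegral_add_measure]
    rw [lintegral_add_left (hkm _ _), lintegral_add_left (hkm _ _), hS]
  rw [htot, hPN]
  set X : ℝ≥0∞ := J + S + d ^ p + I with hX
  have b1 : J + S ≤ X := le_add_right le_self_add
  have b2 : S ≤ X := le_add_self.trans b1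
  have b3 : d ^ p ≤ X := le_add_right le_add_self
  have b4 : I ≤ X := le_add_self
  calc _ ≤ (S + (X1 * (J + S) + X2 * d ^ p)) + ((X1 * (J + S) + X2 * d ^ p) + D * I) := by gcongr
    _ = S + D * I + 2 * X1 * (J + S) + 2 * X2 * d ^ p := by ring
    _ ≤ X + D * X + 2 * X1 * X + 2 * X2 * X := by gcongr
    _ = _ := by ring

end Concatenation

namespace Setting

variable {N : ℕ} [NeZero N] (S : Setting N)

/-! ### The distance in the phase space -/

theorem p_pos : 0 < S.p := by linarith [S.p_gt]

theorem s_mul_p_lt : S.s * S.p < 1 := by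
  have h := S.p_lt.trans_le (min_le_left _ _)
  rw [lt_div_iff₀ S.s_pos] at h
  linarith

theorem p_mul_one_sub_s_lt : S.p * (1 - S.s) < 1 := by
  have h := S.p_lt.trans_le (min_le_right _ _)
  rwa [lt_div_iff₀ (by linarith [S.s_lt])] at h

theorem eLpNorm_rpow_eq {E : Type*} [NormedAddCommGroup E] (f : ℝ → E) (μ : Measure ℝ) :
    eLpNorm f (ENNReal.ofReal S.p) μ ^ S.p = ∫⁻ x, ‖f x‖ₑ ^ S.p ∂μ := by
  have hp := S.p_pos
  rw [eLpNorm_eq_lintegral_rpow_enorm_toReal (by simpa using hp) ENNReal.ofReal_ne_top,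
    ENNReal.toReal_ofReal hp.le, ← ENNReal.rpow_mul, one_div_mul_cancel hp.ne', ENNReal.rpow_one]

theorem neg_two_T_le : -2 * S.T ≤ -S.T - S.σ := by
  linarith [S.T_pos, S.σ_le]

theorem bNorm_congr {φ ψ : ℝ → Vec N} (h : ∀ᵐ t ∂vol (-2 * S.T) 0, φ t = ψ t) :
    S.bNorm φ = S.bNorm ψ := by
  have h' := ae_vol_mono S.neg_two_T_le le_rfl h
  rw [bNorm, bNorm, slobNorm, slobNorm, slobSeminorm_congr h', eLpNorm_congr_ae h,
    eLpNorm_congr_ae h']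

theorem bNorm_zero : S.bNorm (fun _ => 0) = 0 := by
  have hp := S.p_pos
  simp [bNorm, slobNorm, slobSeminorm, ENNReal.zero_rpow_of_pos hp, hp]

theorem bNorm_neg (φ : ℝ → Vec N) : S.bNorm (fun t => -φ t) = S.bNorm φ := by
  rw [bNorm, bNorm, slobNorm, slobNorm, slobSeminorm_neg]
  exact congrArg₂ _ (eLpNorm_neg ..) (congrArg₂ _ (eLpNorm_neg ..) rfl)

theorem bNorm_add_le {φ ψ : ℝ → Vec N} (hφ : AEStronglyMeasurable φ (vol (-2 * S.T) 0))
    (hψ : AEStronglyMeasurable ψ (vol (-2 * S.T) 0)) :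
    S.bNorm (fun t => φ t + ψ t) ≤ S.bNorm φ + S.bNorm ψ := by
  have hle : vol (-S.T - S.σ) 0 ≤ vol (-2 * S.T) 0 :=
    Measure.restrict_mono (Ioo_subset_Ioo S.neg_two_T_le le_rfl) le_rfl
  have h1 := eLpNorm_add_le hφ hψ S.one_le_p
  have h2 := eLpNorm_add_le (hφ.mono_measure hle) (hψ.mono_measure hle) S.one_le_p
  have h3 := slobSeminorm_add_le (s := S.s) S.p_gt.le (hφ.mono_measure hle) (hψ.mono_measure hle)
  calc S.bNorm (fun t => φ t + ψ t)
      ≤ _ + (_ + _) := add_le_add h1 (add_le_add h2 h3)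
    _ = _ := by rw [bNorm, bNorm, slobNorm, slobNorm]; ring

variable {S}

theorem sdist_comm (q q' : S.State) : S.sdist q q' = S.sdist q' q := by
  rw [sdist, sdist, enorm_sub_rev, ← S.bNorm_neg]
  simp only [neg_sub]

theorem sdist_triangle {q₁ q₂ q₃ : S.State}
    (h₁ : AEStronglyMeasurable q₁.1 (vol (-2 * S.T) 0))
    (h₂ : AEStronglyMeasurable q₂.1 (vol (-2 * S.T) 0))
    (h₃ : AEStronglyMeasurable q₃.1 (vol (-2 * S.T) 0)) :
    S.sdist q₁ q₃ ≤ S.sdist q₁ q₂ + S.sdist q₂ q₃ := by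
  have h := S.bNorm_add_le (h₁.sub h₂) (h₂.sub h₃)
  simp only [Pi.sub_apply, sub_add_sub_cancel] at h
  have h' := enorm_add_le (q₁.2 - q₂.2) (q₂.2 - q₃.2)
  rw [sub_add_sub_cancel] at h'
  refine (add_le_add h h').trans (le_of_eq ?_)
  rw [sdist, sdist]
  exact add_add_add_comm _ _ _ _

/-- Equality of states as elements of the phase space, that is, up to equality almost everywhere
of the histories. -/
def StateEq (q q' : S.State) : Prop :=
  (∀ᵐ t ∂vol (-2 * S.T) 0, q.1 t = q'.1 t) ∧ q.2 = q'.2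

namespace StateEq

variable {q q' q'' : S.State}

theorem symm (h : S.StateEq q q') : S.StateEq q' q :=
  ⟨h.1.mono fun _ ht => ht.symm, h.2.symm⟩

theorem trans (h : S.StateEq q q') (h' : S.StateEq q' q'') : S.StateEq q q'' :=
  ⟨by filter_upwards [h.1, h'.1] with t a b using a.trans b, h.2.trans h'.2⟩

theorem sdist_left (h : S.StateEq q q') (r : S.State) : S.sdist q r = S.sdist q' r := by
  rw [sdist, sdist, h.2]
  congr 1
  refine S.bNorm_congr ?_
  filter_upwards [h.1] with t ht
  rw [ht]

theorem sdist_right (h : S.StateEq q q') (r : S.State) : S.sdist r q = S.sdist r q' := by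
  rw [sdist_comm, h.sdist_left, sdist_comm]

theorem sdist_eq_zero (h : S.StateEq q q') : S.sdist q q' = 0 := by
  rw [h.sdist_left, sdist]
  simp [S.bNorm_zero]

theorem mem_phase (h : S.StateEq q q') (hq : q ∈ S.phase) : q' ∈ S.phase := by
  have h' := ae_vol_mono S.neg_two_T_le le_rfl h.1
  refine ⟨hq.1.ae_eq h.1, ?_⟩
  have := hq.2
  rwa [slobNorm, slobSeminorm_congr h', eLpNorm_congr_ae h'] at this

end StateEq

theorem mem_phase_iff {q : S.State} : q ∈ S.phase ↔
    AEStronglyMeasurable q.1 (vol (-2 * S.T) 0) ∧ S.bNorm q.1 < ⊤ := by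
  rw [bNorm, ENNReal.add_lt_top]
  exact ⟨fun h => ⟨h.1.1, h.1.2, h.2⟩, fun h => ⟨⟨h.1, h.2.1⟩, h.2.2⟩⟩

/-- A state at finite distance from the phase space belongs to the phase space. -/
theorem mem_phase_of_sdist_lt_top {q q' : S.State} (hq : q ∈ S.phase)
    (hq' : AEStronglyMeasurable q'.1 (vol (-2 * S.T) 0)) (h : S.sdist q' q < ⊤) :
    q' ∈ S.phase := by
  refine mem_phase_iff.2 ⟨hq', ?_⟩
  have h1 := S.bNorm_add_le (hq'.sub hq.1.1) hq.1.1
  simp only [Pi.sub_apply, sub_add_cancel] at h1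
  refine h1.trans_lt (ENNReal.add_lt_top.2 ⟨lt_of_le_of_lt le_self_add h, (mem_phase_iff.1 hq).2⟩)

/-! ### Continuous dependence on the data in the phase space -/

/-- The value of the difference of two solutions, in terms of the distance of the data. -/
theorem exists_enorm_sub_le (S : Setting N) : ∃ C : ℝ≥0∞, C < ⊤ ∧ ∀ (q q' : S.State) (h h' : ℝ → ℝ)
    (v v' : ℝ → Vec N), S.IntegralSol h q (2 * S.T) v → S.IntegralSol h' q' (2 * S.T) v' →
    (∀ᵐ t ∂vol 0 (2 * S.T), h t = h' t) → ∀ t ∈ Icc 0 (2 * S.T),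
      ‖v t - v' t‖ₑ ≤ C * S.sdist q q' := by
  have hT := S.T_pos
  set m : ℝ≥0∞ := (vol (-2 * S.T) 0) univ ^ (1 / (1 : ℝ≥0∞).toReal -
    1 / (ENNReal.ofReal S.p).toReal) with hm
  have hmt : m < ⊤ := by
    refine ENNReal.rpow_lt_top_of_nonneg ?_ (measure_ne_top _ _)
    rw [ENNReal.toReal_ofReal S.p_pos.le]
    have := inv_le_one_of_one_le₀ S.p_gt.le
    simp only [ENNReal.toReal_one, one_div]; linarith
  set E := Real.exp ((‖S.Aop‖ + ‖S.Bop‖) * (2 * S.T)) with hE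
  refine ⟨(1 + ‖S.Aop‖ₑ * m) * ENNReal.ofReal E, ENNReal.mul_lt_top
    (ENNReal.add_lt_top.2 ⟨by simp, ENNReal.mul_lt_top enorm_lt_top hmt⟩) ENNReal.ofReal_lt_top, ?_⟩
  intro q q' h h' v v' H H' hh t ht
  have hφ : MemLp (fun r => q.1 r - q'.1 r) (ENNReal.ofReal S.p) (vol (-2 * S.T) 0) :=
    H.history.sub H'.history
  have hφi := integrable_of_memLp hφ
  have hL1 : ENNReal.ofReal (∫ r in Ioo (-2 * S.T) 0, ‖q.1 r - q'.1 r‖) ≤ S.sdist q q' * m := by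
    rw [ofReal_integral_norm_eq_lintegral_enorm hφi, ← eLpNorm_one_eq_lintegral_enorm]
    refine (eLpNorm_le_eLpNorm_mul_rpow_measure_univ S.one_le_p hφ.1).trans ?_
    gcongr
    exact le_add_right le_self_add
  have hx : ‖q.2 - q'.2‖ₑ ≤ S.sdist q q' := le_add_self
  calc ‖v t - v' t‖ₑ = ENNReal.ofReal ‖v t - v' t‖ := (ofReal_norm _).symm
    _ ≤ ENNReal.ofReal ((‖q.2 - q'.2‖ + ‖S.Aop‖ * ∫ r in Ioo (-2 * S.T) 0, ‖q.1 r - q'.1 r‖) * E) := by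
        refine ENNReal.ofReal_le_ofReal ((H.norm_sub_le H' hh t ht).trans ?_)
        refine mul_le_mul_of_nonneg_left (Real.exp_le_exp.2 ?_) (by positivity)
        exact mul_le_mul_of_nonneg_left ht.2 (by positivity)
    _ = (‖q.2 - q'.2‖ₑ + ‖S.Aop‖ₑ * ENNReal.ofReal (∫ r in Ioo (-2 * S.T) 0, ‖q.1 r - q'.1 r‖)) *
          ENNReal.ofReal E := by
        rw [ENNReal.ofReal_mul (by positivity), ENNReal.ofReal_add (norm_nonneg _) (by positivity),
          ENNReal.ofReal_mul (norm_nonneg _), ofReal_norm, ofReal_norm]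
    _ ≤ (S.sdist q q' + ‖S.Aop‖ₑ * (S.sdist q q' * m)) * ENNReal.ofReal E := by gcongr
    _ = _ := by ring

/-- The states of two solutions with the same input stay close in the phase space, with a Lipschitz
constant that is uniform on one delay interval. -/
theorem exists_sdist_stateAt_le (S : Setting N) : ∃ C : ℝ≥0∞, C < ⊤ ∧ ∀ (q q' : S.State)
    (h h' : ℝ → ℝ) (v v' : ℝ → Vec N), S.IntegralSol h q (2 * S.T) v →
    S.IntegralSol h' q' (2 * S.T) v' → (∀ᵐ t ∂vol 0 (2 * S.T), h t = h' t) →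
    ∀ t ∈ Icc 0 (2 * S.T), S.sdist (S.stateAt v t) (S.stateAt v' t) ≤ C * S.sdist q q' := by
  have hT := S.T_pos
  have hp := S.p_pos
  have hσ := S.σ_pos
  have hσT := S.neg_two_T_le
  obtain ⟨C1, hC1, H1⟩ := exists_enorm_sub_le S
  obtain ⟨C2, hC2, H2⟩ := slobSeminorm_concat (N := N) S.p_gt S.s_pos S.s_lt S.s_mul_p_lt
    (by linarith [S.p_mul_one_sub_s_lt]) (a := S.T + S.σ) (L := 2 * S.T) (by linarith) (by linarith)
  -- bounds of the `p`-th powers of the norms of the difference `w` and of its derivative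
  set Y : ℝ≥0∞ := 1 + C1 ^ S.p * ENNReal.ofReal (2 * S.T) with hY
  set Z : ℝ≥0∞ := 2 ^ (S.p - 1) * (‖S.Bop‖ₑ ^ S.p * (C1 ^ S.p * ENNReal.ofReal (2 * S.T)) +
    ‖S.Aop‖ₑ ^ S.p) with hZ
  set X : ℝ≥0∞ := C2 * (1 + 1 + C1 ^ S.p + Z) with hX
  have hC1p : C1 ^ S.p < ⊤ := ENNReal.rpow_lt_top_of_nonneg hp.le hC1.ne
  have hYt : Y < ⊤ :=
    ENNReal.add_lt_top.2 ⟨by simp, ENNReal.mul_lt_top hC1p ENNReal.ofReal_lt_top⟩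
  have hZt : Z < ⊤ := by
    refine ENNReal.mul_lt_top
      (ENNReal.rpow_lt_top_of_nonneg (by linarith [S.p_gt]) ENNReal.ofNat_ne_top)
      (ENNReal.add_lt_top.2 ⟨ENNReal.mul_lt_top ?_ (ENNReal.mul_lt_top hC1p ENNReal.ofReal_lt_top),
        ?_⟩)
    · exact ENNReal.rpow_lt_top_of_nonneg hp.le enorm_ne_top
    · exact ENNReal.rpow_lt_top_of_nonneg hp.le enorm_ne_top
  have hXt : X < ⊤ := ENNReal.mul_lt_top hC2 (by
    simp only [ENNReal.add_lt_top]; exact ⟨⟨⟨by simp, by simp⟩, hC1p⟩, hZt⟩)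
  have hroot : ∀ {x c : ℝ≥0∞} (d : ℝ≥0∞), x ^ S.p ≤ c * d ^ S.p → x ≤ c ^ (1 / S.p) * d := by
    intro x c d hx
    have := ENNReal.rpow_le_rpow hx (by positivity : 0 ≤ 1 / S.p)
    rwa [ENNReal.mul_rpow_of_nonneg _ _ (by positivity), ← ENNReal.rpow_mul, ← ENNReal.rpow_mul,
      mul_one_div_cancel hp.ne', ENNReal.rpow_one, ENNReal.rpow_one] at this
  have hrt : ∀ {c : ℝ≥0∞}, c < ⊤ → c ^ (1 / S.p) < ⊤ := fun hc =>
    ENNReal.rpow_lt_top_of_nonneg (by positivity) hc.ne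
  refine ⟨Y ^ (1 / S.p) + (Y ^ (1 / S.p) + X ^ (1 / S.p)) + C1, ?_, ?_⟩
  · simp only [ENNReal.add_lt_top]; exact ⟨⟨hrt hYt, hrt hYt, hrt hXt⟩, hC1⟩
  intro q q' h h' v v' H H' hh t ht
  set d : ℝ≥0∞ := S.sdist q q' with hd
  have hsup := H1 q q' h h' v v' H H' hh
  rw [← hd] at hsup
  set w : ℝ → Vec N := fun t => v t - v' t with hw
  have hwm : MemLp w (ENNReal.ofReal S.p) (vol (-2 * S.T) (2 * S.T)) :=
    (H.memLp (by linarith)).sub (H'.memLp (by linarith))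
  have hwφ : ∀ᵐ r ∂vol (-2 * S.T) 0, w r = q.1 r - q'.1 r := by
    filter_upwards [H.initial, H'.initial] with r a b
    simp only [hw, a, b]
  -- the history
  have hneg : ∫⁻ r in Ioo (-2 * S.T) 0, ‖w r‖ₑ ^ S.p ≤ d ^ S.p := by
    rw [← S.eLpNorm_rpow_eq w, eLpNorm_congr_ae hwφ]
    gcongr
    exact le_add_right le_self_add
  have hslob : slobSeminorm S.p S.s (-(S.T + S.σ)) 0 w ≤ d := by
    rw [neg_add', slobSeminorm_congr (ae_vol_mono hσT le_rfl hwφ)]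
    exact le_add_right (le_add_left le_add_self)
  -- the solution
  have hpos : ∫⁻ r in Ioo 0 (2 * S.T), ‖w r‖ₑ ^ S.p ≤
      C1 ^ S.p * ENNReal.ofReal (2 * S.T) * d ^ S.p := by
    calc ∫⁻ r in Ioo 0 (2 * S.T), ‖w r‖ₑ ^ S.p ≤ ∫⁻ r in Ioo 0 (2 * S.T), (C1 * d) ^ S.p := by
          refine setLIntegral_mono' measurableSet_Ioo fun r hr => ?_
          gcongr
          exact hsup r (Ioo_subset_Icc_self hr)
      _ = _ := by
          rw [setLIntegral_const, Real.volume_Ioo, sub_zero, ENNReal.mul_rpow_of_nonneg _ _ hp.le]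
          ring
  have hall : ∫⁻ r in Ioo (-2 * S.T) (2 * S.T), ‖w r‖ₑ ^ S.p ≤ Y * d ^ S.p := by
    have e : volume.restrict (Ioo (-2 * S.T) (2 * S.T)) = vol (-2 * S.T) 0 + vol 0 (2 * S.T) :=
      vol_ae_eq_union (by linarith) (by linarith)
    rw [e, lintegral_add_measure, hY, add_mul, one_mul]
    exact add_le_add hneg hpos
  -- the derivative of the solution
  set F : ℝ → Vec N := fun r => S.rhs h v r - S.rhs h' v' r with hF
  have hFm : MemLp F (ENNReal.ofReal S.p) (vol 0 (2 * S.T)) := H.memLp_rhs.sub H'.memLp_rhs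
  have hFi : Integrable F (vol 0 (2 * S.T)) := integrable_of_memLp hFm
  obtain ⟨F', hF', hFF'⟩ := hFm.1
  have hprim : ∀ ξ t, 0 < ξ → ξ ≤ t → t < 2 * S.T →
      ‖w t - w ξ‖ₑ ≤ ∫⁻ r in Ioo ξ t, ‖F' r‖ₑ := by
    intro ξ t hξ hξt htT
    have m1 : ξ ∈ Icc 0 (2 * S.T) := ⟨hξ.le, by linarith⟩
    have m2 : t ∈ Icc 0 (2 * S.T) := ⟨by linarith, htT.le⟩
    have e : w t - w ξ = ∫ r in Ioo ξ t, F r := by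
      rw [← integral_Ioc_eq_integral_Ioo, ← intervalIntegral.integral_of_le hξt, hF,
        intervalIntegral.integral_sub (intervalIntegrable_of_vol H.integrable_rhs m1 m2)
        (intervalIntegrable_of_vol H'.integrable_rhs m1 m2), ← H.sub_eq_integral m1 m2,
        ← H'.sub_eq_integral m1 m2]
      simp only [hw]; abel
    rw [e]
    refine (enorm_integral_le_lintegral_enorm _).trans (le_of_eq (lintegral_congr_ae ?_))
    filter_upwards [ae_vol_mono hξ.le htT.le hFF'] with r hr
    rw [hr]
  have hFp : ∫⁻ r in Ioo 0 (2 * S.T), ‖F' r‖ₑ ^ S.p ≤ Z * d ^ S.p := by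
    have hdel : ∫⁻ r in Ioo 0 (2 * S.T), ‖w (r - 2 * S.T)‖ₑ ^ S.p ≤ d ^ S.p := by
      have := lintegral_vol_add (fun r => ‖w r‖ₑ ^ S.p) (-2 * S.T) 0 (-(2 * S.T))
      simp only [← sub_eq_add_neg, sub_neg_eq_add, zero_add] at this
      rw [show -2 * S.T + 2 * S.T = 0 by ring] at this
      rw [this]; exact hneg
    have hpt : ∀ᵐ r ∂vol 0 (2 * S.T), ‖F' r‖ₑ ^ S.p ≤ 2 ^ (S.p - 1) *
        ((‖S.Bop‖ₑ * (C1 * d)) ^ S.p + ‖S.Aop‖ₑ ^ S.p * ‖w (r - 2 * S.T)‖ₑ ^ S.p) := by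
      filter_upwards [hFF', hh, ae_restrict_mem measurableSet_Ioo] with r hr hhr hrm
      have e : F' r = -(S.Bop (w r)) + S.Aop (w (r - 2 * S.T)) := by
        rw [← hr]; simp only [hF, hw]
        rw [rhs_eq, rhs_eq, hhr, map_sub, map_sub]; abel
      rw [e]
      have e1 : ‖-(S.Bop (w r)) + S.Aop (w (r - 2 * S.T))‖ₑ ≤
          ‖S.Bop‖ₑ * (C1 * d) + ‖S.Aop‖ₑ * ‖w (r - 2 * S.T)‖ₑ := by
        refine (enorm_add_le _ _).trans (add_le_add ?_ (S.Aop.le_opENorm _))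
        rw [enorm_neg]
        refine (S.Bop.le_opENorm _).trans ?_
        gcongr
        exact hsup r (Ioo_subset_Icc_self hrm)
      refine (ENNReal.rpow_le_rpow e1 hp.le).trans ?_
      refine (ENNReal.rpow_add_le_mul_rpow_add_rpow _ _ S.p_gt.le).trans ?_
      rw [ENNReal.mul_rpow_of_nonneg ‖S.Aop‖ₑ _ hp.le]
    have htop1 : (2 : ℝ≥0∞) ^ (S.p - 1) ≠ ⊤ :=
      ENNReal.rpow_ne_top_of_nonneg (by linarith [S.p_gt]) ENNReal.ofNat_ne_top
    have htop2 : ‖S.Aop‖ₑ ^ S.p ≠ ⊤ := ENNReal.rpow_ne_top_of_nonneg hp.le enorm_ne_top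
    refine (lintegral_mono_ae hpt).trans ?_
    rw [lintegral_const_mul' _ _ htop1, lintegral_add_left measurable_const,
      lintegral_const_mul' _ _ htop2, setLIntegral_const, Real.volume_Ioo, sub_zero, hZ, mul_assoc,
      add_mul]
    refine mul_le_mul_right (add_le_add (le_of_eq ?_) (mul_le_mul_right hdel _)) _
    rw [ENNReal.mul_rpow_of_nonneg _ _ hp.le, ENNReal.mul_rpow_of_nonneg _ _ hp.le]
    ring
  have hslob' : slobSeminorm S.p S.s (-(S.T + S.σ)) (2 * S.T) w ≤ X ^ (1 / S.p) * d := by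
    refine hroot d ((H2 w (fun r => ‖F' r‖ₑ) (C1 * d) ?_ hF'.enorm hprim
      fun ξ hξ => hsup ξ (Ioo_subset_Icc_self hξ)).trans ?_)
    · exact (memLp_vol_mono (by linarith) le_rfl hwm).1
    · rw [hX, mul_assoc]
      refine mul_le_mul_right ?_ _
      have e1 : ∫⁻ t in Ioo (-(S.T + S.σ)) 0, ‖w t‖ₑ ^ S.p ≤ d ^ S.p :=
        (lintegral_mono_set (Ioo_subset_Ioo (by linarith) le_rfl)).trans hneg
      calc _ ≤ d ^ S.p + d ^ S.p + (C1 * d) ^ S.p + Z * d ^ S.p := by gcongr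
        _ = _ := by rw [ENNReal.mul_rpow_of_nonneg _ _ hp.le]; ring
  -- the norms of the shifted functions
  have hL : ∀ a, -2 * S.T ≤ a → eLpNorm (fun θ => w (t + θ)) (ENNReal.ofReal S.p) (vol a 0) ≤
      Y ^ (1 / S.p) * d := by
    intro a ha
    refine hroot d (le_trans ?_ hall)
    have hsub : Ioo (a + t) t ⊆ Ioo (-2 * S.T) (2 * S.T) :=
      Ioo_subset_Ioo (by linarith [ht.1]) ht.2
    have e := eLpNorm_vol_add (v := w) (r := ENNReal.ofReal S.p) (a := a + t) (b := t) (s := t)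
      (hwm.1.mono_measure (Measure.restrict_mono hsub le_rfl))
    rw [add_sub_cancel_right, sub_self] at e
    rw [e, S.eLpNorm_rpow_eq]
    exact lintegral_mono_set hsub
  have hSl : slobSeminorm S.p S.s (-S.T - S.σ) 0 (fun θ => w (t + θ)) ≤ X ^ (1 / S.p) * d := by
    have e := slobSeminorm_add (p := S.p) (s := S.s) w (-S.T - S.σ + t) t t
    rw [add_sub_cancel_right, sub_self] at e
    rw [e]
    exact (slobSeminorm_mono hp (by linarith [ht.1]) ht.2).trans hslob'
  calc S.sdist (S.stateAt v t) (S.stateAt v' t)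
      ≤ Y ^ (1 / S.p) * d + (Y ^ (1 / S.p) * d + X ^ (1 / S.p) * d) + C1 * d :=
        add_le_add (add_le_add (hL _ le_rfl) (add_le_add (hL _ hσT) hSl)) (hsup t ht)
    _ = _ := by ring

end Setting

/-! ### Translations of Lipschitz functions -/

/-- A Hölder condition with exponent `γ > s` bounds the Slobodeckij seminorm. -/
theorem slobSeminorm_le_of_holder {N : ℕ} {p s a b c γ : ℝ} {f : ℝ → Vec N} (hp : 0 < p)
    (hf : ∀ t ∈ Ioo a b, ∀ ξ ∈ Ioo a b, ‖f t - f ξ‖ ≤ c * |t - ξ| ^ γ) :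
    slobSeminorm p s a b f ≤ ENNReal.ofReal c *
      (powerMass (γ * p - (1 + s * p)) (b - a) * ENNReal.ofReal (b - a)) ^ (1 / p) := by
  have hk : ∀ t ∈ Ioo a b, ∀ ξ ∈ Ioo a b, slobKernel p s f t ξ ≤
      ENNReal.ofReal c ^ p * ENNReal.ofReal (|ξ - t| ^ (γ * p - (1 + s * p))) := by
    intro t ht ξ hξ
    rcases eq_or_ne t ξ with rfl | hne
    · simp [slobKernel, ENNReal.zero_rpow_of_pos hp]
    have h0 : 0 < |ξ - t| := abs_pos.2 (sub_ne_zero.2 hne.symm)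
    have h1 : ‖f t - f ξ‖ₑ ≤ ENNReal.ofReal c * ENNReal.ofReal (|ξ - t| ^ γ) := by
      rw [← ofReal_norm, abs_sub_comm, ← ENNReal.ofReal_mul' (by positivity)]
      exact ENNReal.ofReal_le_ofReal (hf t ht ξ hξ)
    calc slobKernel p s f t ξ
        ≤ (ENNReal.ofReal c * ENNReal.ofReal (|ξ - t| ^ γ)) ^ p *
          ENNReal.ofReal (|ξ - t| ^ (-(1 + s * p))) := by
          rw [slobKernel, abs_sub_comm t]; gcongr
      _ = _ := by
          rw [ENNReal.mul_rpow_of_nonneg _ _ hp.le,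
            ENNReal.ofReal_rpow_of_nonneg (Real.rpow_nonneg (abs_nonneg (ξ - t)) γ) hp.le,
            ← Real.rpow_mul h0.le, mul_assoc,
            ← ENNReal.ofReal_mul (by positivity), ← Real.rpow_add h0, ← sub_eq_add_neg]
  rw [slobSeminorm_eq hp]
  have h2 : ∫⁻ t in Ioo a b, ∫⁻ ξ in Ioo a b, slobKernel p s f t ξ ≤
      ENNReal.ofReal c ^ p * (powerMass (γ * p - (1 + s * p)) (b - a) * ENNReal.ofReal (b - a)) := by
    calc ∫⁻ t in Ioo a b, ∫⁻ ξ in Ioo a b, slobKernel p s f t ξ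
        ≤ ∫⁻ t in Ioo a b, ENNReal.ofReal c ^ p * powerMass (γ * p - (1 + s * p)) (b - a) := by
          refine setLIntegral_mono' measurableSet_Ioo fun t ht => ?_
          refine (setLIntegral_mono' measurableSet_Ioo fun ξ hξ => hk t ht ξ hξ).trans ?_
          rw [lintegral_const_mul _ (by fun_prop)]
          gcongr
          exact lintegral_abs_sub_rpow_le t (by linarith [ht.2]) (by linarith [ht.1])
      _ = _ := by rw [setLIntegral_const, Real.volume_Ioo, mul_assoc]
  refine (ENNReal.rpow_le_rpow h2 (by positivity)).trans (le_of_eq ?_)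
  rw [ENNReal.mul_rpow_of_nonneg _ _ (by positivity), ← ENNReal.rpow_mul,
    mul_one_div_cancel hp.ne', ENNReal.rpow_one]

/-- The first time at which a continuous function reaches a level from below. -/
theorem exists_first_hit {f : ℝ → ℝ} {b l : ℝ} (hb : 0 ≤ b) (hf : ContinuousOn f (Icc 0 b))
    (h0 : f 0 < l) (h1 : l ≤ f b) :
    ∃ τ ∈ Ioc 0 b, f τ = l ∧ ∀ r ∈ Ico 0 τ, f r < l := by
  set Z : Set ℝ := {r ∈ Icc 0 b | f r = l} with hZ
  have hne : Z.Nonempty := by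
    obtain ⟨r, hr, hr'⟩ := intermediate_value_Icc hb hf ⟨h0.le, h1⟩
    exact ⟨r, hr, hr'⟩
  have hcl : IsClosed Z := hf.preimage_isClosed_of_isClosed isClosed_Icc (isClosed_singleton (x := l))
  have hbd : BddBelow Z := ⟨0, fun r hr => hr.1.1⟩
  have hmem := hcl.csInf_mem hne hbd
  refine ⟨sInf Z, ⟨lt_of_le_of_ne hmem.1.1 fun h => ?_, hmem.1.2⟩, hmem.2, fun r hr => ?_⟩
  · rw [← h] at hmem; exact h0.ne hmem.2
  · by_contra hcon
    have hsub : Icc 0 r ⊆ Icc 0 b := Icc_subset_Icc_right (hr.2.le.trans hmem.1.2)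
    obtain ⟨x, hx, hx'⟩ := intermediate_value_Icc hr.1 (hf.mono hsub) ⟨h0.le, not_lt.1 hcon⟩
    have := csInf_le hbd (⟨hsub hx, hx'⟩ : x ∈ Z)
    linarith [hx.2, hr.2]

namespace Setting

variable {N : ℕ} [NeZero N] {S : Setting N}

/-- `W` is Lipschitz on `[-2T, 2T]` with constant `K`. -/
def IsLip (S : Setting N) (K : ℝ) (W : ℝ → Vec N) : Prop :=
  ∀ t ∈ Icc (-2 * S.T) (2 * S.T), ∀ r ∈ Icc (-2 * S.T) (2 * S.T), ‖W t - W r‖ ≤ K * |t - r|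

theorem IsLip.continuousOn {K : ℝ} {W : ℝ → Vec N} (hW : S.IsLip K W) :
    ContinuousOn W (Icc (-2 * S.T) (2 * S.T)) := by
  refine (LipschitzOnWith.of_dist_le_mul (K := K.toNNReal) fun t ht r hr => ?_).continuousOn
  rw [dist_eq_norm, Real.dist_eq]
  refine (hW t ht r hr).trans ?_
  gcongr
  exact Real.le_coe_toNNReal K

theorem IsLip.aestronglyMeasurable {K : ℝ} {W : ℝ → Vec N} (hW : S.IsLip K W) {t : ℝ}
    (ht : t ∈ Icc 0 (2 * S.T)) : AEStronglyMeasurable (S.stateAt W t).1 (vol (-2 * S.T) 0) := by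
  have hT := S.T_pos
  refine ContinuousOn.aestronglyMeasurable ?_ measurableSet_Ioo
  exact hW.continuousOn.comp (by fun_prop) fun θ hθ =>
    ⟨by linarith [hθ.1, ht.1], by linarith [hθ.2, ht.2]⟩

theorem IsLip.mem_phase {K : ℝ} {W : ℝ → Vec N} (hW : S.IsLip K W) {t : ℝ}
    (ht : t ∈ Icc 0 (2 * S.T)) : S.stateAt W t ∈ S.phase := by
  have hT := S.T_pos
  have hp := S.p_pos
  have hσT := S.neg_two_T_le
  have hL : ∀ a ≤ 0, -2 * S.T ≤ a → MemLp (S.stateAt W t).1 (ENNReal.ofReal S.p) (vol a 0) := by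
    intro a ha0 ha
    refine memLp_of_continuousOn_Icc (hW.continuousOn.comp (by fun_prop) fun θ hθ =>
      ⟨by linarith [hθ.1, ht.1], by linarith [hθ.2, ht.2]⟩)
  have hσ0 : -S.T - S.σ ≤ 0 := by linarith [S.σ_pos]
  refine ⟨hL _ (by linarith) le_rfl, ENNReal.add_lt_top.2 ⟨(hL _ hσ0 hσT).2, ?_⟩⟩
  refine (slobSeminorm_le_of_holder (c := K) (γ := 1) hp fun θ hθ ξ hξ => ?_).trans_lt ?_
  · rw [Real.rpow_one]
    have := hW (t + θ) ⟨by linarith [hθ.1, ht.1], by linarith [hθ.2, ht.2]⟩ (t + ξ)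
      ⟨by linarith [hξ.1, ht.1], by linarith [hξ.2, ht.2]⟩
    rwa [add_sub_add_left_eq_sub] at this
  · refine ENNReal.mul_lt_top ENNReal.ofReal_lt_top (ENNReal.rpow_lt_top_of_nonneg (by positivity)
      (ENNReal.mul_lt_top (powerMass_lt_top ?_ (by linarith)) ENNReal.ofReal_lt_top).ne)
    nlinarith [S.s_lt]

/-- The states of a Lipschitz function depend continuously on time. The increments of
`W(t + ·) - W(t' + ·)` are bounded by a multiple of `|t - t'|` and by a multiple of the distance of
the arguments; interpolation between both gives a small Hölder norm of an exponent above `s`. -/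
theorem IsLip.exists_sdist_le {K : ℝ} {W : ℝ → Vec N} (hW : S.IsLip K W) {ε : ℝ≥0∞} (hε : 0 < ε) :
    ∃ η : ℝ, 0 < η ∧ ∀ t ∈ Icc 0 (2 * S.T), ∀ t' ∈ Icc 0 (2 * S.T), |t - t'| ≤ η →
      S.sdist (S.stateAt W t) (S.stateAt W t') ≤ ε := by
  have hT := S.T_pos
  have hp := S.p_pos
  have hσT := S.neg_two_T_le
  have hσ0 : -S.T - S.σ ≤ 0 := by linarith [S.σ_pos]
  have hK : 0 ≤ K := by
    have := (norm_nonneg _).trans (hW 0 ⟨by linarith, by linarith⟩ (2 * S.T) ⟨by linarith, le_rfl⟩)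
    rw [abs_of_neg (by linarith)] at this
    nlinarith
  -- any Hölder exponent strictly between `s` and `1` would do
  set γ : ℝ := (1 + S.s) / 2 with hγ
  have hγ0 : 0 < γ := by have := S.s_pos; positivity
  have hγ1 : γ < 1 := by linarith [S.s_lt]
  set A : ℝ → ℝ≥0∞ := fun a => vol a 0 univ ^ (ENNReal.ofReal S.p).toReal⁻¹ with hA
  have hAt : ∀ a, A a ≠ ⊤ := fun a =>
    ENNReal.rpow_ne_top_of_nonneg (by positivity) (measure_ne_top _ _)
  set D : ℝ≥0∞ := (powerMass (γ * S.p - (1 + S.s * S.p)) (0 - (-S.T - S.σ)) *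
    ENNReal.ofReal (0 - (-S.T - S.σ))) ^ (1 / S.p) with hD
  have hDt : D ≠ ⊤ := by
    refine ENNReal.rpow_ne_top_of_nonneg (by positivity)
      (ENNReal.mul_lt_top (powerMass_lt_top ?_ (by linarith)) ENNReal.ofReal_lt_top).ne
    nlinarith [S.s_lt]
  set μ : ℝ → ℝ≥0∞ := fun η => A (-2 * S.T) * ENNReal.ofReal (K * η) +
    (A (-S.T - S.σ) * ENNReal.ofReal (K * η) +
      ENNReal.ofReal (2 * K * η ^ (1 - γ)) * D) + ENNReal.ofReal (K * η) with hμ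
  have hμ0 : Tendsto μ (𝓝 0) (𝓝 0) := by
    have h1 : Tendsto (fun η : ℝ => ENNReal.ofReal (K * η)) (𝓝 0) (𝓝 0) := by
      have : Tendsto (fun η : ℝ => ENNReal.ofReal (K * η)) (𝓝 0) (𝓝 (ENNReal.ofReal (K * 0))) :=
        (ENNReal.continuous_ofReal.comp (continuous_const.mul continuous_id)).tendsto 0
      simpa using this
    have h2 : Tendsto (fun η : ℝ => ENNReal.ofReal (2 * K * η ^ (1 - γ))) (𝓝 0) (𝓝 0) := by
      have : Tendsto (fun η : ℝ => ENNReal.ofReal (2 * K * η ^ (1 - γ))) (𝓝 0)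
          (𝓝 (ENNReal.ofReal (2 * K * 0 ^ (1 - γ)))) :=
        (ENNReal.continuous_ofReal.comp (continuous_const.mul
          (Real.continuous_rpow_const (by linarith)))).tendsto 0
      rw [Real.zero_rpow (by linarith)] at this
      simpa using this
    have h3 : ∀ c : ℝ≥0∞, c ≠ ⊤ → Tendsto (fun η : ℝ => c * ENNReal.ofReal (K * η)) (𝓝 0) (𝓝 0) := by
      intro c hc
      simpa using ENNReal.Tendsto.const_mul h1 (Or.inr hc)
    have h4 : Tendsto (fun η : ℝ => ENNReal.ofReal (2 * K * η ^ (1 - γ)) * D) (𝓝 0) (𝓝 0) := by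
      simpa using ENNReal.Tendsto.mul_const h2 (Or.inr hDt)
    simpa using ((h3 _ (hAt _)).add ((h3 _ (hAt _)).add h4)).add h1
  have hev : ∀ᶠ η in 𝓝[>] (0 : ℝ), μ η ≤ ε :=
    (hμ0.mono_left nhdsWithin_le_nhds).eventually_le_const hε
  obtain ⟨η, hη1, hη0⟩ := (hev.and self_mem_nhdsWithin).exists
  refine ⟨η, hη0, fun t ht t' ht' htt => le_trans ?_ hη1⟩
  have hη0' : (0 : ℝ) < η := hη0
  have hI : ∀ {θ x : ℝ}, θ ∈ Ioo (-2 * S.T) 0 → x ∈ Icc 0 (2 * S.T) →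
      x + θ ∈ Icc (-2 * S.T) (2 * S.T) := fun hθ hx =>
    ⟨by linarith [hθ.1, hx.1], by linarith [hθ.2, hx.2]⟩
  have hb : ∀ θ ∈ Ioo (-2 * S.T) 0, ‖W (t + θ) - W (t' + θ)‖ ≤ K * η := fun θ hθ => by
    refine (hW _ (hI hθ ht) _ (hI hθ ht')).trans ?_
    rw [add_sub_add_right_eq_sub]; gcongr
  have hLp : ∀ a, -2 * S.T ≤ a → eLpNorm (fun θ => W (t + θ) - W (t' + θ)) (ENNReal.ofReal S.p)
      (vol a 0) ≤ A a * ENNReal.ofReal (K * η) := fun a ha =>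
    eLpNorm_le_of_ae_bound ((ae_restrict_iff' measurableSet_Ioo).2
      (ae_of_all _ fun θ hθ => hb θ ⟨ha.trans_lt hθ.1, hθ.2⟩))
  refine add_le_add (add_le_add (hLp _ le_rfl) (add_le_add (hLp _ hσT) ?_)) ?_
  · refine slobSeminorm_le_of_holder hp fun θ hθ ξ hξ => ?_
    have hθ' : θ ∈ Ioo (-2 * S.T) 0 := ⟨hσT.trans_lt hθ.1, hθ.2⟩
    have hξ' : ξ ∈ Ioo (-2 * S.T) 0 := ⟨hσT.trans_lt hξ.1, hξ.2⟩
    set X : ℝ := ‖W (t + θ) - W (t' + θ) - (W (t + ξ) - W (t' + ξ))‖ with hX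
    have hX0 : 0 ≤ X := norm_nonneg _
    have b1 : X ≤ 2 * K * η := by
      have := norm_sub_le (W (t + θ) - W (t' + θ)) (W (t + ξ) - W (t' + ξ))
      linarith [hb θ hθ', hb ξ hξ']
    have b2 : X ≤ 2 * K * |θ - ξ| := by
      have e : W (t + θ) - W (t' + θ) - (W (t + ξ) - W (t' + ξ)) =
        (W (t + θ) - W (t + ξ)) - (W (t' + θ) - W (t' + ξ)) := by abel
      have := norm_sub_le (W (t + θ) - W (t + ξ)) (W (t' + θ) - W (t' + ξ))
      rw [← e] at this
      have c1 := hW _ (hI hθ' ht) _ (hI hξ' ht)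
      have c2 := hW _ (hI hθ' ht') _ (hI hξ' ht')
      rw [add_sub_add_left_eq_sub] at c1 c2
      linarith
    calc X = X ^ (1 - γ) * X ^ γ := by
          rw [← Real.rpow_add_of_nonneg hX0 (by linarith) hγ0.le, sub_add_cancel, Real.rpow_one]
      _ ≤ (2 * K * η) ^ (1 - γ) * (2 * K * |θ - ξ|) ^ γ := by
          have e1 : 0 ≤ 1 - γ := by linarith
          gcongr
      _ = 2 * K * η ^ (1 - γ) * |θ - ξ| ^ γ := by
          rw [Real.mul_rpow (by positivity) hη0'.le, Real.mul_rpow (by positivity) (abs_nonneg _)]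
          have : (2 * K) ^ (1 - γ) * (2 * K) ^ γ = 2 * K := by
            rw [← Real.rpow_add_of_nonneg (by positivity) (by linarith) hγ0.le, sub_add_cancel,
              Real.rpow_one]
          calc _ = (2 * K) ^ (1 - γ) * (2 * K) ^ γ * (η ^ (1 - γ) * |θ - ξ| ^ γ) := by ring
            _ = _ := by rw [this]; ring
  · have hmem : ∀ {x : ℝ}, x ∈ Icc 0 (2 * S.T) → x ∈ Icc (-2 * S.T) (2 * S.T) := fun hx =>
      ⟨by linarith [hx.1], hx.2⟩
    rw [← ofReal_norm]
    refine ENNReal.ofReal_le_ofReal ((hW t (hmem ht) t' (hmem ht')).trans ?_)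
    gcongr

/-! ### Half-cycles -/

theorem IntegralSol.stateAt_aestronglyMeasurable {h : ℝ → ℝ} {q : S.State} {T₁ t : ℝ}
    {v : ℝ → Vec N} (H : S.IntegralSol h q T₁ v) (ht : t ∈ Icc 0 T₁) :
    AEStronglyMeasurable (S.stateAt v t).1 (vol (-2 * S.T) 0) :=
  (H.shift ht.1 ht.2).history.1

/-- A solution `W` with constant input that reaches a level transversally at time `T` attracts the
nearby solutions: a solution that starts below the level and close to a state of `W` first reaches
the level at nearly the same time, and follows `W` until then. -/
theorem exists_half_cycle {c K l : ℝ} {W : ℝ → Vec N} (hW : S.IsLip K W)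
    (hsol : S.IntegralSol (fun _ => c) (S.stateAt W 0) (4 * S.T) W) (L : Vec N →L[ℝ] ℝ)
    (hlt : ∀ t ∈ Ico 0 S.T, L (W t) < l)
    (hcross : ∀ η > 0, ∃ t ∈ Ioo S.T (S.T + η), l < L (W t)) {ε : ℝ} (hε : 0 < ε) :
    ∃ δ : ℝ≥0∞, 0 < δ ∧ ∀ t ∈ Icc 0 S.T, ∀ q ∈ S.phase, S.sdist q (S.stateAt W t) < δ → L q.2 < l →
      ∀ v, S.IsFrozenSolution c q v → ∃ τ, 0 < τ ∧ |τ - (S.T - t)| ≤ ε ∧ L (v τ) = l ∧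
        (∀ r ∈ Ico 0 τ, L (v r) < l) ∧
        (∀ r ∈ Icc 0 τ, S.stateAt v r ∈ S.phase ∧
          S.sdist (S.stateAt v r) (S.stateAt W (min (t + r) S.T)) ≤ ENNReal.ofReal ε) ∧
        S.sdist (S.stateAt v τ) (S.stateAt W S.T) ≤ ENNReal.ofReal ε := by
  have hT := S.T_pos
  obtain ⟨C, hC, HC⟩ := exists_sdist_stateAt_le S
  obtain ⟨η₀, hη₀, Hη⟩ := hW.exists_sdist_le (ENNReal.ofReal_pos.2 (half_pos hε))
  obtain ⟨η, hη, hηε, hηη, hηT⟩ : ∃ η : ℝ, 0 < η ∧ η ≤ ε ∧ η ≤ η₀ ∧ η ≤ S.T / 2 :=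
    ⟨min ε (min η₀ (S.T / 2)), by positivity, min_le_left _ _,
      (min_le_right _ _).trans (min_le_left _ _), (min_le_right _ _).trans (min_le_right _ _)⟩
  -- just after `T`, at `t₁`, `W` is above the level; before `T - η` it is below by a gap `g`
  obtain ⟨t₁, ht₁, hlt₁⟩ := hcross η hη
  have hWc : ContinuousOn (fun t => L (W t)) (Icc 0 (S.T - η)) :=
    L.continuous.comp_continuousOn (hW.continuousOn.mono
      (Icc_subset_Icc (by linarith) (by linarith)))
  obtain ⟨g, hg, hgW⟩ : ∃ g > 0, ∀ t ∈ Icc 0 (S.T - η), L (W t) ≤ l - g := by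
    obtain ⟨x, hx, hmax⟩ := isCompact_Icc.exists_isMaxOn
      (nonempty_Icc.2 (by linarith : (0 : ℝ) ≤ S.T - η)) hWc
    refine ⟨l - L (W x), sub_pos.2 (hlt x ⟨hx.1, by linarith [hx.2]⟩), fun t ht => ?_⟩
    have : L (W t) ≤ L (W x) := hmax ht
    linarith
  -- solutions within `κ` of `W` are above the level at `t₁` and below it before `T - η`
  set κ : ℝ := min (ε / 2) (min ((L (W t₁) - l) / (‖L‖ + 1)) (g / (‖L‖ + 1))) with hκ
  have hL1 : 0 < ‖L‖ + 1 := by positivity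
  have hκ0 : 0 < κ := lt_min (by positivity) (lt_min (div_pos (sub_pos.2 hlt₁) hL1) (by positivity))
  have hκ1 : κ ≤ ε / 2 := min_le_left _ _
  have hκ2 : κ * (‖L‖ + 1) ≤ L (W t₁) - l :=
    (le_div_iff₀ hL1).1 ((min_le_right _ _).trans (min_le_left _ _))
  have hκ3 : κ * (‖L‖ + 1) ≤ g :=
    (le_div_iff₀ hL1).1 ((min_le_right _ _).trans (min_le_right _ _))
  have hC1 : C + 1 ≠ ⊤ := ENNReal.add_ne_top.2 ⟨hC.ne, by simp⟩
  refine ⟨ENNReal.ofReal κ / (C + 1), ENNReal.div_pos (ENNReal.ofReal_pos.2 hκ0).ne' hC1, ?_⟩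
  intro t ht q hq hqt hlq v hv
  have hvI : S.IntegralSol (fun _ => c) q (2 * S.T) v :=
    (solvesOn_iff (by linarith)).1 (hv _ (by linarith))
  have hWI : S.IntegralSol (fun _ => c) (S.stateAt W t) (2 * S.T) (fun r => W (t + r)) :=
    (hsol.shift ht.1 (by linarith [ht.2])).mono (by linarith [ht.2])
  have hclose : ∀ r ∈ Icc 0 (2 * S.T),
      S.sdist (S.stateAt v r) (S.stateAt W (t + r)) ≤ ENNReal.ofReal κ := by
    intro r hr
    have h1 := HC _ _ _ _ _ _ hvI hWI (ae_of_all _ fun _ => rfl) r hr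
    have e : S.stateAt (fun r => W (t + r)) r = S.stateAt W (t + r) := by
      simp only [stateAt, add_assoc]
    rw [e] at h1
    refine h1.trans ?_
    rw [ENNReal.lt_div_iff_mul_lt (Or.inl (by simp)) (Or.inl hC1)] at hqt
    refine le_trans ?_ hqt.le
    rw [mul_comm]
    gcongr
    exact le_self_add
  have hLclose : ∀ r ∈ Icc 0 (2 * S.T), |L (v r) - L (W (t + r))| < κ * (‖L‖ + 1) := by
    intro r hr
    have h1 : ‖v r - W (t + r)‖ₑ ≤ ENNReal.ofReal κ := le_trans le_add_self (hclose r hr)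
    rw [← ofReal_norm, ENNReal.ofReal_le_ofReal_iff hκ0.le] at h1
    rw [← map_sub, ← Real.norm_eq_abs]
    have := L.le_opNorm (v r - W (t + r))
    nlinarith [norm_nonneg L]
  have hLv : ContinuousOn (fun r => L (v r)) (Icc 0 (2 * S.T)) :=
    L.continuous.comp_continuousOn hvI.continuousOn
  have ht₁' : t₁ - t ∈ Icc 0 (2 * S.T) := ⟨by linarith [ht₁.1, ht.2], by linarith [ht₁.2, ht.1]⟩
  have hv1 : l ≤ L (v (t₁ - t)) := by
    have := hLclose _ ht₁'
    rw [add_sub_cancel] at this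
    have := (abs_lt.1 this).1
    linarith
  have hv0 : L (v 0) < l := by rwa [hvI.value_zero (by linarith)]
  obtain ⟨τ, hτ, hτl, hτlt⟩ := exists_first_hit ht₁'.1
    (hLv.mono (Icc_subset_Icc_right ht₁'.2)) hv0 hv1
  have hτ2 : τ ∈ Icc 0 (2 * S.T) := ⟨hτ.1.le, hτ.2.trans ht₁'.2⟩
  have hup : t + τ < S.T + η := by linarith [hτ.2, ht₁.2]
  have hlow : S.T - η < t + τ := by
    by_contra hcon
    have h1 := hgW (t + τ) ⟨by linarith [ht.1, hτ.1], not_lt.1 hcon⟩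
    have h2 := (abs_lt.1 (hLclose τ hτ2)).2
    linarith
  have hmeas : ∀ r ∈ Icc 0 τ, AEStronglyMeasurable (S.stateAt v r).1 (vol (-2 * S.T) 0) :=
    fun r hr => hvI.stateAt_aestronglyMeasurable ⟨hr.1, hr.2.trans hτ2.2⟩
  have hfollow : ∀ r ∈ Icc 0 τ, ∀ x ∈ Icc 0 S.T, |t + r - x| ≤ η →
      S.sdist (S.stateAt v r) (S.stateAt W x) ≤ ENNReal.ofReal ε := by
    intro r hr x hx hrx
    have hr2 : t + r ∈ Icc 0 (2 * S.T) := ⟨by linarith [ht.1, hr.1], by linarith [hr.2]⟩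
    have hx2 : x ∈ Icc 0 (2 * S.T) := ⟨hx.1, by linarith [hx.2]⟩
    refine (sdist_triangle (hmeas r hr) (hW.aestronglyMeasurable hr2)
      (hW.aestronglyMeasurable hx2)).trans ?_
    rw [← add_halves ε, ENNReal.ofReal_add (by positivity) (by positivity)]
    exact add_le_add ((hclose r ⟨hr.1, hr.2.trans hτ2.2⟩).trans (ENNReal.ofReal_le_ofReal hκ1))
      (Hη _ hr2 _ hx2 (hrx.trans hηη))
  have hmin : ∀ r ∈ Icc 0 τ, S.sdist (S.stateAt v r) (S.stateAt W (min (t + r) S.T)) ≤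
      ENNReal.ofReal ε := by
    intro r hr
    refine hfollow r hr _ ⟨le_min (by linarith [ht.1, hr.1]) hT.le, min_le_right _ _⟩ ?_
    rcases le_total (t + r) S.T with h | h
    · rw [min_eq_left h]; simpa using hη.le
    · rw [min_eq_right h, abs_of_nonneg (by linarith)]; linarith [hr.2]
  refine ⟨τ, hτ.1, ?_, hτl, hτlt, fun r hr => ⟨?_, hmin r hr⟩, ?_⟩
  · rw [abs_le]; constructor <;> linarith
  · exact mem_phase_of_sdist_lt_top (hW.mem_phase ⟨le_min (by linarith [ht.1, hr.1]) hT.le,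
      (min_le_right _ _).trans (by linarith)⟩) (hmeas r hr)
      ((hmin r hr).trans_lt ENNReal.ofReal_lt_top)
  · refine hfollow τ ⟨hτ.1.le, le_rfl⟩ S.T ⟨hT.le, le_rfl⟩ ?_
    rw [abs_le]; constructor <;> linarith

end Setting

/-! ### The relay -/

section Relay

variable {α β : ℝ} {g g' : ℝ → ℝ} {t τ : ℝ}

theorem thresholdTimes_congr (h : ∀ r ∈ Ioc 0 t, g r = g' r) :
    thresholdTimes α β g t = thresholdTimes α β g' t := by
  ext r
  simp only [thresholdTimes, mem_ofPred_eq]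
  exact and_congr_right fun hr => by rw [h r hr]

theorem sSup_thresholdTimes_mem (hg : ContinuousOn g (Icc 0 t))
    (hne : (thresholdTimes α β g t).Nonempty) :
    sSup (thresholdTimes α β g t) ∈ thresholdTimes α β g t := by
  obtain ⟨x, hx⟩ := hne
  have hbd : BddAbove (thresholdTimes α β g t) := ⟨t, fun r hr => hr.1.2⟩
  have hxs := le_csSup hbd hx
  have hZ : IsClosed (Icc x t ∩ g ⁻¹' {α, β}) :=
    (hg.mono (Icc_subset_Icc_left hx.1.1.le)).preimage_isClosed_of_isClosed isClosed_Icc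
      (Set.toFinite _).isClosed
  have e : sSup (thresholdTimes α β g t) = sSup (Icc x t ∩ g ⁻¹' {α, β}) := by
    refine le_antisymm (csSup_le ⟨x, hx⟩ fun r hr => ?_) (csSup_le_csSup hbd
      ⟨x, ⟨le_rfl, hx.1.2⟩, hx.2⟩ fun r hr => ⟨⟨hx.1.1.trans_le hr.1.1, hr.1.2⟩, hr.2⟩)
    rcases le_total x r with h | h
    · exact le_csSup ⟨t, fun r hr => hr.1.2⟩ ⟨⟨h, hr.1.2⟩, hr.2⟩
    · exact h.trans (le_csSup ⟨t, fun r hr => hr.1.2⟩ ⟨⟨le_rfl, hx.1.2⟩, hx.2⟩)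
  have h2 := hZ.csSup_mem ⟨x, ⟨le_rfl, hx.1.2⟩, hx.2⟩ ⟨t, fun r hr => hr.1.2⟩
  rw [← e] at h2
  exact ⟨⟨hx.1.1.trans_le h2.1.1, h2.1.2⟩, h2.2⟩

/-- The relay is causal. -/
theorem relay_congr (ht : 0 ≤ t) (hg : ContinuousOn g (Icc 0 t)) (h : ∀ r ∈ Icc 0 t, g r = g' r) :
    relay α β g t = relay α β g' t := by
  have e := thresholdTimes_congr (α := α) (β := β) fun r hr => h r (Ioc_subset_Icc_self hr)
  rw [relay, relay, ← e, h 0 ⟨le_rfl, ht⟩]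
  split_ifs with h1 h2 h3 h3 <;> first | rfl | skip
  all_goals
    have := (sSup_thresholdTimes_mem hg (nonempty_iff_ne_empty.2 h1)).1
    rw [h _ (Ioc_subset_Icc_self this)] at *
    contradiction

theorem abs_relay : |relay α β g t| = 1 := by
  rw [relay]; split_ifs <;> simp

theorem relay_zero : relay α β g 0 = if g 0 < β then 1 else -1 := by
  have : thresholdTimes α β g 0 = ∅ := by
    ext r; simp only [thresholdTimes, mem_ofPred_eq, mem_empty_iff_false, iff_false]
    rintro ⟨h, -⟩; linarith [h.1, h.2]
  rw [relay, if_pos this]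

theorem relay_eq_one_of_lt (ht : 0 ≤ t) (hg : ContinuousOn g (Icc 0 t))
    (h : ∀ r ∈ Icc 0 t, g r < β) : relay α β g t = 1 := by
  rw [relay, if_pos (h 0 ⟨le_rfl, ht⟩)]
  split_ifs with h1 h2
  · rfl
  · rfl
  · have := sSup_thresholdTimes_mem hg (nonempty_iff_ne_empty.2 h1)
    exact absurd (this.2.resolve_left h2) (h _ (Ioc_subset_Icc_self this.1)).ne

theorem relay_eq_neg_one_of_gt (hg : ContinuousOn g (Icc 0 t)) (h0 : β ≤ g 0)
    (h : ∀ r ∈ Icc 0 t, α < g r) : relay α β g t = -1 := by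
  rw [relay, if_neg (not_lt.2 h0)]
  split_ifs with h1 h2
  · rfl
  · have := sSup_thresholdTimes_mem hg (nonempty_iff_ne_empty.2 h1)
    exact absurd h2 (h _ (Ioc_subset_Icc_self this.1)).ne'
  · rfl

/-- At a threshold, the relay has the value that it would have as an initial value. -/
theorem relay_of_threshold (hαβ : α < β) (ht : 0 < t) (h : g t = α ∨ g t = β) :
    relay α β g t = if g t < β then 1 else -1 := by
  have h1 : IsGreatest (thresholdTimes α β g t) t := ⟨⟨⟨ht, le_rfl⟩, h⟩, fun r hr => hr.1.2⟩
  rw [relay, if_neg h1.nonempty.ne_empty, h1.csSup_eq]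
  rcases h with h | h
  · rw [h, if_pos rfl, if_pos hαβ]
  · rw [h, if_neg hαβ.ne', if_neg (lt_irrefl _)]

/-- The relay has the semigroup property at every time at which its state can be read off from
the value of the input. -/
theorem relay_add (hτ0 : 0 ≤ τ) (hτ : relay α β g τ = if g τ < β then 1 else -1) (ht : 0 ≤ t) :
    relay α β g (τ + t) = relay α β (fun r => g (τ + r)) t := by
  by_cases hne : thresholdTimes α β (fun r => g (τ + r)) t = ∅
  · have e : thresholdTimes α β g (τ + t) = thresholdTimes α β g τ := by
      ext r
      constructor
      · rintro ⟨h1, h2⟩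
        refine ⟨⟨h1.1, ?_⟩, h2⟩
        by_contra hcon
        have : r - τ ∈ thresholdTimes α β (fun r => g (τ + r)) t :=
          ⟨⟨by linarith, by linarith [h1.2]⟩, by simpa using h2⟩
        rw [hne] at this
        exact this
      · rintro ⟨h1, h2⟩
        exact ⟨⟨h1.1, by linarith [h1.2]⟩, h2⟩
    rw [relay.eq_1 α β (fun r => g (τ + r)), if_pos hne, add_zero, ← hτ, relay, e, ← relay]
  · obtain ⟨x, hx⟩ := nonempty_iff_ne_empty.2 hne
    have hx' : τ + x ∈ thresholdTimes α β g (τ + t) :=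
      ⟨⟨by linarith [hx.1.1], by linarith [hx.1.2]⟩, hx.2⟩
    have hbd : BddAbove (thresholdTimes α β (fun r => g (τ + r)) t) := ⟨t, fun r hr => hr.1.2⟩
    have hbd' : BddAbove (thresholdTimes α β g (τ + t)) := ⟨τ + t, fun r hr => hr.1.2⟩
    have e : sSup (thresholdTimes α β g (τ + t)) =
        τ + sSup (thresholdTimes α β (fun r => g (τ + r)) t) := by
      refine le_antisymm (csSup_le ⟨_, hx'⟩ fun r hr => ?_) ?_
      · rcases le_or_gt r τ with h | h
        · linarith [le_csSup hbd hx, hx.1.1]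
        · have : r - τ ∈ thresholdTimes α β (fun r => g (τ + r)) t :=
            ⟨⟨by linarith, by linarith [hr.1.2]⟩, by simpa using hr.2⟩
          linarith [le_csSup hbd this]
      · have : sSup (thresholdTimes α β (fun r => g (τ + r)) t) ≤
            sSup (thresholdTimes α β g (τ + t)) - τ := csSup_le ⟨x, hx⟩ fun r hr => by
          have : τ + r ∈ thresholdTimes α β g (τ + t) :=
            ⟨⟨by linarith [hr.1.1], by linarith [hr.1.2]⟩, hr.2⟩
          linarith [le_csSup hbd' this]
        linarith
    rw [relay, relay, if_neg hne, if_neg (nonempty_iff_ne_empty.1 ⟨_, hx'⟩), e]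

/-- The relay is right-continuous. -/
theorem relay_eq_right (hαβ : α < β) (ht : 0 ≤ t) {b : ℝ} (hb : t < b)
    (hg : ContinuousOn g (Icc 0 b)) :
    ∃ η > 0, t + η ≤ b ∧ ∀ r ∈ Icc t (t + η), relay α β g r = relay α β g t := by
  have hgt : ContinuousWithinAt g (Icc t b) t :=
    (hg t ⟨ht, hb.le⟩).mono (Icc_subset_Icc_left ht)
  have key : ∀ U ∈ 𝓝 (g t), ∃ η > 0, t + η ≤ b ∧ ∀ r ∈ Icc t (t + η), g r ∈ U := by
    intro U hU
    have h1 : g ⁻¹' U ∈ 𝓝[Icc t b] t := hgt hU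
    have h2 : g ⁻¹' U ∈ 𝓝[≥] t := by rwa [nhdsWithin_Icc_eq_nhdsGE hb] at h1
    obtain ⟨x, hx, hxs⟩ := (mem_nhdsGE_iff_exists_Icc_subset (a := t)).1 h2
    refine ⟨min (x - t) (b - t), lt_min (sub_pos.2 hx) (sub_pos.2 hb), ?_, fun r hr => hxs ⟨hr.1, ?_⟩⟩
    · linarith [min_le_right (x - t) (b - t)]
    · linarith [min_le_left (x - t) (b - t), hr.2]
  by_cases h : g t = α ∨ g t = β
  · have hτ : relay α β g t = if g t < β then 1 else -1 := by
      rcases ht.eq_or_lt with rfl | h0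
      · exact relay_zero
      · exact relay_of_threshold hαβ h0 h
    have hshift : ∀ η, t + η ≤ b → ∀ r ∈ Icc t (t + η),
        ContinuousOn (fun x => g (t + x)) (Icc 0 (r - t)) := fun η hη r hr =>
      hg.comp (by fun_prop) fun x hx => ⟨by linarith [hx.1], by linarith [hx.2, hr.2]⟩
    rcases h with h | h
    · obtain ⟨η, hη, hηb, H⟩ := key (Iio β) (Iio_mem_nhds (by rwa [h]))
      refine ⟨η, hη, hηb, fun r hr => ?_⟩
      rw [hτ, if_pos (by rwa [h]), ← add_sub_cancel t r, relay_add ht hτ (by linarith [hr.1])]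
      exact relay_eq_one_of_lt (by linarith [hr.1]) (hshift η hηb r hr) fun x hx =>
        H _ ⟨by linarith [hx.1], by linarith [hx.2, hr.2]⟩
    · obtain ⟨η, hη, hηb, H⟩ := key (Ioi α) (Ioi_mem_nhds (by rwa [h]))
      refine ⟨η, hη, hηb, fun r hr => ?_⟩
      rw [hτ, if_neg (by rw [h]; exact lt_irrefl _), ← add_sub_cancel t r,
        relay_add ht hτ (by linarith [hr.1])]
      exact relay_eq_neg_one_of_gt (hshift η hηb r hr) (by simp [h])
        fun x hx => H _ ⟨by linarith [hx.1], by linarith [hx.2, hr.2]⟩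
  · obtain ⟨η, hη, hηb, H⟩ := key {α, β}ᶜ ((Set.toFinite _).isClosed.isOpen_compl.mem_nhds h)
    refine ⟨η, hη, hηb, fun r hr => ?_⟩
    have e : thresholdTimes α β g r = thresholdTimes α β g t := by
      ext x
      constructor
      · rintro ⟨h1, h2⟩
        refine ⟨⟨h1.1, ?_⟩, h2⟩
        by_contra hcon
        exact H x ⟨(not_le.1 hcon).le, by linarith [h1.2, hr.2]⟩ h2
      · rintro ⟨h1, h2⟩
        exact ⟨⟨h1.1, h1.2.trans hr.1⟩, h2⟩
    rw [relay, e, ← relay]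

end Relay

namespace Setting

variable {N : ℕ} [NeZero N] {S : Setting N}

/-- The functional `M` as a continuous linear map. -/
def Mop (S : Setting N) : Vec N →L[ℝ] ℝ := ∑ i, S.m i • EuclideanSpace.proj i

theorem Mop_apply (x : Vec N) : S.Mop x = S.M x := by
  simp [Mop, M]

theorem continuous_M : Continuous S.M := by
  have : S.M = S.Mop := funext fun x => Mop_apply x |>.symm
  rw [this]; exact S.Mop.continuous

/-! ### Solutions of the problem with hysteresis and with constant input -/

section Solutions

variable {h : ℝ → ℝ} {c t τ T₁ : ℝ} {q q' : S.State} {u v w : ℝ → Vec N}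

theorem IntegralSol.continuousOn_M (H : S.IntegralSol h q T₁ v) :
    ContinuousOn (fun t => S.M (v t)) (Icc 0 T₁) := continuous_M.comp_continuousOn H.continuousOn

theorem IsFrozenSolution.integralSol (H : S.IsFrozenSolution c q v) (T₁ : ℝ) :
    S.IntegralSol (fun _ => c) q T₁ v :=
  ((solvesOn_iff (by positivity)).1 (H (max T₁ 1) (by positivity))).mono (le_max_left _ _)

theorem IsSolution.integralSol (H : S.IsSolution q v) (T₁ : ℝ) :
    S.IntegralSol (S.hyst v) q T₁ v :=
  ((solvesOn_iff (by positivity)).1 (H (max T₁ 1) (by positivity))).mono (le_max_left _ _)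

theorem stateEq_stateAt (ht : 0 ≤ t) (h : ∀ᵐ r ∂vol (-2 * S.T) 0, v r = w r)
    (h' : ∀ r ∈ Icc 0 t, v r = w r) : S.StateEq (S.stateAt v t) (S.stateAt w t) := by
  refine ⟨?_, h' t ⟨ht, le_rfl⟩⟩
  have h1 : ∀ᵐ r ∂vol (-2 * S.T) t, v r = w r :=
    ae_vol_union (by linarith [S.T_pos]) ht h ((ae_restrict_iff' measurableSet_Ioo).2
      (ae_of_all _ fun x hx => h' x (Ioo_subset_Icc_self hx)))
  refine ae_vol_mono (a := -2 * S.T - t) (b := t - t) (by linarith) (by linarith)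
    ((ae_vol_add (s := t) h1).mono fun r hr => ?_)
  simpa [stateAt, add_comm] using hr

theorem IntegralSol.stateEq_zero (H : S.IntegralSol h q T₁ v) (hT : 0 ≤ T₁) :
    S.StateEq (S.stateAt v 0) q := by
  refine ⟨?_, H.value_zero hT⟩
  simpa [stateAt] using H.initial

/-- Whether a function is a solution depends on the history only up to equality almost
everywhere. -/
theorem StateEq.isFrozenSolution (h : S.StateEq q q') (H : S.IsFrozenSolution c q v) :
    S.IsFrozenSolution c q' v := fun T₁ hT₁ =>
  { H T₁ hT₁ with
    initial := by filter_upwards [(H T₁ hT₁).initial, h.1] with t a b using a.trans b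
    initial_zero := (H T₁ hT₁).initial_zero.trans h.2 }

theorem isFrozenSolution_frozen (hq : q ∈ S.phase) (c : ℝ) :
    S.IsFrozenSolution c q (S.frozen c q) :=
  Classical.epsilon_spec (exists_isFrozenSolution c q hq.1)

/-- The first hit is determined by the values up to that time. -/
theorem firstHit_eq {l : ℝ} (hτ : 0 < τ) (h1 : S.M (v τ) = l) (h2 : ∀ t ∈ Ico 0 τ, S.M (v t) ≠ l) :
    S.firstHit v l = ENNReal.ofReal τ := by
  refine le_antisymm (iInf₂_le τ ⟨hτ, h1, h2⟩) (le_iInf₂ fun τ' h' => ENNReal.ofReal_le_ofReal ?_)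
  by_contra hcon
  exact h2 τ' ⟨h'.1.le, not_le.1 hcon⟩ h'.2.1

/-- The restriction of a solution to `[τ, ∞)` is a solution if the state of the relay at `τ` can be
read off from the value. -/
theorem IsSolution.shift (H : S.IsSolution q v) (hτ : 0 ≤ τ)
    (hr : S.hyst v τ = if S.M (v τ) < S.β then 1 else -1) :
    S.IsSolution (S.stateAt v τ) (fun t => v (τ + t)) := fun T₁ hT₁ =>
  (solvesOn_iff hT₁).2 <| by
    have h1 := (H.integralSol (τ + T₁)).shift hτ (by linarith)
    rw [add_sub_cancel_left] at h1
    exact h1.congr hT₁.le ((ae_restrict_iff' measurableSet_Ioo).2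
      (ae_of_all _ fun x hx => (relay_add hτ hr hx.1.le).symm)) (ae_of_all _ fun _ => rfl)
      fun _ _ => rfl

/-- As long as the relay keeps the value `c` below the level `l` of `L`, the solution follows the
solution with the constant input `c` up to the time at which the latter reaches the level. -/
theorem IsSolution.eq_of_first_hit (H : S.IsSolution q v) (Hw : S.IsFrozenSolution c q w)
    (hτ : 0 < τ) (L : Vec N →L[ℝ] ℝ) {l : ℝ} (h2 : ∀ r ∈ Ico 0 τ, L (w r) < l)
    (hc : ∀ x ≤ τ, (∀ r ∈ Ico 0 x, L (v r) < l) → ∀ r ∈ Ico 0 x, S.hyst v r = c) :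
    ∀ r ∈ Icc 0 τ, v r = w r := by
  have key : ∀ x ≤ τ, (∀ r ∈ Ico 0 x, L (v r) < l) → ∀ r ∈ Icc 0 x, v r = w r := fun x hx hlt =>
    (H.integralSol x).unique (Hw.integralSol x) ((ae_restrict_iff' measurableSet_Ioo).2
      (ae_of_all _ fun r hr => hc x hx hlt r ⟨hr.1.le, hr.2⟩)) (ae_of_all _ fun _ => rfl) rfl
  -- `v` cannot reach the level before `τ`, since up to that time it agrees with `w`
  have hv0 : L (v 0) < l := by
    rw [(H.integralSol 0).value_zero le_rfl, ← (Hw.integralSol 0).value_zero le_rfl]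
    exact h2 0 ⟨le_rfl, hτ⟩
  by_cases hex : ∃ x ∈ Icc 0 τ, l ≤ L (v x)
  · obtain ⟨x, hx, hxl⟩ := hex
    obtain ⟨x', hx', e, hlt⟩ := exists_first_hit (f := fun r => L (v r)) hx.1
      (L.continuous.comp_continuousOn (H.integralSol x).continuousOn) hv0 hxl
    have hle : x' ≤ τ := hx'.2.trans hx.2
    have h3 := key x' hle hlt
    have h4 : x' = τ := by
      by_contra hne
      have := h2 x' ⟨hx'.1.le, lt_of_le_of_ne hle hne⟩
      rw [← h3 x' ⟨hx'.1.le, le_rfl⟩, e] at this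
      exact lt_irrefl _ this
    rwa [h4] at h3
  · push Not at hex
    exact key τ le_rfl fun r hr => hex r ⟨hr.1, hr.2.le⟩

/-- A solution starting below `β` follows the solution with input `1` up to the threshold `β`, and
restarts there. -/
theorem IsSolution.eq_of_first_hit_β (H : S.IsSolution q v) (Hw : S.IsFrozenSolution 1 q w)
    (hτ : 0 < τ) (h1 : S.M (w τ) = S.β) (h2 : ∀ r ∈ Ico 0 τ, S.M (w r) < S.β) :
    (∀ r ∈ Icc 0 τ, v r = w r) ∧ S.IsSolution (S.stateAt v τ) (fun t => v (τ + t)) := by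
  have e : ∀ r ∈ Icc 0 τ, v r = w r := H.eq_of_first_hit Hw hτ S.Mop (l := S.β) (by simpa only [Mop_apply] using h2) fun x hx hlt r hr =>
      relay_eq_one_of_lt hr.1 (H.integralSol r).continuousOn_M fun y hy => by
        simpa only [Mop_apply] using hlt y ⟨hy.1, hy.2.trans_lt hr.2⟩
  have := e τ ⟨hτ.le, le_rfl⟩
  exact ⟨e, H.shift hτ.le (relay_of_threshold S.α_lt_β hτ (Or.inr (by simp only [this, h1])))⟩

/-- A solution starting at or above `β` follows the solution with input `-1` up to the threshold
`α`, and restarts there. -/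
theorem IsSolution.eq_of_first_hit_α (H : S.IsSolution q v) (Hw : S.IsFrozenSolution (-1) q w)
    (hq : S.β ≤ S.M q.2)
    (hτ : 0 < τ) (h1 : S.M (w τ) = S.α) (h2 : ∀ r ∈ Ico 0 τ, S.α < S.M (w r)) :
    (∀ r ∈ Icc 0 τ, v r = w r) ∧ S.IsSolution (S.stateAt v τ) (fun t => v (τ + t)) := by
  have e : ∀ r ∈ Icc 0 τ, v r = w r := H.eq_of_first_hit Hw hτ (-S.Mop) (l := -S.α)
    (by simpa [Mop_apply] using h2) fun x hx hlt r hr =>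
      relay_eq_neg_one_of_gt (H.integralSol r).continuousOn_M
        (by simpa only [(H.integralSol 0).value_zero le_rfl] using hq) fun y hy => by
        simpa [Mop_apply] using hlt y ⟨hy.1, hy.2.trans_lt hr.2⟩
  have := e τ ⟨hτ.le, le_rfl⟩
  exact ⟨e, H.shift hτ.le (relay_of_threshold S.α_lt_β hτ (Or.inl (by simp only [this, h1])))⟩

end Solutions

end Setting

namespace Setting

variable {N : ℕ} [NeZero N] {S : Setting N}

/-! ### Well-posedness of the problem with hysteresis -/

section WellPosed

variable {h : ℝ → ℝ} {c t τ T₁ : ℝ} {q q' : S.State} {u v w : ℝ → Vec N}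

theorem hyst_congr (ht : 0 ≤ t) (H : ContinuousOn (fun r => S.M (v r)) (Icc 0 t))
    (h : ∀ r ∈ Icc 0 t, v r = w r) : S.hyst v t = S.hyst w t :=
  relay_congr ht H fun r hr => by rw [h r hr]

theorem norm_rhs_le (hh : |h t| ≤ 1) :
    ‖S.rhs h v t‖ ≤ ‖S.k‖ + ‖S.Bop‖ * ‖v t‖ + ‖S.Aop‖ * ‖v (t - 2 * S.T)‖ := by
  rw [rhs_eq]
  refine (norm_add_le _ _).trans (add_le_add ((_root_.norm_sub_le _ _).trans (add_le_add ?_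
    (S.Bop.le_opNorm _))) (S.Aop.le_opNorm _))
  rw [norm_smul, Real.norm_eq_abs]
  exact mul_le_of_le_one_left (norm_nonneg _) hh

/-- Solutions of the problem with hysteresis are unique, since the relay is right-continuous. -/
theorem IntegralSol.unique_hyst (H : S.IntegralSol (S.hyst v) q T₁ v)
    (H' : S.IntegralSol (S.hyst w) q T₁ w) : ∀ t ∈ Icc 0 T₁, v t = w t := by
  rcases lt_or_ge T₁ 0 with hT | hT
  · simp [Icc_eq_empty (not_le.2 hT)]
  set Z : Set ℝ := {t | ∀ r ∈ Icc 0 t, v r = w r} with hZ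
  have hclosed : IsClosed (Z ∩ Icc 0 T₁) := by
    have hD : IsClosed {t ∈ Icc 0 T₁ | v t = w t} := by
      have := (H.continuousOn.sub H'.continuousOn).preimage_isClosed_of_isClosed isClosed_Icc
        (isClosed_singleton (x := 0))
      convert this using 1
      ext t
      simp [sub_eq_zero]
    refine isClosed_of_closure_subset fun t ht => ?_
    have htI : t ∈ Icc 0 T₁ := isClosed_Icc.closure_subset (closure_mono inter_subset_right ht)
    refine ⟨fun r hr => ?_, htI⟩
    rcases hr.2.eq_or_lt with rfl | hlt
    · refine (hD.closure_subset (closure_mono (fun x hx => ?_) ht)).2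
      exact ⟨hx.2, hx.1 x ⟨hx.2.1, le_rfl⟩⟩
    · obtain ⟨x, hx, hxr⟩ := (mem_closure_iff.1 ht) (Ioi r) isOpen_Ioi hlt
      exact hxr.1 r ⟨hr.1, hx.le⟩
  have h0 : (0 : ℝ) ∈ Z := fun r hr => by
    rw [le_antisymm hr.2 hr.1, H.value_zero hT, H'.value_zero hT]
  have := hclosed.Icc_subset_of_forall_exists_gt h0 fun x hx y hy => by
    obtain ⟨hxZ, hx0, hxT⟩ := hx
    obtain ⟨η, hη, hηT, e⟩ := relay_eq_right S.α_lt_β hx0 hxT H.continuousOn_M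
    obtain ⟨η', hη', hηT', e'⟩ := relay_eq_right S.α_lt_β hx0 hxT H'.continuousOn_M
    have ee : S.hyst v x = S.hyst w x :=
      hyst_congr hx0 (H.continuousOn_M.mono (Icc_subset_Icc_right hxT.le)) hxZ
    set ζ := min (min η η') (y - x) with hζ
    have hζ0 : 0 < ζ := lt_min (lt_min hη hη') (sub_pos.2 hy)
    have hζ1 : ζ ≤ η := (min_le_left _ _).trans (min_le_left _ _)
    have hζ2 : ζ ≤ η' := (min_le_left _ _).trans (min_le_right _ _)
    have hζ3 : ζ ≤ y - x := min_le_right _ _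
    have hst := stateEq_stateAt hx0 (by
      filter_upwards [H.initial, H'.initial] with r a b using a.trans b.symm) hxZ
    have hu := ((H.shift hx0 hxT.le).mono (T₂ := ζ) (by linarith)).unique
      ((H'.shift hx0 hxT.le).mono (by linarith)) ((ae_restrict_iff' measurableSet_Ioo).2
        (ae_of_all _ fun r hr => by
          have a := e (x + r) ⟨by linarith [hr.1], by linarith [hr.2]⟩
          have b := e' (x + r) ⟨by linarith [hr.1], by linarith [hr.2]⟩
          exact a.trans (ee.trans b.symm))) hst.1 hst.2
    refine ⟨x + ζ, fun r hr => ?_, by linarith, by linarith⟩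
    rcases le_total r x with hrx | hrx
    · exact hxZ r ⟨hr.1, hrx⟩
    · simpa using hu (r - x) ⟨by linarith, by linarith [hr.2]⟩
  exact fun t ht => this ht t ⟨ht.1, le_rfl⟩

/-- A solution can be continued beyond its final time, with constant input. -/
theorem IntegralSol.exists_extension (hT : 0 ≤ T₁) (H : S.IntegralSol (S.hyst v) q T₁ v) :
    ∃ η > 0, ∃ V, S.IntegralSol (S.hyst V) q (T₁ + η) V := by
  set c := S.hyst v T₁ with hc
  obtain ⟨w, hw⟩ := exists_isFrozenSolution c (S.stateAt v T₁) (H.shift hT le_rfl).history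
  set V : ℝ → Vec N := fun t => if t ≤ T₁ then v t else w (t - T₁) with hV
  have hV1 : ∀ t ≤ T₁, V t = v t := fun t ht => by simp [hV, ht]
  have hV2 : ∀ t ∈ Icc (0 : ℝ) 1, V (T₁ + t) = w t := fun t ht => by
    rcases ht.1.eq_or_lt with h | h
    · rw [← h, (hw.integralSol 0).value_zero le_rfl, add_zero, hV1 _ le_rfl]; rfl
    · simp [hV, h]
  have hglue := IntegralSol.glue (H₀ := fun t => if t < T₁ then S.hyst v t else c) hT zero_le_one H
    (hw.integralSol 1) hV1 hV2
    ((ae_restrict_iff' measurableSet_Ioo).2 (ae_of_all _ fun t ht => by simp [ht.2]))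
    ((ae_restrict_iff' measurableSet_Ioo).2 (ae_of_all _ fun t ht => by simp [ht.1.le]))
  obtain ⟨η, hη, hη1, e⟩ := relay_eq_right S.α_lt_β hT (by linarith) hglue.continuousOn_M
  have hhyst : ∀ t ∈ Icc 0 T₁, S.hyst V t = S.hyst v t := fun t ht =>
    hyst_congr ht.1 (hglue.continuousOn_M.mono (Icc_subset_Icc_right (by linarith [ht.2])))
      fun r hr => hV1 r (hr.2.trans ht.2)
  refine ⟨η, hη, V, (hglue.mono hη1).congr (by linarith) ((ae_restrict_iff' measurableSet_Ioo).2
    (ae_of_all _ fun t ht => ?_)) (ae_of_all _ fun _ => rfl) fun _ _ => rfl⟩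
  rcases lt_or_ge t T₁ with h | h
  · simp [h, hhyst t ⟨ht.1.le, h.le⟩]
  · simp only [not_lt.2 h, if_false]
    exact (e t ⟨h, ht.2.le⟩).trans (hhyst T₁ ⟨hT, le_rfl⟩)

/-- Solutions on all intervals `[0, y]`, `y < T₁`, give a solution on `[0, T₁]`: they agree with
each other and are bounded, and so the right-hand side is in `L_p` up to `T₁`. -/
theorem exists_integralSol_hyst_of_lt (hT : 0 < T₁)
    (H : ∀ y ∈ Ico 0 T₁, ∃ v, S.IntegralSol (S.hyst v) q y v) :
    ∃ v, S.IntegralSol (S.hyst v) q T₁ v := by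
  choose! w hw using H
  have hq : MemLp q.1 (ENNReal.ofReal S.p) (vol (-2 * S.T) 0) := (hw 0 ⟨le_rfl, hT⟩).history
  have hww : ∀ x ∈ Ico 0 T₁, ∀ y ∈ Ico 0 T₁, x ≤ y → ∀ r ∈ Icc 0 x, w y r = w x r :=
    fun x hx y hy hxy => ((hw y hy).mono hxy).unique_hyst (hw x hx)
  -- the common continuation, still without the value at `T₁`
  set V₀ : ℝ → Vec N := fun t => if t < 0 then q.1 t else w t t with hV₀
  have hV₀w : ∀ y ∈ Ico 0 T₁, ∀ r ∈ Icc 0 y, V₀ r = w y r := fun y hy r hr => by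
    simp only [hV₀, not_lt.2 hr.1, if_false]
    exact (hww r ⟨hr.1, hr.2.trans_lt hy.2⟩ y hy hr.2 r ⟨hr.1, le_rfl⟩).symm
  have hV₀q : ∀ᵐ t ∂vol (-2 * S.T) 0, V₀ t = q.1 t :=
    (ae_restrict_iff' measurableSet_Ioo).2 (ae_of_all _ fun t ht => by simp [hV₀, ht.2])
  have hsol : ∀ y ∈ Ico 0 T₁, S.IntegralSol (S.hyst V₀) q y V₀ := fun y hy =>
    (hw y hy).congr hy.1 ((ae_restrict_iff' measurableSet_Ioo).2 (ae_of_all _ fun t ht =>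
      (hyst_congr ht.1.le ((hw y hy).continuousOn_M.mono (Icc_subset_Icc_right ht.2.le))
        fun r hr => (hV₀w y hy r ⟨hr.1, hr.2.trans ht.2.le⟩).symm).symm))
      (by filter_upwards [hV₀q, (hw y hy).initial] with t a b using a.trans b.symm) (hV₀w y hy)
  obtain ⟨R, hR⟩ : ∃ R : ℝ, ∀ t ∈ Ico 0 T₁, ‖V₀ t‖ ≤ R := by
    refine ⟨(‖q.2‖ + ‖S.k‖ * T₁ + ‖S.Aop‖ * ∫ r in Ioo (-2 * S.T) 0, ‖q.1 r‖) *
      Real.exp ((‖S.Aop‖ + ‖S.Bop‖) * T₁), fun t ht => ?_⟩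
    refine ((hsol t ht).norm_le (fun r => abs_relay.le) t ⟨ht.1, le_rfl⟩).trans ?_
    have : 0 ≤ ∫ r in Ioo (-2 * S.T) 0, ‖q.1 r‖ := integral_nonneg fun _ => norm_nonneg _
    gcongr <;> exact ht.2.le
  have hexh : ∀ {E : Type} [NormedAddCommGroup E] {f : ℝ → E},
      (∀ y ∈ Ico 0 T₁, AEStronglyMeasurable f (vol 0 y)) → AEStronglyMeasurable f (vol 0 T₁) := by
    intro E _ f hf
    obtain ⟨y, -, hy, hlim⟩ := exists_seq_strictMono_tendsto' hT
    have e : Ioo 0 T₁ = ⋃ n, Ioo 0 (y n) := by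
      ext t
      simp only [mem_iUnion]
      refine ⟨fun ht => ?_, fun ⟨n, ht⟩ => ⟨ht.1, ht.2.trans (hy n).2⟩⟩
      obtain ⟨n, hn⟩ := (hlim.eventually_const_lt ht.2).exists
      exact ⟨n, ht.1, hn⟩
    rw [vol, e]
    exact aestronglyMeasurable_iUnion_iff.2 fun n => hf _ ⟨(hy n).1.le, (hy n).2⟩
  have hmV : AEStronglyMeasurable V₀ (vol 0 T₁) := hexh fun y hy =>
    ((hsol y hy).continuousOn.mono Ioo_subset_Icc_self).aestronglyMeasurable measurableSet_Ioo
  have hV₀p : MemLp V₀ (ENNReal.ofReal S.p) (vol (-2 * S.T) T₁) := by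
    refine memLp_vol_union (by linarith [S.T_pos]) hT.le
      (hq.ae_eq (hV₀q.mono fun t ht => ht.symm)) (MemLp.of_bound hmV R ?_)
    exact (ae_restrict_iff' measurableSet_Ioo).2 (ae_of_all _ fun t ht => hR t ⟨ht.1.le, ht.2⟩)
  have hmr : AEStronglyMeasurable (S.rhs (S.hyst V₀) V₀) (vol 0 T₁) :=
    hexh fun y hy => (hsol y hy).memLp_rhs.1
  have hdel : MemLp (fun t => V₀ (t - 2 * S.T)) (ENNReal.ofReal S.p) (vol 0 T₁) := by
    have := memLp_vol_mono (a' := 0) (b' := T₁) (by linarith) (by linarith [S.T_pos])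
      (memLp_vol_add (s := -(2 * S.T)) hV₀p)
    simpa only [sub_eq_add_neg, add_comm] using this
  have hmemr : MemLp (S.rhs (S.hyst V₀) V₀) (ENNReal.ofReal S.p) (vol 0 T₁) := by
    have hb : MemLp (fun t => ‖S.k‖ + ‖S.Bop‖ * ‖V₀ t‖ + ‖S.Aop‖ * ‖V₀ (t - 2 * S.T)‖)
        (ENNReal.ofReal S.p) (vol 0 T₁) :=
      ((memLp_const ‖S.k‖).add ((memLp_vol_mono (by linarith [S.T_pos]) le_rfl hV₀p).norm.const_mul
        ‖S.Bop‖)).add (hdel.norm.const_mul ‖S.Aop‖)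
    exact hb.of_le hmr (ae_of_all _ fun t => (norm_rhs_le abs_relay.le).trans (Real.le_norm_self _))
  -- the value at `T₁` is the limit
  set V : ℝ → Vec N := fun t => if t < T₁ then V₀ t else
    q.2 + ∫ r in (0 : ℝ)..T₁, S.rhs (S.hyst V₀) V₀ r with hV
  have hVV : ∀ t < T₁, V t = V₀ t := fun t ht => by simp [hV, ht]
  have hsolV : S.IntegralSol (S.hyst V₀) q T₁ V := by
    have hr : ∀ᵐ t ∂vol 0 T₁, S.rhs (S.hyst V₀) V₀ t = S.rhs (S.hyst V₀) V t :=
      (ae_restrict_iff' measurableSet_Ioo).2 (ae_of_all _ fun t ht => by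
        rw [rhs, rhs, hVV t ht.2, hVV (t - 2 * S.T) (by linarith [ht.2, S.T_pos])])
    refine ⟨hq, ?_, hmemr.ae_eq hr, fun t ht => ?_⟩
    · filter_upwards [hV₀q, ae_restrict_mem measurableSet_Ioo] with t a b
      rw [hVV t (b.2.trans hT), a]
    · have e : ∫ r in (0 : ℝ)..t, S.rhs (S.hyst V₀) V r = ∫ r in (0 : ℝ)..t, S.rhs (S.hyst V₀) V₀ r := by
        rw [intervalIntegral.integral_of_le ht.1, intervalIntegral.integral_of_le ht.1,
          integral_Ioc_eq_integral_Ioo, integral_Ioc_eq_integral_Ioo]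
        exact integral_congr_ae ((ae_vol_mono le_rfl ht.2 hr).mono fun r hr => hr.symm)
      rw [e]
      rcases ht.2.eq_or_lt with rfl | hlt
      · simp [hV]
      · rw [hVV t hlt]
        exact (hsol t ⟨ht.1, hlt⟩).eq t ⟨ht.1, le_rfl⟩
  exact ⟨V, hsolV.congr hT.le ((ae_restrict_iff' measurableSet_Ioo).2 (ae_of_all _ fun t ht =>
    hyst_congr ht.1.le (hsolV.continuousOn_M.mono (Icc_subset_Icc_right ht.2.le))
      fun r hr => hVV r (hr.2.trans_lt ht.2))) (ae_of_all _ fun _ => rfl) fun _ _ => rfl⟩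

/-- The problem with hysteresis is globally solvable. -/
theorem exists_isSolution (hq : q ∈ S.phase) : ∃ v, S.IsSolution q v := by
  have key : ∀ n : ℕ, ∃ v, S.IntegralSol (S.hyst v) q n v := by
    intro n
    set Z : Set ℝ := {t | ∃ v, S.IntegralSol (S.hyst v) q t v} with hZ
    have h0 : (0 : ℝ) ∈ Z := by
      obtain ⟨v, hv⟩ := exists_isFrozenSolution 1 q hq.1
      exact ⟨v, (hv.integralSol 0).congr le_rfl (by simp [vol]) (ae_of_all _ fun _ => rfl)
        fun _ _ => rfl⟩
    have hclosed : IsClosed (Z ∩ Icc 0 (n : ℝ)) := by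
      refine isClosed_of_closure_subset fun t ht => ?_
      have htI : t ∈ Icc 0 (n : ℝ) :=
        isClosed_Icc.closure_subset (closure_mono inter_subset_right ht)
      refine ⟨?_, htI⟩
      rcases htI.1.eq_or_lt with rfl | hlt
      · exact h0
      · refine exists_integralSol_hyst_of_lt hlt fun y hy => ?_
        obtain ⟨x, hx, ⟨v, hv⟩, -⟩ := (mem_closure_iff.1 ht) (Ioi y) isOpen_Ioi hy.2
        exact ⟨v, hv.mono hx.le⟩
    refine hclosed.Icc_subset_of_forall_exists_gt h0 (fun x hx y hy => ?_) ⟨n.cast_nonneg, le_rfl⟩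
    obtain ⟨v, hv⟩ := hx.1
    obtain ⟨η, hη, V, hVs⟩ := hv.exists_extension hx.2.1
    exact ⟨min (x + η) y, ⟨V, hVs.mono (min_le_left _ _)⟩, lt_min (by linarith) hy, min_le_right _ _⟩
  choose w hw using key
  obtain ⟨V, hV⟩ := exists_global_of_forall_nat (q := q) w (fun n => (hw n).initial)
    (fun (m n : ℕ) hmn => ((hw n).mono (by exact_mod_cast hmn)).unique_hyst (hw m))
  refine ⟨V, fun T₁ hT₁ => (solvesOn_iff hT₁).2 ?_⟩
  obtain ⟨n, hn⟩ := exists_nat_ge T₁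
  refine ((hw n).congr n.cast_nonneg ((ae_restrict_iff' measurableSet_Ioo).2 (ae_of_all _
    fun t ht => ?_)) (hV n).1 (hV n).2).mono hn
  exact (hyst_congr ht.1.le ((hw n).continuousOn_M.mono (Icc_subset_Icc_right ht.2.le))
    fun r hr => ((hV n).2 r ⟨hr.1, hr.2.trans ht.2.le⟩).symm).symm

end WellPosed

end Setting

namespace Setting

variable {N : ℕ} [NeZero N] {S : Setting N}

/-! ### The two half-cycles of the periodic solution -/

/-- A solution with bounded data is Lipschitz. -/
theorem IntegralSol.norm_sub_le_of_bounded {h : ℝ → ℝ} {q : S.State} {T₁ R : ℝ} {v : ℝ → Vec N}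
    (H : S.IntegralSol h q T₁ v) (hh : ∀ t, |h t| ≤ 1) (h1 : ∀ r ∈ Icc 0 T₁, ‖v r‖ ≤ R)
    (h2 : ∀ᵐ r ∂vol 0 T₁, ‖v (r - 2 * S.T)‖ ≤ R) :
    ∀ a ∈ Icc 0 T₁, ∀ b ∈ Icc 0 T₁,
      ‖v a - v b‖ ≤ (‖S.k‖ + ‖S.Bop‖ * R + ‖S.Aop‖ * R) * |a - b| := by
  intro a ha b hb
  rw [H.sub_eq_integral hb ha]
  refine intervalIntegral.norm_integral_le_of_norm_le_const_ae ?_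
  have h3 : ∀ᵐ r ∂volume, r ∈ Ioc 0 T₁ → ‖v (r - 2 * S.T)‖ ≤ R := by
    rw [← ae_restrict_iff' measurableSet_Ioc, ← Measure.restrict_congr_set Ioo_ae_eq_Ioc]
    exact h2
  filter_upwards [h3] with r hr hr'
  have hI : r ∈ Ioc 0 T₁ := by
    rw [uIoc, mem_Ioc] at hr'
    exact ⟨(le_min hb.1 ha.1).trans_lt hr'.1, hr'.2.trans (max_le hb.2 ha.2)⟩
  refine (norm_rhs_le (hh r)).trans ?_
  gcongr
  · exact h1 r ⟨hI.1.le, hI.2⟩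
  · exact hr hI

/-- Two functions that are Lipschitz on adjacent intervals are Lipschitz together. -/
theorem norm_sub_le_of_split {E : Type*} [NormedAddCommGroup E] {W : ℝ → E} {K a b c : ℝ}
    (h1 : ∀ t ∈ Icc a b, ∀ r ∈ Icc a b, ‖W t - W r‖ ≤ K * |t - r|)
    (h2 : ∀ t ∈ Icc b c, ∀ r ∈ Icc b c, ‖W t - W r‖ ≤ K * |t - r|) :
    ∀ t ∈ Icc a c, ∀ r ∈ Icc a c, ‖W t - W r‖ ≤ K * |t - r| := by
  have key : ∀ t ∈ Icc a b, ∀ r ∈ Icc b c, ‖W t - W r‖ ≤ K * |t - r| := by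
    intro t ht r hr
    have e1 := h1 t ht b ⟨ht.1.trans ht.2, le_rfl⟩
    have e2 := h2 b ⟨le_rfl, hr.1.trans hr.2⟩ r hr
    have e3 := norm_sub_le_norm_sub_add_norm_sub (W t) (W b) (W r)
    rw [abs_of_nonpos (by linarith [ht.2])] at e1
    rw [abs_of_nonpos (by linarith [hr.1])] at e2
    rw [abs_of_nonpos (by linarith [ht.2, hr.1])]
    linarith
  intro t ht r hr
  rcases le_total t b with h | h <;> rcases le_total r b with h' | h'
  · exact h1 t ⟨ht.1, h⟩ r ⟨hr.1, h'⟩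
  · exact key t ⟨ht.1, h⟩ r ⟨h', hr.2⟩
  · rw [norm_sub_rev, abs_sub_comm]
    exact key r ⟨hr.1, h'⟩ t ⟨h, ht.2⟩
  · exact h2 t ⟨h, ht.2⟩ r ⟨h', hr.2⟩

/-- A Lipschitz history has a Lipschitz continuation with constant input. -/
theorem exists_isLip_frozen {K₀ c : ℝ} (hc : |c| ≤ 1) {w₀ : ℝ → Vec N}
    (h₀ : ∀ t ∈ Icc (-2 * S.T) 0, ∀ r ∈ Icc (-2 * S.T) 0, ‖w₀ t - w₀ r‖ ≤ K₀ * |t - r|) :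
    ∃ K W, S.IsLip K W ∧ S.IsFrozenSolution c (S.stateAt W 0) W ∧
      ∀ t ∈ Icc (-2 * S.T) 0, W t = w₀ t := by
  have hT := S.T_pos
  have hc₀ : ContinuousOn w₀ (Icc (-2 * S.T) 0) := by
    refine (LipschitzOnWith.of_dist_le_mul (K := K₀.toNNReal) fun t ht r hr => ?_).continuousOn
    rw [dist_eq_norm, Real.dist_eq]
    refine (h₀ t ht r hr).trans ?_
    gcongr
    exact Real.le_coe_toNNReal K₀
  obtain ⟨w, hw⟩ := exists_isFrozenSolution (S := S) c (S.stateAt w₀ 0)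
    (memLp_of_continuousOn_Icc (by simpa [stateAt] using hc₀))
  have hw0 : w 0 = w₀ 0 := (hw.integralSol 0).value_zero le_rfl
  set W : ℝ → Vec N := fun t => if t ≤ 0 then w₀ t else w t with hW
  have hW0 : ∀ t ≤ 0, W t = w₀ t := fun t ht => by simp [hW, ht]
  have hWw : ∀ t ≥ 0, W t = w t := fun t ht => by
    rcases ht.lt_or_eq with h | h
    · simp [hW, not_le.2 h]
    · rw [← h, hW0 0 le_rfl, hw0]
  have hst : S.stateAt w₀ 0 = (w₀, w₀ 0) := by simp [stateAt]
  have hae : ∀ᵐ t ∂vol (-2 * S.T) 0, W t = w t := by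
    filter_upwards [(hw.integralSol 0).initial, ae_restrict_mem measurableSet_Ioo] with t a b
    rw [a, hst, hW0 t b.2.le]
  have hWsol : S.IsFrozenSolution c (S.stateAt W 0) W := by
    have h1 : S.IsFrozenSolution c (S.stateAt w₀ 0) W := fun T₁ hT₁ => (solvesOn_iff hT₁).2
      ((hw.integralSol T₁).congr hT₁.le (ae_of_all _ fun _ => rfl) hae fun t ht => hWw t ht.1)
    exact ((h1.integralSol 0).stateEq_zero le_rfl).symm.isFrozenSolution h1
  have hWI := hWsol.integralSol (2 * S.T)
  have hWc : ContinuousOn W (Icc (-2 * S.T) (2 * S.T)) := by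
    rw [← Icc_union_Icc_eq_Icc (by linarith : -2 * S.T ≤ 0) (by linarith : 0 ≤ 2 * S.T)]
    exact (hc₀.congr fun t ht => hW0 t ht.2).union_of_isClosed hWI.continuousOn isClosed_Icc
      isClosed_Icc
  obtain ⟨R, hR⟩ := isCompact_Icc.exists_bound_of_continuousOn hWc
  have hL := hWI.norm_sub_le_of_bounded (R := R) (fun _ => hc)
    (fun r hr => hR r ⟨by linarith [hr.1], hr.2⟩) ((ae_restrict_iff' measurableSet_Ioo).2
      (ae_of_all _ fun r hr => hR _ ⟨by linarith [hr.1], by linarith [hr.2]⟩))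
  refine ⟨max K₀ (‖S.k‖ + ‖S.Bop‖ * R + ‖S.Aop‖ * R), W, ?_, hWsol, fun t ht => hW0 t ht.2⟩
  refine norm_sub_le_of_split (b := 0) (fun t ht r hr => ?_) fun t ht r hr => ?_
  · rw [hW0 t ht.2, hW0 r hr.2]
    refine (h₀ t ht r hr).trans ?_
    gcongr
    exact le_max_left _ _
  · refine (hL t ht r hr).trans ?_
    gcongr
    exact le_max_right _ _

/-- A Lipschitz solution with constant input is differentiable on `(0, 2T)`, because its right-hand
side is continuous. -/
theorem IsLip.exists_hasDerivAt {K c t : ℝ} {W : ℝ → Vec N} (hW : S.IsLip K W)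
    (hsol : S.IsFrozenSolution c (S.stateAt W 0) W) (ht : t ∈ Ioo 0 (2 * S.T)) :
    ∃ D, HasDerivAt W D t := by
  have hT := S.T_pos
  have H := hsol.integralSol (2 * S.T)
  have hc : ContinuousOn (S.rhs (fun _ => c) W) (Icc 0 (2 * S.T)) := by
    have e : S.rhs (fun _ => c) W = fun r => c • S.k - S.Bop (W r) + S.Aop (W (r - 2 * S.T)) := rfl
    rw [e]
    have h1 : ContinuousOn (fun r => W (r - 2 * S.T)) (Icc 0 (2 * S.T)) :=
      hW.continuousOn.comp (by fun_prop) fun r hr => ⟨by linarith [hr.1], by linarith [hr.2]⟩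
    have h2 : ContinuousOn W (Icc 0 (2 * S.T)) := H.continuousOn
    exact (continuousOn_const.sub (S.Bop.continuous.comp_continuousOn h2)).add
      (S.Aop.continuous.comp_continuousOn h1)
  have hnhd : Icc 0 (2 * S.T) ∈ 𝓝 t := Icc_mem_nhds ht.1 ht.2
  have h3 := intervalIntegral.integral_hasDerivAt_right (a := 0) (b := t)
    (f := S.rhs (fun _ => c) W) ((hc.mono (by
      rw [uIcc_of_le ht.1.le]; exact Icc_subset_Icc_right ht.2.le)).intervalIntegrable)
    (ContinuousOn.stronglyMeasurableAtFilter_nhdsWithin hc measurableSet_Icc t |>.filter_mono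
      (by rw [nhdsWithin_eq_nhds.2 hnhd]))
    (hc.continuousAt hnhd)
  refine ⟨_, (h3.const_add (W 0)).congr_of_eventuallyEq ?_⟩
  filter_upwards [hnhd] with r hr
  exact H.eq r hr

/-- If a function reaches a level from below with non-zero derivative then it exceeds the level
afterwards. -/
theorem exists_gt_of_hasDerivAt {f : ℝ → ℝ} {d T l : ℝ} (hf : HasDerivAt f d T) (hd : d ≠ 0)
    (hT : 0 < T) (hl : f T = l) (hlt : ∀ t ∈ Ico 0 T, f t < l) :
    ∀ η > 0, ∃ t ∈ Ioo T (T + η), l < f t := by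
  intro η hη
  have h1 := hasDerivAt_iff_tendsto_slope.1 hf
  have hpos : 0 < d := by
    by_contra hcon
    have hneg : d < 0 := lt_of_le_of_ne (not_lt.1 hcon) hd
    have h2 : ∀ᶠ t in 𝓝[<] T, slope f T t < 0 :=
      (h1.mono_left (nhdsWithin_mono _ fun x hx => ne_of_lt hx)).eventually_lt_const hneg
    obtain ⟨t, ht, ht'⟩ := (h2.and (Ico_mem_nhdsLT hT)).exists
    rw [slope_def_field, div_neg_iff] at ht
    have := hlt t ht'
    rcases ht with ht | ht <;> linarith [ht'.2]
  have h2 : ∀ᶠ t in 𝓝[>] T, 0 < slope f T t :=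
    (h1.mono_left (nhdsWithin_mono _ fun x hx => ne_of_gt hx)).eventually_const_lt hpos
  obtain ⟨t, ht, ht'⟩ := (h2.and (Ioo_mem_nhdsGT (by linarith : T < T + η))).exists
  refine ⟨t, ht', ?_⟩
  rw [slope_def_field, div_pos_iff] at ht
  rcases ht with ht | ht <;> linarith [ht'.1]

/-- The limit cycle, cut at its switching times: `W₁` and `W₂` solve the equation with the constant
inputs `1` and `-1` on `[0, ∞)`, their restrictions to `[0, T]` are the halves of the cycle, and both
cross the respective threshold at `T`. -/
structure IsCycle (S : Setting N) (W₁ W₂ : ℝ → Vec N) : Prop where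
  lip₁ : ∃ K, S.IsLip K W₁
  lip₂ : ∃ K, S.IsLip K W₂
  sol₁ : S.IsFrozenSolution 1 (S.stateAt W₁ 0) W₁
  sol₂ : S.IsFrozenSolution (-1) (S.stateAt W₂ 0) W₂
  link₁ : S.StateEq (S.stateAt W₁ S.T) (S.stateAt W₂ 0)
  link₂ : S.StateEq (S.stateAt W₂ S.T) (S.stateAt W₁ 0)
  start : S.M (W₁ 0) = S.α
  lt₁ : ∀ t ∈ Ico 0 S.T, S.M (W₁ t) < S.β
  gt₂ : ∀ t ∈ Ico 0 S.T, S.α < S.M (W₂ t)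
  cross₁ : ∀ η > 0, ∃ t ∈ Ioo S.T (S.T + η), S.β < S.M (W₁ t)
  cross₂ : ∀ η > 0, ∃ t ∈ Ioo S.T (S.T + η), S.M (W₂ t) < S.α

section Periodic

variable {q : S.State} {u : ℝ → Vec N}

theorem IsSolution.continuous_M (H : S.IsSolution q u) {b : ℝ} :
    ContinuousOn (fun t => S.M (u t)) (Icc 0 b) := (H.integralSol b).continuousOn_M

/-- Between switching times the relay keeps its value. -/
theorem IsSolution.hyst_eq_of_no_switching (H : S.IsSolution q u) {a b : ℝ} (ha : 0 ≤ a)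
    (h : ∀ t ∈ Ioo a b, ¬ IsSwitchingTime S.α S.β (fun r => S.M (u r)) t) :
    ∀ t ∈ Ico a b, S.hyst u t = S.hyst u a := by
  intro t ht
  have hab : a < b := ht.1.trans_lt ht.2
  obtain ⟨η, hη, hηb, e⟩ := relay_eq_right S.α_lt_β ha hab H.continuous_M
  have hc : ContinuousOn (S.hyst u) (Ioo a b) := fun r hr => by
    have := h r hr
    simp only [IsSwitchingTime, not_and, not_not] at this
    exact (this (ha.trans_lt hr.1)).continuousWithinAt
  have hd : IsDiscrete ({1, -1} : Set ℝ) := (Set.toFinite _).isDiscrete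
  rcases ht.1.eq_or_lt with rfl | hlt
  · rfl
  have hx : a + η / 2 ∈ Ioo a b := ⟨by linarith, by linarith⟩
  rw [isPreconnected_Ioo.constant_of_mapsTo hd hc (fun r _ => ?_) ⟨hlt, ht.2⟩ hx]
  · exact e _ ⟨by linarith, by linarith⟩
  · have := abs_relay (α := S.α) (β := S.β) (g := fun t => S.M (u t)) (t := r)
    rcases eq_or_eq_neg_of_abs_eq this with h | h <;> simp [hyst, h]

namespace IsSymmetricPeriodic

theorem isSolution (hu : S.IsSymmetricPeriodic q u) : S.IsSolution q u := hu.periodic.solution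

theorem value_zero (hu : S.IsSymmetricPeriodic q u) : u 0 = q.2 := (hu.isSolution.integralSol 0).value_zero le_rfl

theorem hyst_first (hu : S.IsSymmetricPeriodic q u) : ∀ t ∈ Ico 0 S.T, S.hyst u t = 1 := by
  intro t ht
  have hT := S.T_pos
  rw [hu.isSolution.hyst_eq_of_no_switching le_rfl (fun r hr hsw => ?_) t ht, hyst, relay_zero,
    hu.value_zero, hu.start, if_pos S.α_lt_β]
  rcases (hu.switching r ⟨hr.1, by linarith [hr.2]⟩).1 hsw with h | h <;> linarith [hr.2]

theorem hyst_second (hu : S.IsSymmetricPeriodic q u) : ∀ t ∈ Ico S.T (2 * S.T), S.hyst u t = -1 := by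
  intro t ht
  have hT := S.T_pos
  rw [hu.isSolution.hyst_eq_of_no_switching hT.le (fun r hr hsw => ?_) t ht, hyst,
    relay_of_threshold S.α_lt_β hT (Or.inr hu.at_T), hu.at_T, if_neg (lt_irrefl _)]
  rcases (hu.switching r ⟨by linarith [hr.1], hr.2.le⟩).1 hsw with h | h <;> linarith [hr.1, hr.2]

/-- Reaching `β` before `T` would switch the relay. -/
theorem lt_β (hu : S.IsSymmetricPeriodic q u) : ∀ t ∈ Ico 0 S.T, S.M (u t) < S.β := by
  intro t ht
  by_contra hcon
  obtain ⟨x, hx, hx'⟩ := intermediate_value_Icc ht.1 hu.isSolution.continuous_M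
    ⟨by simp only [hu.value_zero, hu.start, S.α_lt_β.le], not_lt.1 hcon⟩
  have hx0 : x ≠ 0 := by
    rintro rfl
    simp only [hu.value_zero, hu.start] at hx'
    exact S.α_lt_β.ne hx'
  have h1 := hu.hyst_first x ⟨hx.1, hx.2.trans_lt ht.2⟩
  rw [hyst, relay_of_threshold S.α_lt_β (lt_of_le_of_ne hx.1 hx0.symm) (Or.inr hx'),
    show S.M (u x) = S.β from hx',
    if_neg (lt_irrefl _)] at h1
  norm_num at h1

theorem α_lt (hu : S.IsSymmetricPeriodic q u) : ∀ t ∈ Ico S.T (2 * S.T), S.α < S.M (u t) := by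
  intro t ht
  have hT := S.T_pos
  by_contra hcon
  obtain ⟨x, hx, hx'⟩ := intermediate_value_Icc' ht.1
    (hu.isSolution.continuous_M.mono (Icc_subset_Icc_left hT.le))
    ⟨not_lt.1 hcon, by simp only [hu.at_T, S.α_lt_β.le]⟩
  have h1 := hu.hyst_second x ⟨hx.1, hx.2.trans_lt ht.2⟩
  rw [hyst, relay_of_threshold S.α_lt_β (hT.trans_le hx.1) (Or.inl hx'),
    show S.M (u x) = S.α from hx',
    if_pos S.α_lt_β] at h1
  norm_num at h1

/-- By periodicity the delayed term is bounded, since `u` is bounded on `[0, 2T]`. -/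
theorem lipschitz (hu : S.IsSymmetricPeriodic q u) : ∃ K, ∀ t ∈ Icc 0 (2 * S.T), ∀ r ∈ Icc 0 (2 * S.T),
    ‖u t - u r‖ ≤ K * |t - r| := by
  have hT := S.T_pos
  have H := hu.isSolution.integralSol (2 * S.T)
  obtain ⟨R, hR⟩ := isCompact_Icc.exists_bound_of_continuousOn H.continuousOn
  have h1 : ∀ᵐ t ∂vol (-2 * S.T) 0, ‖u t‖ ≤ R := by
    filter_upwards [H.initial, hu.periodic.history, ae_restrict_mem measurableSet_Ioo] with t a b c
    rw [a, ← b]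
    exact hR _ ⟨by linarith [c.1], by linarith [c.2]⟩
  refine ⟨_, H.norm_sub_le_of_bounded (fun _ => abs_relay.le) hR ?_⟩
  have h2 := ae_vol_mono (a' := 0) (b' := 2 * S.T) (by linarith) (by linarith)
    (ae_vol_add (s := -(2 * S.T)) h1)
  simpa only [sub_eq_add_neg, add_comm] using h2

/-- The halves of a symmetric periodic solution form a cycle. -/
theorem exists_isCycle (hu : S.IsSymmetricPeriodic q u) : ∃ W₁ W₂, S.IsCycle W₁ W₂ ∧ S.StateEq q (S.stateAt W₁ 0) ∧
    (∀ t ∈ Icc 0 S.T, S.StateEq (S.stateAt u t) (S.stateAt W₁ t)) ∧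
    (∀ t ∈ Icc 0 S.T, S.StateEq (S.stateAt u (S.T + t)) (S.stateAt W₂ t)) := by
  have hT := S.T_pos
  obtain ⟨K, hK⟩ := hu.lipschitz
  have hini := (hu.isSolution.integralSol 0).initial
  obtain ⟨K₁, W₁, hl₁, hs₁, h₁⟩ := exists_isLip_frozen (S := S) (c := 1) (by simp)
    (w₀ := fun t => u (2 * S.T + t)) (K₀ := K) fun t ht r hr => by
      have := hK (2 * S.T + t) ⟨by linarith [ht.1], by linarith [ht.2]⟩ (2 * S.T + r)
        ⟨by linarith [hr.1], by linarith [hr.2]⟩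
      rwa [add_sub_add_left_eq_sub] at this
  have hq : S.StateEq q (S.stateAt W₁ 0) := by
    refine ⟨?_, ?_⟩
    · filter_upwards [hu.periodic.history, ae_restrict_mem measurableSet_Ioo] with t a b
      simp [stateAt, h₁ t ⟨b.1.le, b.2.le⟩, a]
    · simp [stateAt, h₁ 0 ⟨by linarith, le_rfl⟩, hu.periodic.value]
  have hWu₁ : ∀ t ∈ Icc 0 S.T, u t = W₁ t :=
    (hu.isSolution.integralSol S.T).unique (hs₁.integralSol S.T)
      ((ae_restrict_iff' measurableSet_Ioo).2 (ae_of_all _ fun t ht =>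
        hu.hyst_first t ⟨ht.1.le, ht.2⟩)) hq.1 hq.2
  have hst₁ : ∀ t ∈ Icc 0 S.T, S.StateEq (S.stateAt u t) (S.stateAt W₁ t) := fun t ht =>
    stateEq_stateAt ht.1 (by
      filter_upwards [hini, hq.1] with r a b
      rw [a, b]; simp [stateAt]) fun r hr => hWu₁ r ⟨hr.1, hr.2.trans ht.2⟩
  obtain ⟨K₂, W₂, hl₂, hs₂, h₂⟩ := exists_isLip_frozen (S := S) (c := -1) (by simp)
    (w₀ := fun t => W₁ (S.T + t)) (K₀ := K₁) fun t ht r hr => by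
      have := hl₁ (S.T + t) ⟨by linarith [ht.1], by linarith [ht.2]⟩ (S.T + r)
        ⟨by linarith [hr.1], by linarith [hr.2]⟩
      rwa [add_sub_add_left_eq_sub] at this
  have hlink₁ : S.StateEq (S.stateAt W₁ S.T) (S.stateAt W₂ 0) := by
    refine ⟨?_, ?_⟩
    · filter_upwards [ae_restrict_mem measurableSet_Ioo] with t b
      simp [stateAt, h₂ t ⟨b.1.le, b.2.le⟩]
    · simp [stateAt, h₂ 0 ⟨by linarith, le_rfl⟩]
  have hst₂0 : S.StateEq (S.stateAt u S.T) (S.stateAt W₂ 0) := (hst₁ S.T ⟨hT.le, le_rfl⟩).trans hlink₁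
  have hushift := (hu.isSolution.integralSol (2 * S.T)).shift hT.le (by linarith)
  have hWu₂ : ∀ t ∈ Icc 0 S.T, u (S.T + t) = W₂ t :=
    (hushift.mono (by linarith)).unique (hs₂.integralSol S.T)
      ((ae_restrict_iff' measurableSet_Ioo).2 (ae_of_all _ fun t ht =>
        hu.hyst_second (S.T + t) ⟨by linarith [ht.1], by linarith [ht.2]⟩)) hst₂0.1 hst₂0.2
  have hst₂ : ∀ t ∈ Icc 0 S.T, S.StateEq (S.stateAt u (S.T + t)) (S.stateAt W₂ t) := fun t ht => by
    have e : S.stateAt u (S.T + t) = S.stateAt (fun r => u (S.T + r)) t := by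
      simp only [stateAt, add_assoc]
    rw [e]
    refine stateEq_stateAt ht.1 ?_ fun r hr => hWu₂ r ⟨hr.1, hr.2.trans ht.2⟩
    filter_upwards [hst₂0.1] with r a
    simpa [stateAt] using a
  have hlink₂ : S.StateEq (S.stateAt W₂ S.T) (S.stateAt W₁ 0) := by
    refine (hst₂ S.T ⟨hT.le, le_rfl⟩).symm.trans (StateEq.trans ⟨?_, ?_⟩ hq)
    · filter_upwards [hu.periodic.history] with t a
      simp only [stateAt, ← two_mul]; exact a
    · simp only [stateAt, ← two_mul]; exact hu.periodic.value
  have hMT : S.M (W₁ S.T) = S.β := by rw [← hWu₁ S.T ⟨hT.le, le_rfl⟩, hu.at_T]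
  have hM2T : S.M (W₂ S.T) = S.α := by
    rw [← hWu₂ S.T ⟨hT.le, le_rfl⟩, ← two_mul, hu.at_two_T]
  have hlt₁ : ∀ t ∈ Ico 0 S.T, S.M (W₁ t) < S.β := fun t ht => by
    rw [← hWu₁ t ⟨ht.1, ht.2.le⟩]; exact hu.lt_β t ht
  have hgt₂ : ∀ t ∈ Ico 0 S.T, S.α < S.M (W₂ t) := fun t ht => by
    rw [← hWu₂ t ⟨ht.1, ht.2.le⟩]
    exact hu.α_lt _ ⟨by linarith [ht.1], by linarith [ht.2]⟩
  -- the one-sided derivatives of `M u` are the derivatives of `M W₁` and `M W₂` at `T`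
  obtain ⟨D₁, hD₁⟩ := hl₁.exists_hasDerivAt hs₁ (t := S.T) ⟨hT, by linarith⟩
  obtain ⟨D₂, hD₂⟩ := hl₂.exists_hasDerivAt hs₂ (t := S.T) ⟨hT, by linarith⟩
  have hM₁ : HasDerivAt (fun t => S.M (W₁ t)) (S.M D₁) S.T := by
    simpa only [Function.comp_def, Mop_apply] using (S.Mop.hasFDerivAt (x := W₁ S.T)).comp_hasDerivAt S.T hD₁
  have hM₂ : HasDerivAt (fun t => S.M (W₂ t)) (S.M D₂) S.T := by
    simpa only [Function.comp_def, Mop_apply] using (S.Mop.hasFDerivAt (x := W₂ S.T)).comp_hasDerivAt S.T hD₂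
  have hd₁ : S.M D₁ ≠ 0 := by
    have h1 : HasDerivWithinAt (fun t => S.M (u t)) (S.M D₁) (Iic S.T) S.T := by
      refine hM₁.hasDerivWithinAt.congr_of_eventuallyEq ?_ (by rw [hWu₁ _ ⟨hT.le, le_rfl⟩])
      filter_upwards [Icc_mem_nhdsLE hT] with t ht
      rw [hWu₁ t ht]
    rw [← h1.derivWithin (uniqueDiffOn_Iic _ _ self_mem_Iic)]
    exact hu.transverse_T
  have hd₂ : S.M D₂ ≠ 0 := by
    have h0 : HasDerivAt (fun t => S.M (W₂ (t - S.T))) (S.M D₂) (2 * S.T) := by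
      refine HasDerivAt.comp_sub_const (f := fun t => S.M (W₂ t)) (2 * S.T) S.T ?_
      rwa [two_mul, add_sub_cancel_right]
    have h1 : HasDerivWithinAt (fun t => S.M (u t)) (S.M D₂) (Iic (2 * S.T)) (2 * S.T) := by
      refine h0.hasDerivWithinAt.congr_of_eventuallyEq_of_mem ?_ self_mem_Iic
      filter_upwards [Icc_mem_nhdsLE (by linarith : S.T < 2 * S.T)] with t ht
      rw [← hWu₂ (t - S.T) ⟨by linarith [ht.1], by linarith [ht.2]⟩, add_sub_cancel]
    rw [← h1.derivWithin (uniqueDiffOn_Iic _ _ self_mem_Iic)]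
    exact hu.transverse_two_T
  refine ⟨W₁, W₂, ⟨⟨K₁, hl₁⟩, ⟨K₂, hl₂⟩, hs₁, hs₂, hlink₁, hlink₂, ?_, hlt₁, hgt₂,
    exists_gt_of_hasDerivAt hM₁ hd₁ hT hMT hlt₁, fun η hη => ?_⟩, hq, hst₁, hst₂⟩
  · rw [← hWu₁ 0 ⟨le_rfl, hT.le⟩, hu.value_zero, hu.start]
  · obtain ⟨t, ht, h⟩ := exists_gt_of_hasDerivAt hM₂.neg (neg_ne_zero.2 hd₂) hT
      (congrArg Neg.neg hM2T) (fun t ht => neg_lt_neg (hgt₂ t ht)) η hη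
    exact ⟨t, ht, neg_lt_neg_iff.1 h⟩

end IsSymmetricPeriodic

end Periodic

end Setting

namespace Setting

variable {N : ℕ} [NeZero N] {S : Setting N}

/-! ### Solutions near the cycle -/

theorem StateEq.isSolution {q q' : S.State} {v : ℝ → Vec N} (h : S.StateEq q q')
    (H : S.IsSolution q v) : S.IsSolution q' v := fun T₁ hT₁ =>
  { H T₁ hT₁ with
    initial := by filter_upwards [(H T₁ hT₁).initial, h.1] with t a b using a.trans b
    initial_zero := (H T₁ hT₁).initial_zero.trans h.2 }

/-- A time shift of a solution is a solution with the state at that time as initial data. -/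
theorem IsSolution.stateEq_of_shift {q : S.State} {v : ℝ → Vec N} {s : ℝ}
    (H : S.IsSolution q (fun r => v (s + r))) : S.StateEq (S.stateAt v s) q := by
  have h := (H.integralSol 0).stateEq_zero le_rfl
  have e : S.stateAt (fun r => v (s + r)) 0 = S.stateAt v s := by simp [stateAt]
  rwa [e] at h

/-- `q` lies in the phase space within distance `ε` of the cycle. -/
def NearCycle (S : Setting N) (W₁ W₂ : ℝ → Vec N) (ε : ℝ) (q : S.State) : Prop :=
  q ∈ S.phase ∧ ∃ x ∈ Icc 0 S.T, S.sdist q (S.stateAt W₁ x) ≤ ENNReal.ofReal ε ∨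
    S.sdist q (S.stateAt W₂ x) ≤ ENNReal.ofReal ε

section Near

variable {W₁ W₂ : ℝ → Vec N} {ε ε' : ℝ} {q q' : S.State} {v : ℝ → Vec N}

theorem NearCycle.mono (h : S.NearCycle W₁ W₂ ε q) (hε : ε ≤ ε') : S.NearCycle W₁ W₂ ε' q := by
  obtain ⟨h1, x, hx, h2⟩ := h
  exact ⟨h1, x, hx, h2.imp (fun h => h.trans (ENNReal.ofReal_le_ofReal hε))
    fun h => h.trans (ENNReal.ofReal_le_ofReal hε)⟩

theorem NearCycle.congr (h : S.NearCycle W₁ W₂ ε q) (e : S.StateEq q q') :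
    S.NearCycle W₁ W₂ ε q' := by
  obtain ⟨h1, x, hx, h2⟩ := h
  rw [e.sdist_left, e.sdist_left] at h2
  exact ⟨e.mem_phase h1, x, hx, h2⟩

theorem exists_pos_ofReal_lt {δ : ℝ≥0∞} (hδ : 0 < δ) {ε : ℝ} (hε : 0 < ε) :
    ∃ ε' > 0, ε' ≤ ε ∧ ENNReal.ofReal ε' < δ := by
  obtain ⟨r, hr0, hr⟩ := ENNReal.lt_iff_exists_nnreal_btwn.1 hδ
  refine ⟨min ε r, lt_min hε (by exact_mod_cast hr0), min_le_left _ _, lt_of_le_of_lt ?_ hr⟩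
  exact (ENNReal.ofReal_le_ofReal (min_le_right _ _)).trans (ENNReal.ofReal_coe_nnreal).le

namespace IsCycle

/-- Solutions starting near the first half of the cycle hit the threshold `β` near its end. -/
theorem exists_first_half (hW : S.IsCycle W₁ W₂) (hε : 0 < ε) : ∃ δ : ℝ≥0∞, 0 < δ ∧
    ∀ t ∈ Icc 0 S.T, ∀ q ∈ S.phase, S.sdist q (S.stateAt W₁ t) < δ → S.M q.2 < S.β →
      S.hitTimeβ q < ⊤ ∧ S.Pβ q ∈ S.crossSection S.β ∧
      S.sdist (S.Pβ q) (S.stateAt W₂ 0) ≤ ENNReal.ofReal ε ∧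
      ∀ v, S.IsSolution q v → ∃ τ, 0 < τ ∧ S.IsSolution (S.Pβ q) (fun r => v (τ + r)) ∧
        ∀ r ∈ Icc 0 τ, S.NearCycle W₁ W₂ ε (S.stateAt v r) := by
  obtain ⟨K, hK⟩ := hW.lip₁
  obtain ⟨δ, hδ, H⟩ := exists_half_cycle hK (hW.sol₁.integralSol _) S.Mop (l := S.β)
    (by simpa only [Mop_apply] using hW.lt₁) (by simpa only [Mop_apply] using hW.cross₁) hε
  refine ⟨δ, hδ, fun t ht q hq hqt hqβ => ?_⟩
  have hw := isFrozenSolution_frozen hq 1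
  obtain ⟨τ, hτ, -, h1, h2, h3, h4⟩ := H t ht q hq hqt (by rwa [Mop_apply]) _ hw
  simp only [Mop_apply] at h1 h2
  have hhit : S.hitTimeβ q = ENNReal.ofReal τ := firstHit_eq hτ h1 fun r hr => (h2 r hr).ne
  have hP : S.Pβ q = S.stateAt (S.frozen 1 q) τ := by
    rw [Pβ, hhit, ENNReal.toReal_ofReal hτ.le]
  rw [hP]
  refine ⟨hhit ▸ ENNReal.ofReal_lt_top, ⟨(h3 τ ⟨hτ.le, le_rfl⟩).1, h1⟩, ?_, fun v hv => ?_⟩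
  · rwa [← hW.link₁.sdist_right]
  · obtain ⟨e1, e2⟩ := hv.eq_of_first_hit_β hw hτ h1 h2
    have est : ∀ r ∈ Icc 0 τ, S.StateEq (S.stateAt v r) (S.stateAt (S.frozen 1 q) r) :=
      fun r hr => stateEq_stateAt hr.1 (by
        filter_upwards [(hv.integralSol 0).initial, (hw.integralSol 0).initial] with x a b
        rw [a, b]) fun x hx => e1 x ⟨hx.1, hx.2.trans hr.2⟩
    refine ⟨τ, hτ, (est τ ⟨hτ.le, le_rfl⟩).isSolution e2, fun r hr => ?_⟩
    refine NearCycle.congr ⟨(h3 r hr).1, _, ⟨le_min (by linarith [ht.1, hr.1]) S.T_pos.le,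
      min_le_right _ _⟩, Or.inl (h3 r hr).2⟩ (est r hr).symm

/-- Solutions starting near the second half of the cycle hit the threshold `α` near its end. -/
theorem exists_second_half (hW : S.IsCycle W₁ W₂) (hε : 0 < ε) : ∃ δ : ℝ≥0∞, 0 < δ ∧
    ∀ t ∈ Icc 0 S.T, ∀ q ∈ S.phase, S.sdist q (S.stateAt W₂ t) < δ → S.β ≤ S.M q.2 →
      S.hitTimeα q < ⊤ ∧ S.Pα q ∈ S.crossSection S.α ∧
      S.sdist (S.Pα q) (S.stateAt W₁ 0) ≤ ENNReal.ofReal ε ∧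
      ∀ v, S.IsSolution q v → ∃ τ, 0 < τ ∧ S.T - t - ε ≤ τ ∧
        S.IsSolution (S.Pα q) (fun r => v (τ + r)) ∧
        ∀ r ∈ Icc 0 τ, S.NearCycle W₁ W₂ ε (S.stateAt v r) := by
  obtain ⟨K, hK⟩ := hW.lip₂
  obtain ⟨δ, hδ, H⟩ := exists_half_cycle hK (hW.sol₂.integralSol _) (-S.Mop) (l := -S.α)
    (by simpa [Mop_apply] using hW.gt₂) (by simpa [Mop_apply] using hW.cross₂) hε
  refine ⟨δ, hδ, fun t ht q hq hqt hqβ => ?_⟩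
  have hw := isFrozenSolution_frozen hq (-1)
  obtain ⟨τ, hτ, h0, h1, h2, h3, h4⟩ := H t ht q hq hqt
    (by simpa [Mop_apply] using S.α_lt_β.trans_le hqβ) _ hw
  simp only [neg_apply, Mop_apply, neg_inj, neg_lt_neg_iff] at h1 h2
  have hhit : S.hitTimeα q = ENNReal.ofReal τ := firstHit_eq hτ h1 fun r hr => (h2 r hr).ne'
  have hP : S.Pα q = S.stateAt (S.frozen (-1) q) τ := by
    rw [Pα, hhit, ENNReal.toReal_ofReal hτ.le]
  rw [hP]
  refine ⟨hhit ▸ ENNReal.ofReal_lt_top, ⟨(h3 τ ⟨hτ.le, le_rfl⟩).1, h1⟩, ?_, fun v hv => ?_⟩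
  · rwa [← hW.link₂.sdist_right]
  · obtain ⟨e1, e2⟩ := hv.eq_of_first_hit_α hw hqβ hτ h1 h2
    have est : ∀ r ∈ Icc 0 τ, S.StateEq (S.stateAt v r) (S.stateAt (S.frozen (-1) q) r) :=
      fun r hr => stateEq_stateAt hr.1 (by
        filter_upwards [(hv.integralSol 0).initial, (hw.integralSol 0).initial] with x a b
        rw [a, b]) fun x hx => e1 x ⟨hx.1, hx.2.trans hr.2⟩
    refine ⟨τ, hτ, by linarith [(abs_le.1 h0).1], (est τ ⟨hτ.le, le_rfl⟩).isSolution e2,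
      fun r hr => ?_⟩
    refine NearCycle.congr ⟨(h3 r hr).1, _, ⟨le_min (by linarith [ht.1, hr.1]) S.T_pos.le,
      min_le_right _ _⟩, Or.inr (h3 r hr).2⟩ (est r hr).symm

/-- Solutions starting near the first half of the cycle return to the cross-section
`{M x = α}` near the start of the cycle. -/
theorem exists_return (hW : S.IsCycle W₁ W₂) (hε : 0 < ε) : ∃ δ : ℝ≥0∞, 0 < δ ∧
    ∀ t ∈ Icc 0 S.T, ∀ q ∈ S.phase, S.sdist q (S.stateAt W₁ t) < δ → S.M q.2 < S.β →
      (S.M q.2 = S.α → q ∈ S.domP) ∧ S.P q ∈ S.crossSection S.α ∧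
      S.sdist (S.P q) (S.stateAt W₁ 0) ≤ ENNReal.ofReal ε ∧
      ∀ v, S.IsSolution q v → ∃ s, S.T / 2 ≤ s ∧ S.IsSolution (S.P q) (fun r => v (s + r)) ∧
        ∀ r ∈ Icc 0 s, S.NearCycle W₁ W₂ ε (S.stateAt v r) := by
  have hT := S.T_pos
  -- with `ε₂ ≤ T / 2` the second half takes at least the time `T / 2`
  set ε₂ := min ε (S.T / 2) with hε₂
  have hε₂0 : 0 < ε₂ := lt_min hε (by positivity)
  obtain ⟨δ₂, hδ₂, H₂⟩ := hW.exists_second_half hε₂0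
  obtain ⟨ε₁, hε₁, hε₁ε, hε₁δ⟩ := exists_pos_ofReal_lt hδ₂ hε
  obtain ⟨δ₁, hδ₁, H₁⟩ := hW.exists_first_half hε₁
  refine ⟨δ₁, hδ₁, fun t ht q hq hqt hqβ => ?_⟩
  obtain ⟨a1, a2, a3, a4⟩ := H₁ t ht q hq hqt hqβ
  obtain ⟨b1, b2, b3, b4⟩ := H₂ 0 ⟨le_rfl, hT.le⟩ (S.Pβ q) a2.1 (a3.trans_lt hε₁δ) a2.2.ge
  refine ⟨fun hqα => ⟨⟨⟨hq, hqα⟩, a1⟩, a2, b1⟩, b2,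
    b3.trans (ENNReal.ofReal_le_ofReal (min_le_left _ _)), fun v hv => ?_⟩
  obtain ⟨τ₁, hτ₁, hv₁, hn₁⟩ := a4 v hv
  obtain ⟨τ₂, hτ₂, hle, hv₂, hn₂⟩ := b4 _ hv₁
  refine ⟨τ₁ + τ₂, ?_, ?_, fun r hr => ?_⟩
  · linarith [min_le_right ε (S.T / 2)]
  · simpa only [add_assoc, P] using hv₂
  · rcases le_total r τ₁ with h | h
    · exact (hn₁ r ⟨hr.1, h⟩).mono hε₁ε
    · have := hn₂ (r - τ₁) ⟨by linarith, by linarith [hr.2]⟩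
      have e : S.stateAt (fun r => v (τ₁ + r)) (r - τ₁) = S.stateAt v r := by
        simp only [stateAt, ← add_assoc, add_sub_cancel]
      rw [e] at this
      exact this.mono (min_le_left _ _)

/-- On the cross-section `{M x = α}`, closeness to the cycle is closeness to its first half, since
`M` exceeds `α` on the second half up to its end, where the first half begins. -/
theorem exists_crossSection_near (hW : S.IsCycle W₁ W₂) {η : ℝ≥0∞} (hη : 0 < η) : ∃ ε, 0 < ε ∧
    ∀ q ∈ S.crossSection S.α, S.NearCycle W₁ W₂ ε q →
      ∃ t ∈ Icc 0 S.T, S.sdist q (S.stateAt W₁ t) < η := by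
  have hT := S.T_pos
  obtain ⟨K, hK⟩ := hW.lip₂
  obtain ⟨η', hη'0, hη'⟩ := exists_between hη
  obtain ⟨ε₁, hε₁, -, hε₁η⟩ := exists_pos_ofReal_lt (tsub_pos_of_lt hη') one_pos
  obtain ⟨ζ, hζ, Hζ⟩ := hK.exists_sdist_le hη'0
  obtain ⟨g, hg, hgW⟩ : ∃ g > 0, ∀ t ∈ Icc 0 (S.T - ζ), S.α + g ≤ S.M (W₂ t) := by
    rcases lt_or_ge (S.T - ζ) 0 with h | h
    · exact ⟨1, one_pos, fun t ht => absurd (ht.1.trans ht.2) (not_le.2 h)⟩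
    obtain ⟨x, hx, hmin⟩ := isCompact_Icc.exists_isMinOn (nonempty_Icc.2 h)
      ((hW.sol₂.integralSol (S.T - ζ)).continuousOn_M)
    refine ⟨S.M (W₂ x) - S.α, sub_pos.2 (hW.gt₂ x ⟨hx.1, by linarith [hx.2]⟩), fun t ht => ?_⟩
    have : S.M (W₂ x) ≤ S.M (W₂ t) := hmin ht
    linarith
  -- within `κ` of a state of the second half, `M x = α` excludes the times before `T - ζ`
  set κ : ℝ := g / (‖S.Mop‖ + 1) with hκ
  have hκ0 : 0 < κ := by positivity
  have hκg : κ * (‖S.Mop‖ + 1) = g := div_mul_cancel₀ _ (by positivity)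
  refine ⟨min ε₁ κ, lt_min hε₁ hκ0, fun q hq hn => ?_⟩
  obtain ⟨-, x, hx, h | h⟩ := hn
  · refine ⟨x, hx, (h.trans (ENNReal.ofReal_le_ofReal (min_le_left _ _))).trans_lt
      (hε₁η.trans_le tsub_le_self)⟩
  · refine ⟨0, ⟨le_rfl, hT.le⟩, ?_⟩
    have hxT : S.T - ζ < x := by
      by_contra hcon
      have h1 := hgW x ⟨hx.1, not_lt.1 hcon⟩
      have h2 : ‖q.2 - W₂ x‖ₑ ≤ ENNReal.ofReal κ :=
        (le_add_self.trans h).trans (ENNReal.ofReal_le_ofReal (min_le_right _ _))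
      rw [← ofReal_norm, ENNReal.ofReal_le_ofReal_iff hκ0.le] at h2
      have h3 := S.Mop.le_opNorm (q.2 - W₂ x)
      rw [map_sub, Mop_apply, Mop_apply, hq.2, Real.norm_eq_abs] at h3
      have h4 := (abs_le.1 h3).1
      nlinarith [norm_nonneg S.Mop]
    have hx2 : x ∈ Icc 0 (2 * S.T) := ⟨hx.1, by linarith [hx.2]⟩
    have hT2 : S.T ∈ Icc 0 (2 * S.T) := ⟨hT.le, by linarith⟩
    rw [← hW.link₂.sdist_right]
    refine (sdist_triangle hq.1.1.1 (hK.aestronglyMeasurable hx2)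
      (hK.aestronglyMeasurable hT2)).trans_lt ?_
    have h5 := Hζ x hx2 S.T hT2 (by rw [abs_of_nonpos (by linarith [hx.2])]; linarith)
    calc _ ≤ ENNReal.ofReal ε₁ + η' :=
          add_le_add (h.trans (ENNReal.ofReal_le_ofReal (min_le_left _ _))) h5
      _ < η := by rw [add_comm]; exact lt_tsub_iff_left.1 hε₁η

/-- A solution that stays near the cycle keeps returning to the cross-section, and its returns are
the iterates of the Poincaré map. -/
theorem exists_returns_of_nearCycle (hW : S.IsCycle W₁ W₂) (hε : 0 < ε) : ∃ ε', 0 < ε' ∧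
    (∀ q ∈ S.crossSection S.α, S.NearCycle W₁ W₂ ε' q →
      q ∈ S.domP ∧ S.sdist (S.P q) (S.stateAt W₁ 0) ≤ ENNReal.ofReal ε) ∧
    ∀ q ∈ S.crossSection S.α, ∀ v, S.IsSolution q v →
      (∀ t ≥ 0, S.NearCycle W₁ W₂ ε' (S.stateAt v t)) → ∀ n : ℕ,
        S.P^[n] q ∈ S.crossSection S.α ∧
        ∃ s : ℝ, n * (S.T / 2) ≤ s ∧ S.StateEq (S.stateAt v s) (S.P^[n] q) := by
  have hT := S.T_pos
  obtain ⟨δ, hδ, H⟩ := hW.exists_return hε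
  obtain ⟨ε', hε', H'⟩ := hW.exists_crossSection_near hδ
  refine ⟨ε', hε', fun q hq hn => ?_, fun q hq v hv hn n => ?_⟩
  · obtain ⟨t, ht, h⟩ := H' q hq hn
    have := H t ht q hq.1 h (by rw [hq.2]; exact S.α_lt_β)
    exact ⟨this.1 hq.2, this.2.2.1⟩
  · suffices h : S.P^[n] q ∈ S.crossSection S.α ∧ ∃ s : ℝ, n * (S.T / 2) ≤ s ∧
        S.IsSolution (S.P^[n] q) (fun r => v (s + r)) from
      ⟨h.1, h.2.imp fun s hs => ⟨hs.1, hs.2.stateEq_of_shift⟩⟩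
    induction n with
    | zero => exact ⟨hq, 0, by simp, by simpa using hv⟩
    | succ n ih =>
      obtain ⟨hc, s, hs, hvs⟩ := ih
      have hs0 : 0 ≤ s := le_trans (by positivity) hs
      obtain ⟨t, ht, h⟩ := H' _ hc ((hn s hs0).congr hvs.stateEq_of_shift)
      obtain ⟨-, h1, -, h2⟩ := H t ht _ hc.1 h (by rw [hc.2]; exact S.α_lt_β)
      obtain ⟨s', hs', hv', -⟩ := h2 _ hvs
      rw [Function.iterate_succ_apply']
      refine ⟨h1, s + s', ?_, by simpa only [add_assoc] using hv'⟩
      push_cast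
      linarith

/-- If the iterates of the Poincaré map stay near the start of the cycle then the solution stays
near the cycle. -/
theorem exists_nearCycle_of_iterates (hW : S.IsCycle W₁ W₂) (hε : 0 < ε) : ∃ δ : ℝ≥0∞, 0 < δ ∧
    ∀ q ∈ S.crossSection S.α, ∀ v, S.IsSolution q v →
      (∀ n : ℕ, S.sdist (S.P^[n] q) (S.stateAt W₁ 0) < δ) →
        (∀ n : ℕ, S.P^[n] q ∈ S.crossSection S.α ∧
          ∃ s : ℝ, 0 ≤ s ∧ S.IsSolution (S.P^[n] q) (fun r => v (s + r))) ∧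
        ∀ t ≥ 0, S.NearCycle W₁ W₂ ε (S.stateAt v t) := by
  have hT := S.T_pos
  obtain ⟨δ, hδ, H⟩ := hW.exists_return hε
  refine ⟨δ, hδ, fun q hq v hv hn => ?_⟩
  have key : ∀ n : ℕ, S.P^[n] q ∈ S.crossSection S.α ∧ ∃ s : ℝ, n * (S.T / 2) ≤ s ∧
      S.IsSolution (S.P^[n] q) (fun r => v (s + r)) ∧
      ∀ r ∈ Ico 0 s, S.NearCycle W₁ W₂ ε (S.stateAt v r) := by
    intro n
    induction n with
    | zero => exact ⟨hq, 0, by simp, by simpa using hv, by simp⟩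
    | succ n ih =>
      obtain ⟨hc, s, hs, hvs, hnear⟩ := ih
      obtain ⟨-, h1, -, h2⟩ := H 0 ⟨le_rfl, hT.le⟩ _ hc.1 (hn n) (by rw [hc.2]; exact S.α_lt_β)
      obtain ⟨s', hs', hv', hn'⟩ := h2 _ hvs
      rw [Function.iterate_succ_apply']
      refine ⟨h1, s + s', ?_, by simpa only [add_assoc] using hv', fun r hr => ?_⟩
      · push_cast
        linarith
      · rcases lt_or_ge r s with h | h
        · exact hnear r ⟨hr.1, h⟩
        · have := hn' (r - s) ⟨by linarith, by linarith [hr.2]⟩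
          have e : S.stateAt (fun r => v (s + r)) (r - s) = S.stateAt v r := by
            simp only [stateAt, ← add_assoc, add_sub_cancel]
          rwa [e] at this
  refine ⟨fun n => ⟨(key n).1, ?_⟩, fun t ht => ?_⟩
  · obtain ⟨-, s, hs, hvs, -⟩ := key n
    exact ⟨s, le_trans (by positivity) hs, hvs⟩
  · obtain ⟨n, hn⟩ := exists_nat_gt (t / (S.T / 2))
    obtain ⟨-, s, hs, -, hnear⟩ := key n
    rw [div_lt_iff₀ (by positivity)] at hn
    exact hnear t ⟨ht, hn.trans_le hs⟩

/-- Solutions starting near the cycle reach the cross-section `{M x = α}` near the start of the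
cycle. -/
theorem exists_reach (hW : S.IsCycle W₁ W₂) (hε : 0 < ε) : ∃ δ : ℝ≥0∞, 0 < δ ∧
    ∀ t ∈ Icc 0 S.T, ∀ q ∈ S.phase,
      (S.sdist q (S.stateAt W₁ t) < δ ∧ S.M q.2 < S.β ∨
        S.sdist q (S.stateAt W₂ t) < δ ∧ S.β ≤ S.M q.2) →
      ∀ v, S.IsSolution q v → ∃ q' ∈ S.crossSection S.α,
        S.sdist q' (S.stateAt W₁ 0) ≤ ENNReal.ofReal ε ∧
        ∃ s, 0 ≤ s ∧ S.IsSolution q' (fun r => v (s + r)) ∧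
          ∀ r ∈ Icc 0 s, S.NearCycle W₁ W₂ ε (S.stateAt v r) := by
  obtain ⟨δ₁, hδ₁, H₁⟩ := hW.exists_return hε
  obtain ⟨δ₂, hδ₂, H₂⟩ := hW.exists_second_half hε
  refine ⟨min δ₁ δ₂, lt_min hδ₁ hδ₂, ?_⟩
  rintro t ht q hq (⟨h, h'⟩ | ⟨h, h'⟩) v hv
  · obtain ⟨-, a1, a2, a3⟩ := H₁ t ht q hq (h.trans_le (min_le_left _ _)) h'
    obtain ⟨s, hs, hvs, hn⟩ := a3 v hv
    exact ⟨_, a1, a2, s, by linarith [S.T_pos], hvs, hn⟩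
  · obtain ⟨-, a1, a2, a3⟩ := H₂ t ht q hq (h.trans_le (min_le_right _ _)) h'
    obtain ⟨s, hs, -, hvs, hn⟩ := a3 v hv
    exact ⟨_, a1, a2, s, hs.le, hvs, hn⟩

theorem isFixedPoint (hW : S.IsCycle W₁ W₂) (hq : q ∈ S.phase)
    (e : S.StateEq q (S.stateAt W₁ 0)) : S.IsFixedPoint q := by
  have hα : S.M q.2 = S.α := by rw [e.2]; exact hW.start
  have key : ∀ ε : ℝ, 0 < ε → q ∈ S.domP ∧ S.sdist (S.P q) q ≤ ENNReal.ofReal ε := fun ε hε => by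
    obtain ⟨δ, hδ, H⟩ := hW.exists_return hε
    obtain ⟨h1, -, h2, -⟩ := H 0 ⟨le_rfl, S.T_pos.le⟩ q hq (by rwa [e.sdist_eq_zero])
      (by rw [hα]; exact S.α_lt_β)
    exact ⟨h1 hα, by rwa [e.sdist_right]⟩
  refine ⟨(key 1 one_pos).1, ?_⟩
  by_contra hne
  obtain ⟨ε, hε, -, h⟩ := exists_pos_ofReal_lt (pos_iff_ne_zero.2 hne) one_pos
  exact absurd (key ε hε).2 (not_le.2 h)

end IsCycle

end Near

end Setting

namespace Setting

variable {N : ℕ} [NeZero N] {S : Setting N}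

/-! ### Orbital stability and stability of the fixed point -/

/-- If every state of a Lipschitz arc has a neighbourhood in `Ω`, then the radii of these
neighbourhoods can be chosen independently of the state. -/
theorem IsLip.exists_uniform_nhd {K : ℝ} {W : ℝ → Vec N} (hW : S.IsLip K W) {Ω : Set S.State}
    (hΩ : ∀ x ∈ Icc 0 S.T, ∃ ε : ℝ≥0∞, 0 < ε ∧ ∀ q ∈ S.phase,
      S.sdist q (S.stateAt W x) < ε → q ∈ Ω) :
    ∃ ε : ℝ, 0 < ε ∧ ∀ x ∈ Icc 0 S.T, ∀ q ∈ S.phase,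
      S.sdist q (S.stateAt W x) ≤ ENNReal.ofReal ε → q ∈ Ω := by
  have hT := S.T_pos
  have h2 : ∀ {x}, x ∈ Icc 0 S.T → x ∈ Icc 0 (2 * S.T) := fun hx => ⟨hx.1, by linarith [hx.2]⟩
  suffices h : ∃ ε : ℝ, 0 < ε ∧ ∀ x ∈ Icc 0 S.T, x ∈ Icc 0 S.T → ∀ q ∈ S.phase,
      S.sdist q (S.stateAt W x) ≤ ENNReal.ofReal ε → q ∈ Ω from
    h.imp fun ε hε => ⟨hε.1, fun x hx => hε.2 x hx hx⟩
  refine (isCompact_Icc (a := (0 : ℝ)) (b := S.T)).induction_on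
    (p := fun s => ∃ ε : ℝ, 0 < ε ∧ ∀ x ∈ s, x ∈ Icc 0 S.T → ∀ q ∈ S.phase,
      S.sdist q (S.stateAt W x) ≤ ENNReal.ofReal ε → q ∈ Ω) ⟨1, one_pos, by simp⟩
    (fun s t hst ⟨ε, hε, H⟩ => ⟨ε, hε, fun x hx => H x (hst hx)⟩) ?_ fun x hx => ?_
  · rintro s t ⟨ε, hε, H⟩ ⟨ε', hε', H'⟩
    refine ⟨min ε ε', lt_min hε hε', ?_⟩
    rintro x (hx | hx) hxI q hq h
    · exact H x hx hxI q hq (h.trans (ENNReal.ofReal_le_ofReal (min_le_left _ _)))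
    · exact H' x hx hxI q hq (h.trans (ENNReal.ofReal_le_ofReal (min_le_right _ _)))
  · obtain ⟨ρ, hρ, H⟩ := hΩ x hx
    obtain ⟨ρ', hρ'0, hρ'⟩ := exists_between hρ
    obtain ⟨ε, hε, -, hερ⟩ := exists_pos_ofReal_lt (tsub_pos_of_lt hρ') one_pos
    obtain ⟨ζ, hζ, Hζ⟩ := hW.exists_sdist_le hρ'0
    refine ⟨Metric.closedBall x ζ, mem_nhdsWithin_of_mem_nhds (Metric.closedBall_mem_nhds x hζ),
      ε, hε, fun y hy hyI q hq h => H q hq ?_⟩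
    refine (sdist_triangle hq.1.1 (hW.aestronglyMeasurable (h2 hyI))
      (hW.aestronglyMeasurable (h2 hx))).trans_lt ?_
    calc _ ≤ ENNReal.ofReal ε + ρ' := add_le_add h (Hζ y (h2 hyI) x (h2 hx) hy)
      _ < ρ := by rw [add_comm]; exact lt_tsub_iff_left.1 hερ

/-- The halves `W₁`, `W₂` of a cycle that represents the orbit of `u`, which starts at `q`. -/
structure IsCycleOf (S : Setting N) (u : ℝ → Vec N) (q : S.State) (W₁ W₂ : ℝ → Vec N) : Prop
    extends S.IsCycle W₁ W₂ where
  start_eq : S.StateEq q (S.stateAt W₁ 0)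
  orbit₁ : ∀ t ∈ Icc 0 S.T, S.StateEq (S.stateAt u t) (S.stateAt W₁ t)
  orbit₂ : ∀ t ∈ Icc 0 S.T, S.StateEq (S.stateAt u (S.T + t)) (S.stateAt W₂ t)

namespace IsCycleOf

variable {u W₁ W₂ : ℝ → Vec N} {q : S.State} {ε : ℝ}

theorem mem_Γ₁ (hW : S.IsCycleOf u q W₁ W₂) {r : S.State} (hr : r ∈ S.Γ₁ u) :
    ∃ t ∈ Icc 0 S.T, S.StateEq r (S.stateAt W₁ t) := by
  obtain ⟨t, ht, rfl⟩ := hr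
  exact ⟨t, ht, hW.orbit₁ t ht⟩

theorem mem_Γ₂ (hW : S.IsCycleOf u q W₁ W₂) {r : S.State} (hr : r ∈ S.Γ₂ u) :
    ∃ t ∈ Icc 0 S.T, S.StateEq r (S.stateAt W₂ t) := by
  obtain ⟨t, ht, rfl⟩ := hr
  have := hW.orbit₂ (t - S.T) ⟨by linarith [ht.1], by linarith [ht.2]⟩
  rw [add_sub_cancel] at this
  exact ⟨t - S.T, ⟨by linarith [ht.1], by linarith [ht.2]⟩, this⟩

theorem stateAt_mem_Γ₁ {t : ℝ} (ht : t ∈ Icc 0 S.T) : S.stateAt u t ∈ S.Γ₁ u := ⟨t, ht, rfl⟩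

theorem stateAt_mem_Γ₂ {t : ℝ} (ht : t ∈ Icc 0 S.T) : S.stateAt u (S.T + t) ∈ S.Γ₂ u :=
  ⟨_, ⟨by linarith [ht.1], by linarith [ht.2]⟩, rfl⟩

theorem nearCycle_of_setDist_lt (hW : S.IsCycleOf u q W₁ W₂) {r : S.State} (hr : r ∈ S.phase)
    (h : S.setDist r (S.Γ u) < ENNReal.ofReal ε) : S.NearCycle W₁ W₂ ε r := by
  obtain ⟨r', h⟩ := iInf_lt_iff.1 h
  obtain ⟨hr' | hr', h⟩ := iInf_lt_iff.1 h
  · obtain ⟨t, ht, e⟩ := hW.mem_Γ₁ hr'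
    rw [e.sdist_right] at h
    exact ⟨hr, t, ht, Or.inl h.le⟩
  · obtain ⟨t, ht, e⟩ := hW.mem_Γ₂ hr'
    rw [e.sdist_right] at h
    exact ⟨hr, t, ht, Or.inr h.le⟩

theorem setDist_le_of_nearCycle (hW : S.IsCycleOf u q W₁ W₂) {r : S.State}
    (h : S.NearCycle W₁ W₂ ε r) : S.setDist r (S.Γ u) ≤ ENNReal.ofReal ε := by
  obtain ⟨-, t, ht, h | h⟩ := h
  · rw [← (hW.orbit₁ t ht).sdist_right] at h
    have hm : S.stateAt u t ∈ S.Γ u := Or.inl (stateAt_mem_Γ₁ ht)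
    exact (iInf₂_le (f := fun q' _ => S.sdist r q') _ hm).trans h
  · rw [← (hW.orbit₂ t ht).sdist_right] at h
    have hm : S.stateAt u (S.T + t) ∈ S.Γ u := Or.inr (stateAt_mem_Γ₂ ht)
    exact (iInf₂_le (f := fun q' _ => S.sdist r q') _ hm).trans h

theorem isNhd_nearCycle (hW : S.IsCycleOf u q W₁ W₂) (hε : 0 < ε) :
    S.IsNhd {r | S.NearCycle W₁ W₂ ε r} (S.Γ u) := by
  refine ⟨fun r hr => hr.1, fun r hr => ⟨ENNReal.ofReal ε, ENNReal.ofReal_pos.2 hε,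
    fun r' hr' h => hW.nearCycle_of_setDist_lt hr' ((iInf₂_le r hr).trans_lt h)⟩⟩

theorem exists_nearCycle_subset (hW : S.IsCycleOf u q W₁ W₂) {Ω : Set S.State}
    (hΩ : S.IsNhd Ω (S.Γ u)) : ∃ ε, 0 < ε ∧ ∀ r, S.NearCycle W₁ W₂ ε r → r ∈ Ω := by
  obtain ⟨K₁, hK₁⟩ := hW.lip₁
  obtain ⟨K₂, hK₂⟩ := hW.lip₂
  obtain ⟨ε₁, hε₁, H₁⟩ := hK₁.exists_uniform_nhd (Ω := Ω) fun x hx => by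
    simpa only [(hW.orbit₁ x hx).sdist_right] using hΩ.2 _ (Or.inl (stateAt_mem_Γ₁ hx))
  obtain ⟨ε₂, hε₂, H₂⟩ := hK₂.exists_uniform_nhd (Ω := Ω) fun x hx => by
    simpa only [(hW.orbit₂ x hx).sdist_right] using hΩ.2 _ (Or.inr (stateAt_mem_Γ₂ hx))
  refine ⟨min ε₁ ε₂, lt_min hε₁ hε₂, ?_⟩
  rintro r ⟨hr, x, hx, h | h⟩
  · exact H₁ x hx r hr (h.trans (ENNReal.ofReal_le_ofReal (min_le_left _ _)))
  · exact H₂ x hx r hr (h.trans (ENNReal.ofReal_le_ofReal (min_le_right _ _)))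

theorem isNhd_Γ₁ (hW : S.IsCycleOf u q W₁ W₂) {δ : ℝ≥0∞} (hδ : 0 < δ) :
    S.IsNhd {r | r ∈ S.phase ∧ ∃ t ∈ Icc 0 S.T, S.sdist r (S.stateAt W₁ t) < δ} (S.Γ₁ u) := by
  refine ⟨fun r hr => hr.1, fun r hr => ⟨δ, hδ, fun r' hr' h => ?_⟩⟩
  obtain ⟨t, ht, e⟩ := hW.mem_Γ₁ hr
  exact ⟨hr', t, ht, by rwa [← e.sdist_right]⟩

theorem isNhd_Γ₂ (hW : S.IsCycleOf u q W₁ W₂) {δ : ℝ≥0∞} (hδ : 0 < δ) :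
    S.IsNhd {r | r ∈ S.phase ∧ ∃ t ∈ Icc 0 S.T, S.sdist r (S.stateAt W₂ t) < δ} (S.Γ₂ u) := by
  refine ⟨fun r hr => hr.1, fun r hr => ⟨δ, hδ, fun r' hr' h => ?_⟩⟩
  obtain ⟨t, ht, e⟩ := hW.mem_Γ₂ hr
  exact ⟨hr', t, ht, by rwa [← e.sdist_right]⟩

/-- A neighbourhood of the first half of the orbit contains the points of the cross-section
`{M x = α}` near `q`, and the hysteresis starts at `1` there. -/
theorem exists_mem_startIn (hW : S.IsCycleOf u q W₁ W₂) {Ω₁ : Set S.State} (Ω₂ : Set S.State)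
    (hΩ₁ : S.IsNhd Ω₁ (S.Γ₁ u)) : ∃ δ : ℝ≥0∞, 0 < δ ∧
      ∀ q' ∈ S.crossSection S.α, S.sdist q' q < δ → q' ∈ S.startIn Ω₁ Ω₂ := by
  have h0 : (0 : ℝ) ∈ Icc 0 S.T := ⟨le_rfl, S.T_pos.le⟩
  obtain ⟨δ, hδ, H⟩ := hΩ₁.2 _ (stateAt_mem_Γ₁ h0)
  refine ⟨δ, hδ, fun q' hq' h => Or.inl ⟨H q' hq'.1 ?_, by rw [hq'.2]; exact S.α_lt_β⟩⟩
  rwa [(hW.orbit₁ 0 h0).sdist_right, ← hW.start_eq.sdist_right]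

/-- Orbital stability implies stability of the fixed point. The second assertion relates the
iterates of the Poincaré map to the solution. -/
theorem stable_of_orbitallyStable (hW : S.IsCycleOf u q W₁ W₂) (hu : S.OrbitallyStable u)
    {ε : ℝ≥0∞} (hε : 0 < ε) : ∃ δ : ℝ≥0∞, 0 < δ ∧
      ∀ q' ∈ S.crossSection S.α, S.sdist q' q ≤ δ →
        (∀ n : ℕ, S.P^[n] q' ∈ S.domP ∧ S.sdist (S.P^[n] q') q ≤ ε) ∧
        ∀ v, S.IsSolution q' v → ∀ n : ℕ, S.P^[n] q' ∈ S.crossSection S.α ∧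
          ∃ s : ℝ, n * (S.T / 2) ≤ s ∧ S.StateEq (S.stateAt v s) (S.P^[n] q') := by
  obtain ⟨ε₀, hε₀, -, hε₀ε⟩ := exists_pos_ofReal_lt hε one_pos
  obtain ⟨ε', hε', H, Hret⟩ := hW.exists_returns_of_nearCycle hε₀
  obtain ⟨Ω₁, Ω₂, hΩ₁, -, HΩ⟩ := hu _ (hW.isNhd_nearCycle hε')
  obtain ⟨δ₁, hδ₁, Hδ⟩ := hW.exists_mem_startIn Ω₂ hΩ₁
  obtain ⟨δ, hδ, hδlt⟩ := exists_between (lt_min hδ₁ hε)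
  refine ⟨δ, hδ, fun q' hq' h => ?_⟩
  have hnear : ∀ v, S.IsSolution q' v → ∀ t ≥ 0, S.NearCycle W₁ W₂ ε' (S.stateAt v t) :=
    fun v hv t ht => HΩ q' (Hδ q' hq' (h.trans_lt (hδlt.trans_le (min_le_left _ _)))) v hv
      ⟨t, ht, rfl⟩
  refine ⟨?_, fun v hv => Hret q' hq' v hv (hnear v hv)⟩
  obtain ⟨v, hv⟩ := exists_isSolution hq'.1
  have key : ∀ n : ℕ, S.P^[n] q' ∈ S.domP ∧
      S.sdist (S.P^[n + 1] q') (S.stateAt W₁ 0) ≤ ENNReal.ofReal ε₀ := fun n => by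
    obtain ⟨h1, s, hs, e⟩ := Hret q' hq' v hv (hnear v hv) n
    rw [Function.iterate_succ_apply']
    exact H _ h1 ((hnear v hv s (le_trans (by have := S.T_pos; positivity) hs)).congr e)
  intro n
  refine ⟨(key n).1, ?_⟩
  cases n with
  | zero => exact h.trans (hδlt.le.trans (min_le_right _ _))
  | succ n => rw [hW.start_eq.sdist_right]; exact (key n).2.trans hε₀ε.le

/-- Stability of the fixed point implies orbital stability: nearby solutions reach the
cross-section near the fixed point, and then the returns stay near it. -/
theorem orbitallyStable_of_stable (hW : S.IsCycleOf u q W₁ W₂) (hq : S.StableFixedPoint q) :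
    S.OrbitallyStable u := by
  intro Ω hΩ
  obtain ⟨ε, hε, Hε⟩ := hW.exists_nearCycle_subset hΩ
  obtain ⟨δ, hδ, Hδ⟩ := hW.exists_nearCycle_of_iterates hε
  obtain ⟨δ', hδ', hδ'δ⟩ := exists_between hδ
  obtain ⟨ρ, hρ, Hρ⟩ := hq δ' hδ'
  obtain ⟨ε₁, hε₁, hε₁ε, hε₁ρ⟩ := exists_pos_ofReal_lt hρ hε
  obtain ⟨κ, hκ, Hκ⟩ := hW.exists_reach hε₁
  refine ⟨_, _, hW.isNhd_Γ₁ hκ, hW.isNhd_Γ₂ hκ, ?_⟩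
  intro q₀ hq₀ v hv
  obtain ⟨q', hq', hd, s, hs, hvs, hn⟩ : ∃ q' ∈ S.crossSection S.α,
        S.sdist q' (S.stateAt W₁ 0) ≤ ENNReal.ofReal ε₁ ∧
        ∃ s, 0 ≤ s ∧ S.IsSolution q' (fun r => v (s + r)) ∧
          ∀ r ∈ Icc 0 s, S.NearCycle W₁ W₂ ε₁ (S.stateAt v r) := by
    rcases hq₀ with ⟨⟨h1, t, ht, h2⟩, h3⟩ | ⟨⟨h1, t, ht, h2⟩, h3⟩
    · exact Hκ t ht q₀ h1 (Or.inl ⟨h2, h3⟩) v hv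
    · exact Hκ t ht q₀ h1 (Or.inr ⟨h2, h3⟩) v hv
  have hit := Hρ q' hq' (by rw [hW.start_eq.sdist_right]; exact hd.trans hε₁ρ.le)
  have hnear := (Hδ q' hq' _ hvs fun n => by
    rw [← hW.start_eq.sdist_right]; exact (hit n).2.trans_lt hδ'δ).2
  rintro _ ⟨t, ht, rfl⟩
  refine Hε _ ?_
  rcases le_total t s with h | h
  · exact (hn t ⟨ht, h⟩).mono hε₁ε
  · have := hnear (t - s) (by linarith)
    have e : S.stateAt (fun r => v (s + r)) (t - s) = S.stateAt v t := by
      simp only [stateAt, ← add_assoc, add_sub_cancel]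
    rwa [e] at this

/-- Returns to the cross-section at times tending to infinity approach the cycle, and hence the
fixed point. -/
theorem asymptoticallyStable_of_orbitally (hW : S.IsCycleOf u q W₁ W₂)
    (hu : S.OrbitallyAsymptoticallyStable u) : S.AsymptoticallyStableFixedPoint q := by
  have hT := S.T_pos
  obtain ⟨hs, Θ₁, Θ₂, hΘ₁, -, HΘ⟩ := hu
  intro ε hε
  obtain ⟨δ₁, hδ₁, H₁⟩ := hW.stable_of_orbitallyStable hs hε
  obtain ⟨δ₂, hδ₂, H₂⟩ := hW.exists_mem_startIn Θ₂ hΘ₁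
  obtain ⟨δ, hδ, hδlt⟩ := exists_between (lt_min hδ₁ hδ₂)
  refine ⟨δ, hδ, fun q' hq' h => ?_⟩
  obtain ⟨h1, h2⟩ := H₁ q' hq' (h.trans (hδlt.le.trans (min_le_left _ _)))
  refine ⟨h1, ?_⟩
  obtain ⟨v, hv⟩ := exists_isSolution hq'.1
  have hlim := HΘ q' (H₂ q' hq' (h.trans_lt (hδlt.trans_le (min_le_right _ _)))) v hv
  rw [← tendsto_add_atTop_iff_nat 1, ENNReal.tendsto_nhds_zero]
  intro η hη
  obtain ⟨η₀, hη₀, -, hη₀η⟩ := exists_pos_ofReal_lt hη one_pos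
  obtain ⟨ε', hε', H, -⟩ := hW.exists_returns_of_nearCycle hη₀
  obtain ⟨t₀, ht₀⟩ := eventually_atTop.1
    (hlim.eventually_lt_const (ENNReal.ofReal_pos.2 hε'))
  obtain ⟨n₀, hn₀⟩ := exists_nat_ge (t₀ / (S.T / 2))
  refine eventually_atTop.2 ⟨n₀, fun n hn => ?_⟩
  obtain ⟨hc, s, hs, e⟩ := h2 v hv n
  have hts : t₀ ≤ s := by
    rw [div_le_iff₀ (by positivity)] at hn₀
    have : (n₀ : ℝ) ≤ n := by exact_mod_cast hn
    nlinarith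
  have hnear := (hW.nearCycle_of_setDist_lt (e.symm.mem_phase hc.1) (ht₀ s hts)).congr e
  rw [Function.iterate_succ_apply', hW.start_eq.sdist_right]
  exact (H _ hc hnear).2.trans hη₀η.le

/-- Once a return is sufficiently close to the fixed point, together with all later ones, the
solution stays close to the cycle. -/
theorem orbitally_of_asymptoticallyStable (hW : S.IsCycleOf u q W₁ W₂)
    (hq : S.AsymptoticallyStableFixedPoint q) : S.OrbitallyAsymptoticallyStable u := by
  refine ⟨hW.orbitallyStable_of_stable fun ε hε => ?_, ?_⟩
  · obtain ⟨δ, hδ, H⟩ := hq ε hε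
    exact ⟨δ, hδ, fun q' hq' h => (H q' hq' h).1⟩
  obtain ⟨δ, hδ, Hδ⟩ := hW.exists_nearCycle_of_iterates one_pos
  obtain ⟨δ', hδ', hδ'δ⟩ := exists_between hδ
  obtain ⟨ρ, hρ, Hρ⟩ := hq δ' hδ'
  obtain ⟨ε₁, hε₁, -, hε₁ρ⟩ := exists_pos_ofReal_lt hρ one_pos
  obtain ⟨κ, hκ, Hκ⟩ := hW.exists_reach hε₁
  refine ⟨_, _, hW.isNhd_Γ₁ hκ, hW.isNhd_Γ₂ hκ, ?_⟩
  intro q₀ hq₀ v hv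
  obtain ⟨q', hq', hd, s, hs, hvs, -⟩ : ∃ q' ∈ S.crossSection S.α,
        S.sdist q' (S.stateAt W₁ 0) ≤ ENNReal.ofReal ε₁ ∧
        ∃ s, 0 ≤ s ∧ S.IsSolution q' (fun r => v (s + r)) ∧
          ∀ r ∈ Icc 0 s, S.NearCycle W₁ W₂ ε₁ (S.stateAt v r) := by
    rcases hq₀ with ⟨⟨h1, t, ht, h2⟩, h3⟩ | ⟨⟨h1, t, ht, h2⟩, h3⟩
    · exact Hκ t ht q₀ h1 (Or.inl ⟨h2, h3⟩) v hv
    · exact Hκ t ht q₀ h1 (Or.inr ⟨h2, h3⟩) v hv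
  obtain ⟨hit, hlim⟩ := Hρ q' hq' (by rw [hW.start_eq.sdist_right]; exact hd.trans hε₁ρ.le)
  have hret := (Hδ q' hq' _ hvs fun n => by
    rw [← hW.start_eq.sdist_right]; exact (hit n).2.trans_lt hδ'δ).1
  rw [ENNReal.tendsto_nhds_zero]
  intro η hη
  obtain ⟨η₀, hη₀, -, hη₀η⟩ := exists_pos_ofReal_lt hη one_pos
  obtain ⟨δη, hδη, Hη⟩ := hW.exists_nearCycle_of_iterates hη₀
  obtain ⟨n₀, hn₀⟩ := eventually_atTop.1 (hlim.eventually_lt_const hδη)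
  obtain ⟨hc, s', hs', hv'⟩ := hret n₀
  have hnear := (Hη _ hc _ hv' fun n => by
    rw [← hW.start_eq.sdist_right, ← Function.iterate_add_apply]
    exact hn₀ _ (Nat.le_add_left _ _)).2
  refine eventually_atTop.2 ⟨s + s', fun t ht => ?_⟩
  have := hnear (t - (s + s')) (by linarith)
  have e : S.stateAt (fun r => v (s + (s' + r))) (t - (s + s')) = S.stateAt v t := by
    simp only [stateAt, ← add_assoc, add_sub_cancel]
  rw [e] at this
  exact (hW.setDist_le_of_nearCycle this).trans hη₀η.le

end IsCycleOf

end Setting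

end HystDelay

end

theorem theorem4p11 {N : ℕ} [NeZero N] (S : HystDelay.Setting N)
    (qα : S.State) (u : ℝ → HystDelay.Vec N) (hu : S.IsSymmetricPeriodic qα u) :
    S.IsFixedPoint qα ∧
    (S.OrbitallyAsymptoticallyStable u ↔ S.AsymptoticallyStableFixedPoint qα) ∧
    (S.OrbitallyStable u ↔ S.StableFixedPoint qα) ∧
    (S.OrbitallyUnstable u ↔ S.UnstableFixedPoint qα) := by
  obtain ⟨W₁, W₂, hc, hst, h₁, h₂⟩ := hu.exists_isCycle
  have hW : S.IsCycleOf u qα W₁ W₂ := { hc with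
    start_eq := hst
    orbit₁ := h₁
    orbit₂ := h₂ }
  have hstable : S.OrbitallyStable u ↔ S.StableFixedPoint qα := by
    refine ⟨fun h ε hε => ?_, hW.orbitallyStable_of_stable⟩
    obtain ⟨δ, hδ, H⟩ := hW.stable_of_orbitallyStable h hε
    exact ⟨δ, hδ, fun q' hq' hd => (H q' hq' hd).1⟩
  exact ⟨hc.isFixedPoint hu.mem_phase hst,
    ⟨hW.asymptoticallyStable_of_orbitally, hW.orbitally_of_asymptoticallyStable⟩,
    hstable, not_congr hstable⟩
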